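/- Let $k$ be a field and let $\mathsf{C}$ be a category whose morphisms form a finite set $S$, and suppose that $\mathsf{C}$ is split: for every $s\in S$ there is $t\in S$ with $s\circ t\circ s=s$. Let $\alpha$ be a $2$-cocycle of $\mathsf{C}$ with values in $k^\times$, that is, $\alpha(u\circ t,s)\alpha(u,t)=\alpha(u,t\circ s)\alpha(t,s)$ whenever $u\circ t\circ s$ exists, and let $A=k_\alpha\mathsf{C}$ be the twisted category algebra: the $k$-vector space with basis $S$ and multiplication $t\cdot s=\alpha(t,s)\,t\circ s$ if $t\circ s$ exists and $t\cdot s=0$ otherwise. Call $s,t\in S$ $\mathscr{J}$-equivalent if $S\circ s\circ S=S\circ t\circ S$, and order the $\mathscr{J}$-classes by $\mathscr{J}(s)\le_{\mathscr J}\mathscr{J}(t)$ iff $S\circ s\circ S\subseteq S\circ t\circ S$. Let $S_1,\dots,S_n$ be the $\mathscr{J}$-classes, numbered such that $S_i<_{\mathscr J}S_j$ implies $i<j$, and let $J_j$ be the $k$-span of $S_1\cup\dots\cup S_j$ (so $J_0=\{0\}$). For each $i$ let $e_i\in S_i$ be an idempotent endomorphism of an object $X_i$, let $\Gamma_{e_i}$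 be the group of units of the monoid $e_i\circ\mathrm{End}_{\mathsf C}(X_i)\circ e_i$ and $J_{e_i}$ the set of its non-units, and put $e_i'=\alpha(e_i,e_i)^{-1}e_i$, an idempotent of $A$. Then $e_i'Ae_i'=k_\alpha\Gamma_{e_i}\oplus kJ_{e_i}$, where the twisted group algebra $k_\alpha\Gamma_{e_i}$ is a unitary subalgebra and $kJ_{e_i}$ is a two-sided ideal. Let $T_{(i,1)},\dots,T_{(i,l_i)}$ be representatives of the isomorphism classes of simple $k_\alpha\Gamma_{e_i}$-modules, let $\tilde T_{(i,r)}$ be the inflation of $T_{(i,r)}$ to $e_i'Ae_i'$ along the projection with kernel $kJ_{e_i}$, and let $f_{(i,r)}$ be the block idempotent of $k_\alpha\Gamma_{e_i}$ (its primitive central idempotent) that does not annihilate $T_{(i,r)}$. Set $\Lambda=\{(i,r): 1\le i\le n,\ 1\le r\le l_i\}$ and $$\Delta_{(i,r)}=Ae_i'\otimes_{e_i'Ae_i'}\tilde T_{(i,r)},\qquad D_{(i,r)}=\Delta_{(i,r)}/\mathrm{Rad}(\Delta_{(i,r)}).$$ For $(i,r),(j,s)\in\Lambda$ write $(i,r)\sqsubset(j,s)$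 if $S_j<_{\mathscr J}S_i$ and, in addition, $f_{(i,r)}J_jf_{(j,s)}\not\subseteq J_{j-1}$ or $f_{(j,s)}J_jf_{(i,r)}\not\subseteq J_{j-1}$. Let $\sqsubseteq$ be the reflexive relation obtained from $\sqsubset$, and let $\unlhd$ be the transitive closure of $\sqsubseteq$; this is a partial order on $\Lambda$. Recall that if $(D_\lambda)_{\lambda\in\Lambda}$ is a finite family of representatives of the isomorphism classes of simple modules of a finite-dimensional algebra, with projective covers $P_\lambda$, and $\le$ is a partial order on $\Lambda$, then the standard module labelled by $\lambda$ is the largest quotient $M$ of $P_\lambda$ such that all composition factors of $\mathrm{Rad}(M)$ are of the form $D_\mu$ with $\mu<\lambda$. The algebra is quasi-hereditary with respect to $(\Lambda,\le)$ if every $P_\lambda$ has a finite filtration whose top quotient is isomorphic to the standard module labelled by $\lambda$ and all of whose other quotients are isomorphic to standard modules labelled by elements $\mu>\lambda$. **Theorem.** Suppose that the group orders $|\Gamma_{e_1}|,\dots,|\Gamma_{e_n}|$ are invertible in $k$. Then the modules $D_\lambda$ ($\lambda\in\Lambda$) form a set of representatives of the isomorphism classes of simple $A$-modules, and $A=k_\alpha\mathsf{C}$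 is quasi-hereditary with respect to $(\Lambda,\unlhd)$. Moreover, for every $(i,r)\in\Lambda$, the $A$-module $\Delta_{(i,r)}$ is the standard module labelled by $(i,r)$ with respect to $(\Lambda,\unlhd)$. -/

import Mathlib

open CategoryTheory
open scoped TensorProduct

universe u v w x y

noncomputable section

/-! ## Modules: simple modules, heads, projective covers, quasi-hereditary algebras -/

section ModuleTheory

variable (R : Type u) [Ring R]

/-- `T` is a complete and irredundant family of simple left `R`-modules up to isomorphism.
(Every simple module is a quotient of `R`, so it is enough to look at the universe of `R`.) -/
structure IsSimpleRepresentatives {ι : Type y} (T : ι → Type x)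
    [∀ i, AddCommGroup (T i)] [∀ i, Module R (T i)] : Prop where
  simple : ∀ i, IsSimpleModule R (T i)
  irredundant : ∀ i j, Nonempty (T i ≃ₗ[R] T j) → i = j
  complete : ∀ (M : Type u) [AddCommGroup M] [Module R M], IsSimpleModule R M →
    ∃ i, Nonempty (M ≃ₗ[R] T i)

/-- The radical of a module: the intersection of its maximal submodules. -/
abbrev moduleRad (M : Type x) [AddCommGroup M] [Module R M] : Submodule R M :=
  Module.jacobson R M

/-- The head `M / Rad(M)`. -/
abbrev Head (M : Type x) [AddCommGroup M] [Module R M] : Type x :=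
  M ⧸ moduleRad R M

variable {R} in
/-- `π : P → D` is a projective cover: `P` is projective, and `π` is an epimorphism whose kernel is
superfluous. -/
structure IsProjectiveCover {P : Type x} [AddCommGroup P] [Module R P]
    {D : Type y} [AddCommGroup D] [Module R D] (π : P →ₗ[R] D) : Prop where
  projective : Module.Projective R P
  surjective : Function.Surjective π
  superfluous : ∀ N : Submodule R P, N ⊔ LinearMap.ker π = ⊤ → N = ⊤

/-- Every composition factor (that is, every simple subquotient `N₁ / N₂`) of the submodule `N` of
`M` is isomorphic to `D μ` for some label `μ` satisfying `p`. -/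
def CompositionFactorsIn {M : Type x} [AddCommGroup M] [Module R M] (N : Submodule R M)
    {Λ : Type*} (D : Λ → Type y) [∀ a, AddCommGroup (D a)] [∀ a, Module R (D a)]
    (p : Λ → Prop) : Prop :=
  ∀ N₁ N₂ : Submodule R M, N₁ ≤ N → N₂ ⋖ N₁ →
    ∃ μ, p μ ∧ Nonempty ((N₁ ⧸ N₂.submoduleOf N₁) ≃ₗ[R] D μ)

/-- `M` is (isomorphic to) the standard module labelled by `a`, with respect to the simple modules
`D` and the partial order `ord` on labels: the largest quotient `P / K` of a projective cover `P`
of `D a` all of whose composition factors in `Rad (P / K)` are of the form `D μ` with `μ < a`. -/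
def IsStandardModule {Λ : Type*} (D : Λ → Type y) [∀ a, AddCommGroup (D a)] [∀ a, Module R (D a)]
    (ord : PartialOrder Λ) (a : Λ) (M : Type x) [AddCommGroup M] [Module R M] : Prop :=
  ∃ (P : Type u) (_ : AddCommGroup P) (_ : Module R P) (π : P →ₗ[R] D a) (K : Submodule R P),
    IsProjectiveCover π ∧
    IsLeast {K' : Submodule R P |
      CompositionFactorsIn R (moduleRad R (P ⧸ K')) D (fun μ => ord.lt μ a)} K ∧
    Nonempty (M ≃ₗ[R] (P ⧸ K))

/-- `P` has a filtration `0 = F 0 ⊂ F 1 ⊂ ⋯ ⊂ F (m + 1) = P` whose top quotient is the standard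
module labelled by `a`, all other quotients being standard modules with labels `μ > a`. -/
def HasStandardFiltration {Λ : Type*} (D : Λ → Type y) [∀ a, AddCommGroup (D a)]
    [∀ a, Module R (D a)] (ord : PartialOrder Λ) (a : Λ)
    (P : Type x) [AddCommGroup P] [Module R P] : Prop :=
  ∃ (m : ℕ) (F : ℕ → Submodule R P),
    F 0 = ⊥ ∧ F (m + 1) = ⊤ ∧ (∀ q ≤ m, F q < F (q + 1)) ∧
    IsStandardModule R D ord a (F (m + 1) ⧸ (F m).submoduleOf (F (m + 1))) ∧
    ∀ q < m, ∃ μ, ord.lt a μ ∧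
      IsStandardModule R D ord μ (F (q + 1) ⧸ (F q).submoduleOf (F (q + 1)))

/-- The (finite-dimensional) algebra `R` is quasi-hereditary with respect to the finite set `Λ`
labelling its simple modules `D`, partially ordered by `ord`. -/
structure IsQuasiHereditary {Λ : Type*} (D : Λ → Type y) [∀ a, AddCommGroup (D a)]
    [∀ a, Module R (D a)] (ord : PartialOrder Λ) : Prop where
  finite : Finite Λ
  simples : IsSimpleRepresentatives R D
  filtration : ∀ a : Λ, ∃ (P : Type u) (_ : AddCommGroup P) (_ : Module R P) (π : P →ₗ[R] D a),
    IsProjectiveCover π ∧ HasStandardFiltration R D ord a P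

/-! ## Block idempotents -/

/-- `f` is the block idempotent (primitive central idempotent) of `R` that belongs to the simple
module `T`, i.e. that does not annihilate `T`. -/
structure IsBlockIdempotent (T : Type x) [AddCommGroup T] [Module R T] (f : R) : Prop where
  idem : IsIdempotentElem f
  central : ∀ a, f * a = a * f
  ne_zero : f ≠ 0
  primitive : ∀ g h : R, IsIdempotentElem g → (∀ a, g * a = a * g) → IsIdempotentElem h →
    (∀ a, h * a = a * h) → g * h = 0 → f = g + h → g = 0 ∨ h = 0
  acts : ∃ t : T, f • t ≠ 0

variable {R}

theorem centralIdempotent_smul_simple {T : Type x} [AddCommGroup T] [Module R T]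
    [IsSimpleModule R T] {f : R} (hf : IsIdempotentElem f) (hc : ∀ a, f * a = a * f) :
    (∀ t : T, f • t = 0) ∨ ∀ t : T, f • t = t := by
  let φ : T →ₗ[R] T :=
    { toFun := fun t => f • t
      map_add' := fun s t => smul_add f s t
      map_smul' := fun r t => by simp only [RingHom.id_apply, ← mul_smul, hc] }
  rcases eq_bot_or_eq_top (LinearMap.range φ) with h | h
  · left
    intro t
    have : φ t ∈ LinearMap.range φ := ⟨t, rfl⟩
    rw [h] at this
    exact this
  · right
    intro t
    have : t ∈ LinearMap.range φ := h ▸ Submodule.mem_top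
    obtain ⟨s, rfl⟩ := this
    change f • f • s = f • s
    rw [← mul_smul, hf.eq]

theorem exists_isBlockIdempotent [IsArtinianRing R] (T : Type x) [AddCommGroup T] [Module R T]
    [IsSimpleModule R T] : ∃ f : R, IsBlockIdempotent R T f := by
  let s : Set (Ideal R) := {I | ∃ f : R, IsIdempotentElem f ∧ (∀ a, f * a = a * f) ∧
    (∀ t : T, f • t = t) ∧ I = Ideal.span {f}}
  have hs : s.Nonempty := ⟨Ideal.span {1}, 1, IsIdempotentElem.one, by simp, by simp, rfl⟩
  obtain ⟨I, ⟨f, hf, hc, ha, rfl⟩, hmin⟩ :=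
    (IsWellFounded.wf : WellFounded ((· < ·) : Ideal R → Ideal R → Prop)).has_min s hs
  have := IsSimpleModule.nontrivial R T
  obtain ⟨t₀, ht₀⟩ := exists_ne (0 : T)
  have key : ∀ g : R, IsIdempotentElem g → (∀ a, g * a = a * g) → (∀ t : T, g • t = t) →
      g * f = g → f = g := by
    intro g hg hgc hga hgf
    have hle : Ideal.span {g} ≤ Ideal.span {f} := by
      rw [Ideal.span_singleton_le_iff_mem, Ideal.mem_span_singleton']
      exact ⟨g, hgf⟩
    have hnlt := hmin (Ideal.span {g}) ⟨g, hg, hgc, hga, rfl⟩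
    have heq : Ideal.span {g} = Ideal.span {f} := by
      by_contra hne
      exact hnlt (lt_of_le_of_ne hle hne)
    have hmem : f ∈ Ideal.span {g} := heq ▸ Ideal.mem_span_singleton_self f
    obtain ⟨a, rfl⟩ := Ideal.mem_span_singleton'.1 hmem
    calc a * g = a * g * g := by rw [mul_assoc, hg.eq]
      _ = g * (a * g) := (hgc (a * g)).symm
      _ = g := hgf
  refine ⟨f, hf, hc, ?_, ?_, t₀, by rwa [ha]⟩
  · rintro rfl
    exact ht₀ (by rw [← ha t₀, zero_smul])
  · rintro g h hg hgc hh hhc hgh rfl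
    rcases centralIdempotent_smul_simple (T := T) hg hgc with h0 | h1
    · left
      have hh1 : ∀ t : T, h • t = t := fun t => by
        have := ha t
        rwa [add_smul, h0, zero_add] at this
      have := key h hh hhc hh1 (by rw [mul_add, hh.eq, hhc, hgh, zero_add])
      simpa using this
    · right
      have := key g hg hgc h1 (by rw [mul_add, hg.eq, hgh, add_zero])
      simpa using this

theorem IsBlockIdempotent.unique {T : Type x} [AddCommGroup T] [Module R T] [IsSimpleModule R T]
    {f f' : R} (h : IsBlockIdempotent R T f) (h' : IsBlockIdempotent R T f') : f = f' := by
  have one : ∀ {g : R}, IsBlockIdempotent R T g → ∀ t : T, g • t = t := by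
    intro g hg
    rcases centralIdempotent_smul_simple (T := T) hg.idem hg.central with h0 | h1
    · obtain ⟨t, ht⟩ := hg.acts
      exact absurd (h0 t) ht
    · exact h1
  have main : ∀ {f f' : R}, IsBlockIdempotent R T f → IsBlockIdempotent R T f' → f = f * f' := by
    intro f f' h h'
    have c1 : IsIdempotentElem (f * f') :=
      h.idem.mul_of_commute (h.central f') h'.idem
    have c2 : IsIdempotentElem (f * (1 - f')) :=
      h.idem.mul_of_commute (h.central _) h'.idem.one_sub
    have d1 : ∀ a, f * f' * a = a * (f * f') := fun a => by
      rw [mul_assoc, h'.central, ← mul_assoc, h.central, mul_assoc]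
    have d2 : ∀ a, f * (1 - f') * a = a * (f * (1 - f')) := fun a => by
      have := d1 a
      have e := h.central a
      simp only [mul_sub, mul_one, sub_mul] at this ⊢
      rw [this, e]
    have d3 : f * f' * (f * (1 - f')) = 0 := by
      rw [← mul_assoc, d1 f, ← mul_assoc, h.idem.eq, mul_assoc, mul_sub, mul_one, h'.idem.eq,
        sub_self, mul_zero]
    rcases h.primitive _ _ c1 d1 c2 d2 d3 (by simp [mul_sub]) with e | e
    · obtain ⟨t, ht⟩ := h.acts
      refine absurd ?_ ht
      have : (f * f') • t = 0 := by rw [e, zero_smul]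
      rwa [mul_smul, one h'] at this
    · rw [mul_sub, mul_one, sub_eq_zero] at e
      exact e
  calc f = f * f' := main h h'
    _ = f' * f := h.central f'
    _ = f' := (main h' h).symm

open Classical in
/-- The block idempotent of `R` corresponding to the simple module `T`; it exists and is unique when
`R` is Artinian, see `exists_isBlockIdempotent` and `IsBlockIdempotent.unique`. -/
def blockIdempotent (R : Type u) [Ring R] (T : Type x) [AddCommGroup T] [Module R T] : R :=
  if h : ∃ f : R, IsBlockIdempotent R T f then h.choose else 0

theorem blockIdempotent_spec [IsArtinianRing R] (T : Type x) [AddCommGroup T] [Module R T]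
    [IsSimpleModule R T] : IsBlockIdempotent R T (blockIdempotent R T) := by
  rw [blockIdempotent, dif_pos (exists_isBlockIdempotent T)]
  exact (exists_isBlockIdempotent T).choose_spec

end ModuleTheory

/-! ## Corner algebras `e A e` and the functor `A e ⊗_{e A e} -` -/

section Corner

variable {A : Type u} [Ring A] {e : A}

instance cornerModule {k : Type w} [Field k] [Algebra k A] (he : IsIdempotentElem e) :
    Module k he.Corner :=
  letI : SMul k he.Corner := ⟨fun c a => ⟨c • a.1, by
    obtain ⟨b, hb⟩ := a.2
    refine ⟨c • b, ?_⟩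
    rw [← hb]
    simp⟩⟩
  Function.Injective.module k
    ({ toFun := Subtype.val, map_zero' := rfl, map_add' := fun _ _ => rfl } : he.Corner →+ A)
    Subtype.val_injective (fun _ _ => rfl)

instance cornerAlgebra {k : Type w} [Field k] [Algebra k A] (he : IsIdempotentElem e) :
    Algebra k he.Corner :=
  Algebra.ofModule (fun c a b => Subtype.ext (smul_mul_assoc c a.1 b.1))
    (fun c a b => Subtype.ext (mul_smul_comm c a.1 b.1))

/-- The inclusion of `e A e` into `A`, as a linear map. -/
def cornerInclusion (k : Type w) [Field k] [Algebra k A] (he : IsIdempotentElem e) :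
    he.Corner →ₗ[k] A where
  toFun := Subtype.val
  map_add' _ _ := rfl
  map_smul' _ _ := rfl

theorem cornerInclusion_injective (k : Type w) [Field k] [Algebra k A]
    (he : IsIdempotentElem e) : Function.Injective (cornerInclusion k he) :=
  Subtype.val_injective

instance cornerFiniteDimensional {k : Type w} [Field k] [Algebra k A] [FiniteDimensional k A]
    (he : IsIdempotentElem e) : FiniteDimensional k he.Corner :=
  FiniteDimensional.of_injective (cornerInclusion k he) (cornerInclusion_injective k he)

/-- The elements `x b ⊗ t - x ⊗ b t` of `A e ⊗_ℤ N`, for `x ∈ A e`, `b ∈ e A e` and `t ∈ N`. -/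
def balancedRelations (he : IsIdempotentElem e) (N : Type x) [AddCommGroup N] [Module he.Corner N] :
    Set ((Ideal.span {e} : Ideal A) ⊗[ℤ] N) :=
  {z | ∃ (p q : (Ideal.span {e} : Ideal A)) (b : he.Corner) (t : N),
    (q : A) = (p : A) * b.1 ∧ z = q ⊗ₜ[ℤ] t - p ⊗ₜ[ℤ] (b • t)}

/-- The left `A`-module `A e ⊗_{e A e} N`, for an idempotent `e` and a left `e A e`-module `N`. -/
abbrev CornerInduced (he : IsIdempotentElem e) (N : Type x) [AddCommGroup N]
    [Module he.Corner N] : Type (max u x) :=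
  ((Ideal.span {e} : Ideal A) ⊗[ℤ] N) ⧸ Submodule.span A (balancedRelations he N)

end Corner

/-! ## Categories: morphisms, split categories, `𝒥`-classes, maximal subgroups -/

section Category

variable (C : Type u) [Category.{v} C]

/-- The set `S` of all morphisms of `C`. -/
@[ext]
structure Mor where
  dom : C
  cod : C
  hom : dom ⟶ cod

/-- `C` is split: for every `s` there is a `t` with `s ∘ t ∘ s = s`. -/
def IsSplitCategory : Prop :=
  ∀ ⦃X Y : C⦄ (s : X ⟶ Y), ∃ t : Y ⟶ X, s ≫ t ≫ s = s

variable {C}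

/-- The set `S ∘ s ∘ S`. -/
def twoSidedMor (s : Mor C) : Set (Mor C) :=
  {a | ∃ (p : a.dom ⟶ s.dom) (q : s.cod ⟶ a.cod), a.hom = p ≫ s.hom ≫ q}

/-- The preorder `S ∘ s ∘ S ⊆ S ∘ t ∘ S` on morphisms. -/
instance morPreorder : Preorder (Mor C) := Preorder.lift twoSidedMor

variable (C) in
/-- The partially ordered set of `𝒥`-classes: `s` and `t` are equivalent if and only if
`S ∘ s ∘ S = S ∘ t ∘ S`. -/
abbrev JClass : Type (max u v) := Antisymmetrization (Mor C) (· ≤ ·)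

/-- The `𝒥`-class of a morphism. -/
def jClass (s : Mor C) : JClass C := toAntisymmetrization (· ≤ ·) s

/-- The monoid `e ∘ End(X) ∘ e`, with identity element `e`. -/
def LocalMonoid {X : C} {e : End X} (_ : IsIdempotentElem e) : Type v :=
  Subsemigroup.corner e

instance localMonoidMonoid {X : C} {e : End X} (he : IsIdempotentElem e) :
    Monoid (LocalMonoid he) where
  __ := (inferInstance : Semigroup (Subsemigroup.corner e))
  one := ⟨e, e, by simp only [he.eq]⟩
  one_mul r := Subtype.ext ((Subsemigroup.mem_corner_iff he).mp r.2).1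
  mul_one r := Subtype.ext ((Subsemigroup.mem_corner_iff he).mp r.2).2

/-- An element of `e ∘ End(X) ∘ e`, as a morphism of `C`. -/
def LocalMonoid.mor {X : C} {e : End X} {he : IsIdempotentElem e} (m : LocalMonoid he) : Mor C :=
  ⟨X, X, m.1⟩

theorem LocalMonoid.mor_injective {X : C} {e : End X} {he : IsIdempotentElem e} :
    Function.Injective (LocalMonoid.mor : LocalMonoid he → Mor C) := by
  intro a b h
  simp only [LocalMonoid.mor, Mor.mk.injEq, heq_eq_eq, true_and] at h
  exact Subtype.ext h

instance localMonoidFinite [Finite (Mor C)] {X : C} {e : End X} (he : IsIdempotentElem e) :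
    Finite (LocalMonoid he) :=
  Finite.of_injective _ LocalMonoid.mor_injective

/-- The maximal subgroup `Γ_e`: the group of units of `e ∘ End(X) ∘ e`. -/
abbrev MaximalSubgroup {X : C} {e : End X} (he : IsIdempotentElem e) : Type v :=
  (LocalMonoid he)ˣ

end Category

/-! ## Twisted category algebras -/

section TwistedAlgebra

variable {C : Type u} [Category.{v} C] {k : Type w} [Field k]

/-- A 2-cocycle of `C` with values in `kˣ`: `toFun t s` is `α(t, s)`, where `t ∘ s = s ≫ t`. -/
structure TwoCocycle (C : Type u) [Category.{v} C] (k : Type w) [Field k] where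
  toFun : ∀ {X Y Z : C}, (Y ⟶ Z) → (X ⟶ Y) → kˣ
  cocycle : ∀ {W X Y Z : C} (s : W ⟶ X) (t : X ⟶ Y) (r : Y ⟶ Z),
    toFun (t ≫ r) s * toFun r t = toFun r (s ≫ t) * toFun t s

theorem TwoCocycle.id_left (α : TwoCocycle C k) {X Y : C} (s : X ⟶ Y) :
    α.toFun (𝟙 Y) s = α.toFun (𝟙 Y) (𝟙 Y) := by
  have := α.cocycle s (𝟙 Y) (𝟙 Y)
  simp only [Category.comp_id] at this
  rw [mul_comm] at this
  exact (mul_right_cancel (by rw [this, mul_comm])).symm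

theorem TwoCocycle.id_right (α : TwoCocycle C k) {X Y : C} (s : X ⟶ Y) :
    α.toFun s (𝟙 X) = α.toFun (𝟙 X) (𝟙 X) := by
  have := α.cocycle (𝟙 X) (𝟙 X) s
  simp only [Category.id_comp] at this
  exact mul_left_cancel this

/-- The twisted category algebra `k_α C`: the `k`-vector space with basis `S`. -/
@[nolint unusedArguments]
def TwistedCategoryAlgebra (_α : TwoCocycle C k) : Type (max u v w) := Mor C →₀ k

namespace TwistedCategoryAlgebra

variable (α : TwoCocycle C k)

instance : AddCommGroup (TwistedCategoryAlgebra α) := inferInstanceAs (AddCommGroup (Mor C →₀ k))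
instance : Module k (TwistedCategoryAlgebra α) := inferInstanceAs (Module k (Mor C →₀ k))

/-- The basis element given by a morphism. -/
def of (s : Mor C) : TwistedCategoryAlgebra α := Finsupp.single s 1

open Classical in
/-- The product of basis elements: `α(t, s) • (t ∘ s)` if `t ∘ s` exists, and `0` otherwise. -/
def basisMul (t s : Mor C) : TwistedCategoryAlgebra α :=
  if h : s.cod = t.dom then
    (α.toFun t.hom (s.hom ≫ eqToHom h) : k) • of α ⟨s.dom, t.cod, (s.hom ≫ eqToHom h) ≫ t.hom⟩
  else 0

/-- The multiplication, as the bilinear extension of the product of basis elements. -/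
def mulMap : TwistedCategoryAlgebra α →ₗ[k] TwistedCategoryAlgebra α →ₗ[k]
    TwistedCategoryAlgebra α :=
  Finsupp.linearCombination k fun t => Finsupp.linearCombination k fun s => basisMul α t s

instance : Mul (TwistedCategoryAlgebra α) := ⟨fun a b => mulMap α a b⟩

theorem mul_def (a b : TwistedCategoryAlgebra α) : a * b = mulMap α a b := rfl

theorem of_mul_of (t s : Mor C) : of α t * of α s = basisMul α t s := by
  change (Finsupp.linearCombination k fun t => Finsupp.linearCombination k fun s => basisMul α t s)
    (Finsupp.single t (1 : k)) (Finsupp.single s (1 : k)) = _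
  rw [Finsupp.linearCombination_single, one_smul, Finsupp.linearCombination_single, one_smul]

theorem of_comp {X Y Z : C} (t : Y ⟶ Z) (s : X ⟶ Y) :
    of α ⟨Y, Z, t⟩ * of α ⟨X, Y, s⟩ = (α.toFun t s : k) • of α ⟨X, Z, s ≫ t⟩ := by
  rw [of_mul_of]
  simp [basisMul]

theorem of_not_comp (t s : Mor C) (h : s.cod ≠ t.dom) : of α t * of α s = 0 := by
  rw [of_mul_of, basisMul, dif_neg h]

theorem span_of : Submodule.span k (Set.range (of α)) = ⊤ := by
  rw [eq_top_iff]
  rintro a -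
  induction a using Finsupp.induction_linear with
  | zero => exact Submodule.zero_mem _
  | add f g hf hg => exact Submodule.add_mem _ hf hg
  | single s c =>
    have : (Finsupp.single s c : Mor C →₀ k) = c • (of α s : TwistedCategoryAlgebra α) := by
      change _ = c • (Finsupp.single s (1 : k))
      rw [Finsupp.smul_single, smul_eq_mul, mul_one]
    rw [this]
    exact Submodule.smul_mem _ _ (Submodule.subset_span ⟨s, rfl⟩)

theorem linearMap_ext {M : Type*} [AddCommMonoid M] [Module k M]
    {f g : TwistedCategoryAlgebra α →ₗ[k] M} (h : ∀ s, f (of α s) = g (of α s)) : f = g :=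
  LinearMap.ext_on (span_of α) (by rintro _ ⟨s, rfl⟩; exact h s)

theorem of_mul_assoc (r t s : Mor C) :
    mulMap α (mulMap α (of α r) (of α t)) (of α s) =
      mulMap α (of α r) (mulMap α (of α t) (of α s)) := by
  simp only [← mul_def]
  by_cases h₁ : t.cod = r.dom
  · by_cases h₂ : s.cod = t.dom
    · obtain ⟨Y, Z, r⟩ := r
      obtain ⟨X, Y', t⟩ := t
      obtain ⟨W, X', s⟩ := s
      obtain rfl : Y' = Y := h₁
      obtain rfl : X' = X := h₂
      simp only [of_comp]
      simp only [mul_def, map_smul, LinearMap.smul_apply]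
      simp only [← mul_def, of_comp, smul_smul, Category.assoc]
      congr 1
      have := congrArg (Units.val) (α.cocycle s t r)
      push_cast at this
      rw [mul_comm, this, mul_comm]
    · rw [of_not_comp α t s h₂]
      rw [of_mul_of α r t, basisMul, dif_pos h₁]
      simp only [mul_def, map_smul, LinearMap.smul_apply, map_zero]
      rw [← mul_def, of_not_comp α _ s (by exact h₂), smul_zero]
  · rw [of_not_comp α r t h₁]
    by_cases h₂ : s.cod = t.dom
    · rw [of_mul_of α t s, basisMul, dif_pos h₂]
      simp only [mul_def, map_smul, LinearMap.zero_apply, map_zero]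
      rw [← mul_def, of_not_comp α r _ (by exact h₁), smul_zero]
    · rw [of_not_comp α t s h₂]
      simp [mul_def]

theorem mulMap_assoc (a b c : TwistedCategoryAlgebra α) :
    mulMap α (mulMap α a b) c = mulMap α a (mulMap α b c) := by
  have h₁ : ∀ r t s, mulMap α (mulMap α (of α r) (of α t)) (of α s) =
      mulMap α (of α r) (mulMap α (of α t) (of α s)) := of_mul_assoc α
  have h₂ : ∀ r t c, mulMap α (mulMap α (of α r) (of α t)) c =
      mulMap α (of α r) (mulMap α (of α t) c) := fun r t c => by
    have : mulMap α (mulMap α (of α r) (of α t)) =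
        (mulMap α (of α r)).comp (mulMap α (of α t)) := linearMap_ext α fun s => h₁ r t s
    exact LinearMap.congr_fun this c
  have h₃ : ∀ r b c, mulMap α (mulMap α (of α r) b) c =
      mulMap α (of α r) (mulMap α b c) := fun r b c => by
    have : ((mulMap α).flip c).comp (mulMap α (of α r)) =
        (mulMap α (of α r)).comp ((mulMap α).flip c) := linearMap_ext α fun t => h₂ r t c
    exact LinearMap.congr_fun this b
  have : ((mulMap α).flip c).comp ((mulMap α).flip b) = (mulMap α).flip (mulMap α b c) :=
    linearMap_ext α fun r => h₃ r b c
  exact LinearMap.congr_fun this a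

variable [Finite (Mor C)]

theorem finite_obj (C : Type u) [Category.{v} C] [Finite (Mor C)] : Finite C :=
  Finite.of_injective (fun X : C => (⟨X, X, 𝟙 X⟩ : Mor C)) fun _ _ h => congrArg Mor.dom h

instance : One (TwistedCategoryAlgebra α) :=
  letI : Fintype C := @Fintype.ofFinite C (finite_obj C)
  ⟨∑ X : C, ((α.toFun (𝟙 X) (𝟙 X))⁻¹ : kˣ).val • of α ⟨X, X, 𝟙 X⟩⟩

theorem mulMap_one_left (a : TwistedCategoryAlgebra α) : mulMap α 1 a = a := by
  let _ : Fintype C := @Fintype.ofFinite C (finite_obj C)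
  have h : mulMap α 1 = LinearMap.id := by
    refine linearMap_ext α fun s => ?_
    change mulMap α (∑ X : C, ((α.toFun (𝟙 X) (𝟙 X))⁻¹ : kˣ).val • of α ⟨X, X, 𝟙 X⟩) (of α s) = of α s
    rw [map_sum, LinearMap.sum_apply, Finset.sum_eq_single s.cod]
    · rw [map_smul, LinearMap.smul_apply, ← mul_def, of_comp, smul_smul, α.id_left s.hom, Units.inv_mul,
        Category.comp_id, one_smul]
    · intro X _ hX
      rw [map_smul, LinearMap.smul_apply, ← mul_def, of_not_comp α _ s (by exact hX.symm), smul_zero]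
    · simp
  exact LinearMap.congr_fun h a

theorem mulMap_one_right (a : TwistedCategoryAlgebra α) : mulMap α a 1 = a := by
  let _ : Fintype C := @Fintype.ofFinite C (finite_obj C)
  have h : (mulMap α).flip 1 = LinearMap.id := by
    refine linearMap_ext α fun s => ?_
    change mulMap α (of α s) (∑ X : C, ((α.toFun (𝟙 X) (𝟙 X))⁻¹ : kˣ).val • of α ⟨X, X, 𝟙 X⟩) = of α s
    rw [map_sum, Finset.sum_eq_single s.dom]
    · rw [map_smul, ← mul_def, of_comp, smul_smul, α.id_right s.hom, Units.inv_mul,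
        Category.id_comp, one_smul]
    · intro X _ hX
      rw [map_smul, ← mul_def, of_not_comp α s _ (by exact hX), smul_zero]
    · simp
  exact LinearMap.congr_fun h a

instance : Ring (TwistedCategoryAlgebra α) where
  __ := (inferInstance : AddCommGroup (TwistedCategoryAlgebra α))
  left_distrib a b c := (mulMap α a).map_add b c
  right_distrib a b c := LinearMap.map_add₂ (mulMap α) a b c
  zero_mul a := LinearMap.map_zero₂ (mulMap α) a
  mul_zero a := (mulMap α a).map_zero
  mul_assoc := mulMap_assoc α
  one_mul := mulMap_one_left α
  mul_one := mulMap_one_right α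

instance : Algebra k (TwistedCategoryAlgebra α) :=
  Algebra.ofModule (fun c a b => LinearMap.map_smul₂ (mulMap α) c a b)
    (fun c a b => (mulMap α a).map_smul c b)

instance : FiniteDimensional k (TwistedCategoryAlgebra α) :=
  inferInstanceAs (FiniteDimensional k (Mor C →₀ k))

section Local

variable {X : C} {e : End X} (he : IsIdempotentElem e)

/-- The element `e' = α(e, e)⁻¹ • e` of the twisted category algebra. -/
def idem (_ : IsIdempotentElem e) : TwistedCategoryAlgebra α :=
  ((α.toFun e e)⁻¹ : kˣ).val • of α ⟨X, X, e⟩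

theorem idem_isIdempotentElem : IsIdempotentElem (idem α he) := by
  have h : e ≫ e = e := he.eq
  unfold IsIdempotentElem idem
  rw [smul_mul_smul_comm, of_comp, h, smul_smul]
  simp

/-- The algebra `e' A e'`. -/
abbrev Local : Type (max u v w) := (idem_isIdempotentElem α he).Corner

/-- The span of `Γ_e` in `A`. -/
def groupSpan : Submodule k (TwistedCategoryAlgebra α) :=
  Submodule.span k (Set.range fun g : MaximalSubgroup he => of α (g : LocalMonoid he).mor)

theorem of_mor_mul (m m' : LocalMonoid he) :
    of α m.mor * of α m'.mor = (α.toFun m.1 m'.1 : k) • of α (m * m').mor :=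
  of_comp α m.1 m'.1

theorem groupSpan_mul {a b : TwistedCategoryAlgebra α} (ha : a ∈ groupSpan α he)
    (hb : b ∈ groupSpan α he) : a * b ∈ groupSpan α he := by
  have h : groupSpan α he * groupSpan α he ≤ groupSpan α he := by
    unfold groupSpan
    rw [Submodule.span_mul_span, Submodule.span_le]
    rintro _ ⟨_, ⟨g, rfl⟩, _, ⟨g', rfl⟩, rfl⟩
    change of α (g : LocalMonoid he).mor * of α (g' : LocalMonoid he).mor ∈ _
    rw [of_mor_mul]
    exact Submodule.smul_mem _ _ (Submodule.subset_span ⟨g * g', rfl⟩)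
  exact h (Submodule.mul_mem_mul ha hb)

theorem idem_mem_groupSpan : idem α he ∈ groupSpan α he :=
  Submodule.smul_mem _ _ (Submodule.subset_span ⟨1, rfl⟩)

theorem local_add_val (a b : Local α he) : (a + b).1 = a.1 + b.1 := rfl

/-- The twisted group algebra `k_α Γ_e`, as a unitary subalgebra of `e' A e'`. -/
def groupAlgebra : Subalgebra k (Local α he) where
  carrier := {a | a.1 ∈ groupSpan α he}
  mul_mem' ha hb := groupSpan_mul α he ha hb
  add_mem' {a b} ha hb := by
    change (a + b).1 ∈ groupSpan α he
    rw [local_add_val]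
    exact Submodule.add_mem _ ha hb
  algebraMap_mem' c := Submodule.smul_mem _ c (idem_mem_groupSpan α he)

instance : IsArtinianRing (groupAlgebra α he) := by
  have : FiniteDimensional k (groupAlgebra α he) := inferInstance
  have := IsArtinianRing.of_finite k (groupAlgebra α he)
  convert this

/-- The `k`-linear projection of `A` onto the span of `Γ_e` that annihilates all other
morphisms. -/
def groupProj : TwistedCategoryAlgebra α →ₗ[k] TwistedCategoryAlgebra α :=
  open Classical in
  Finsupp.linearCombination k fun s : Mor C =>
    if s ∈ Set.range (fun g : MaximalSubgroup he => (g : LocalMonoid he).mor) then of α s else 0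

open Classical in
theorem groupProj_of (s : Mor C) : groupProj α he (of α s) =
    if s ∈ Set.range (fun g : MaximalSubgroup he => (g : LocalMonoid he).mor)
    then of α s else 0 := by
  change Finsupp.linearCombination k (fun s : Mor C =>
    if s ∈ Set.range (fun g : MaximalSubgroup he => (g : LocalMonoid he).mor)
    then of α s else 0) (Finsupp.single s (1 : k)) = _
  rw [Finsupp.linearCombination_single, one_smul]

open Classical in
theorem groupProj_of_mor (m : LocalMonoid he) : groupProj α he (of α m.mor) =
    if IsUnit m then of α m.mor else 0 := by
  rw [groupProj_of]
  congr 1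
  apply propext
  constructor
  · rintro ⟨g, hg⟩
    exact LocalMonoid.mor_injective hg ▸ g.isUnit
  · rintro ⟨g, rfl⟩
    exact ⟨g, rfl⟩

theorem groupProj_mem (a : TwistedCategoryAlgebra α) : groupProj α he a ∈ groupSpan α he := by
  classical
  have ha : a ∈ Submodule.span k (Set.range (of α)) := span_of α ▸ Submodule.mem_top
  induction ha using Submodule.span_induction with
  | zero => simp
  | add x y _ _ hx hy => rw [map_add]; exact Submodule.add_mem _ hx hy
  | smul c x _ hx => rw [map_smul]; exact Submodule.smul_mem _ c hx
  | mem x hx =>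
    obtain ⟨s, rfl⟩ := hx
    rw [groupProj_of]
    split_ifs with h
    · obtain ⟨g, rfl⟩ := h
      exact Submodule.subset_span ⟨g, rfl⟩
    · exact Submodule.zero_mem _

theorem local_mem_span (a : Local α he) :
    a.1 ∈ Submodule.span k (Set.range fun m : LocalMonoid he => of α m.mor) := by
  obtain ⟨b, hb⟩ := a.2
  rw [← hb]
  clear hb
  have hmem : b ∈ Submodule.span k (Set.range (of α)) := span_of α ▸ Submodule.mem_top
  change idem α he * b * idem α he ∈ _
  induction hmem using Submodule.span_induction with
  | zero => simp
  | add x y _ _ hx hy => rw [mul_add, add_mul]; exact Submodule.add_mem _ hx hy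
  | smul c x _ hx =>
    rw [mul_smul_comm, smul_mul_assoc]; exact Submodule.smul_mem _ c hx
  | mem x hx =>
    obtain ⟨s, rfl⟩ := hx
    unfold idem
    rw [smul_mul_assoc, smul_mul_assoc, mul_smul_comm]
    refine Submodule.smul_mem _ _ (Submodule.smul_mem _ _ ?_)
    by_cases h₁ : s.cod = X
    · by_cases h₂ : s.dom = X
      · obtain ⟨Y, Z, f⟩ := s
        obtain rfl : Z = X := h₁
        obtain rfl : Y = Z := h₂
        rw [of_comp, smul_mul_assoc, of_comp]
        refine Submodule.smul_mem _ _ (Submodule.smul_mem _ _ (Submodule.subset_span ?_))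
        exact ⟨⟨e * (show End Y from f) * e, show End Y from f, rfl⟩, rfl⟩
      · rw [mul_assoc, of_not_comp α s _ (by exact Ne.symm h₂), mul_zero]
        exact Submodule.zero_mem _
    · rw [of_not_comp α _ s h₁, zero_mul]
      exact Submodule.zero_mem _

theorem groupSpan_corner {a : TwistedCategoryAlgebra α} (ha : a ∈ groupSpan α he) :
    a ∈ Subsemigroup.corner (idem α he) := by
  have hi := idem_isIdempotentElem α he
  rw [Subsemigroup.mem_corner_iff hi]
  induction ha using Submodule.span_induction with
  | zero => simp
  | add x y _ _ hx hy => rw [mul_add, add_mul, hx.1, hx.2, hy.1, hy.2]; exact ⟨rfl, rfl⟩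
  | smul c x _ hx => rw [mul_smul_comm, smul_mul_assoc, hx.1, hx.2]; exact ⟨rfl, rfl⟩
  | mem x hx =>
    obtain ⟨g, rfl⟩ := hx
    obtain ⟨h₁, h₂⟩ := (Subsemigroup.mem_corner_iff he).mp (g : LocalMonoid he).2
    have h₃ : of α (g : LocalMonoid he).mor ∈ Subsemigroup.corner (idem α he) := by
      obtain ⟨m, hm⟩ : ∃ m : LocalMonoid he, m = (g : LocalMonoid he) := ⟨_, rfl⟩
      rw [← hm]
      have h₄ := of_mor_mul α he 1 m
      have h₅ := of_mor_mul α he m 1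
      rw [one_mul] at h₄
      rw [mul_one] at h₅
      have h₆ : idem α he = ((α.toFun e e)⁻¹ : kˣ).val • of α (1 : LocalMonoid he).mor := rfl
      set c : k := ((α.toFun e e)⁻¹ : kˣ).val *
        ((α.toFun (1 : LocalMonoid he).1 m.1 : kˣ) : k) with hc
      set d : k := ((α.toFun e e)⁻¹ : kˣ).val *
        ((α.toFun m.1 (1 : LocalMonoid he).1 : kˣ) : k) with hd
      have hc0 : c ≠ 0 := mul_ne_zero (Units.ne_zero _) (Units.ne_zero _)
      have hd0 : d ≠ 0 := mul_ne_zero (Units.ne_zero _) (Units.ne_zero _)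
      refine ⟨(c * d)⁻¹ • of α m.mor, ?_⟩
      have h₇ : idem α he * of α m.mor = c • of α m.mor := by
        rw [h₆, smul_mul_assoc, h₄, smul_smul]
      have h₈ : of α m.mor * idem α he = d • of α m.mor := by
        rw [h₆, mul_smul_comm, h₅, smul_smul]
      change idem α he * ((c * d)⁻¹ • of α m.mor) * idem α he = of α m.mor
      rw [mul_smul_comm, h₇, smul_smul, smul_mul_assoc, h₈, smul_smul]
      have : (c * d)⁻¹ * c * d = 1 := by field_simp
      rw [this, one_smul]
    exact (Subsemigroup.mem_corner_iff hi).mp h₃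

theorem groupProj_mul (a b : Local α he) :
    groupProj α he (a.1 * b.1) = groupProj α he a.1 * groupProj α he b.1 := by
  classical
  have ha := local_mem_span α he a
  have hb := local_mem_span α he b
  generalize a.1 = a' at ha
  generalize b.1 = b' at hb
  induction ha using Submodule.span_induction with
  | zero => simp
  | add x y _ _ hx hy => rw [add_mul, map_add, map_add, add_mul, hx, hy]
  | smul c x _ hx => rw [smul_mul_assoc, map_smul, map_smul, smul_mul_assoc, hx]
  | mem x hx =>
    obtain ⟨m, rfl⟩ := hx
    induction hb using Submodule.span_induction with
    | zero => simp
    | add x y _ _ hx hy => rw [mul_add, map_add, map_add, mul_add, hx, hy]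
    | smul c x _ hx => rw [mul_smul_comm, map_smul, map_smul, mul_smul_comm, hx]
    | mem x hx =>
      obtain ⟨m', rfl⟩ := hx
      simp only [of_mor_mul, map_smul, groupProj_of_mor, IsUnit.mul_iff]
      by_cases h₁ : IsUnit m <;> by_cases h₂ : IsUnit m' <;> simp [h₁, h₂, of_mor_mul]

/-- The algebra homomorphism `e' A e' = k_α Γ_e ⊕ k J_e → k_α Γ_e` with kernel `k J_e`, where `J_e`
is the set of non-units of `e ∘ End(X) ∘ e`. -/
def localProj : Local α he →+* groupAlgebra α he where
  toFun a := ⟨⟨groupProj α he a.1, groupSpan_corner α he (groupProj_mem α he a.1)⟩,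
    show groupProj α he a.1 ∈ groupSpan α he from groupProj_mem α he a.1⟩
  map_one' := Subtype.ext <| Subtype.ext <| by
    change groupProj α he (idem α he) = idem α he
    have h := groupProj_of_mor α he 1
    rw [if_pos isUnit_one] at h
    unfold idem
    rw [map_smul]
    exact congrArg _ h
  map_mul' a b := Subtype.ext (Subtype.ext (groupProj_mul α he a b))
  map_zero' := Subtype.ext (Subtype.ext (map_zero (groupProj α he)))
  map_add' a b := Subtype.ext (Subtype.ext (map_add (groupProj α he) a.1 b.1))

/-- The inflation of a `k_α Γ_e`-module `T` to `e' A e'`. -/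
@[nolint unusedArguments]
def Inflation (T : Type x) [AddCommGroup T] [Module (groupAlgebra α he) T] : Type x := T

instance (T : Type x) [AddCommGroup T] [Module (groupAlgebra α he) T] :
    AddCommGroup (Inflation α he T) := inferInstanceAs (AddCommGroup T)

instance (T : Type x) [AddCommGroup T] [Module (groupAlgebra α he) T] :
    Module (Local α he) (Inflation α he T) :=
  (Module.compHom T (localProj α he) : Module (Local α he) T)

/-- The `A`-module `Δ = A e' ⊗_{e' A e'} T̃`, where `T̃` is the inflation of the `k_α Γ_e`-module
`T`. -/
abbrev Delta (T : Type x) [AddCommGroup T] [Module (groupAlgebra α he) T] :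
    Type (max u v w x) :=
  CornerInduced (idem_isIdempotentElem α he) (Inflation α he T)

end Local

/-! ### The ideals `J_m` and the order on labels -/

/-- The span `J_m` of the first `m` classes in the enumeration `S 0, S 1, …` of the
`𝒥`-classes. -/
def chainIdeal {n : ℕ} (S : Fin n → JClass C) (m : ℕ) : Submodule k (TwistedCategoryAlgebra α) :=
  Submodule.span k {a | ∃ (s : Mor C) (i : Fin n), i.1 < m ∧ jClass s = S i ∧ a = of α s}

variable {n : ℕ} (S : Fin n → JClass C) {X : Fin n → C} {e : ∀ i, End (X i)}
  (he : ∀ i, IsIdempotentElem (e i)) {l : Fin n → ℕ} (T : ∀ i, Fin (l i) → Type x)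
  [∀ i r, AddCommGroup (T i r)] [∀ i r, Module (groupAlgebra α (he i)) (T i r)]

/-- The block idempotent `f_(i,r)` of `k_α Γ_{e_i}`, as an element of `A`. -/
def labelIdempotent (a : Σ i, Fin (l i)) : TwistedCategoryAlgebra α :=
  (blockIdempotent (groupAlgebra α (he a.1)) (T a.1 a.2)).1.1

/-- The relation `(i,r) ⊏ (j,s)`: `S_j < S_i`, and `f_(i,r) J_j f_(j,s) ⊄ J_{j-1}` or
`f_(j,s) J_j f_(i,r) ⊄ J_{j-1}`. Since the classes are numbered from `0` here, the span of the
classes up to and including the one of index `j` is `chainIdeal α S (j + 1)`. -/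
def LabelRel (a b : Σ i, Fin (l i)) : Prop :=
  S b.1 < S a.1 ∧
    ((∃ z ∈ chainIdeal α S (b.1.1 + 1),
        labelIdempotent α he T a * z * labelIdempotent α he T b ∉ chainIdeal α S b.1.1) ∨
      (∃ z ∈ chainIdeal α S (b.1.1 + 1),
        labelIdempotent α he T b * z * labelIdempotent α he T a ∉ chainIdeal α S b.1.1))

/-- The relation `⊴`: the transitive closure of the reflexive relation `⊑`. -/
def LabelLE : (Σ i, Fin (l i)) → (Σ i, Fin (l i)) → Prop :=
  Relation.TransGen fun a b => a = b ∨ LabelRel α S he T a b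

/-- The relation `⊴` is contained in the order given by `(i,r) < (j,s)` iff `S_j < S_i`. -/
theorem LabelLE.eq_or_lt {a b : Σ i, Fin (l i)} (h : LabelLE α S he T a b) :
    a = b ∨ S b.1 < S a.1 := by
  induction h with
  | single h => exact h.imp_right fun h => h.1
  | tail _ h ih =>
    rcases ih with rfl | ih
    · exact h.imp_right fun h => h.1
    · rcases h with rfl | h
      · exact Or.inr ih
      · exact Or.inr (h.1.trans ih)

/-- The partial order `⊴` on the labels `(i,r)`. -/
@[reducible]
def labelOrder : PartialOrder (Σ i, Fin (l i)) where
  le := LabelLE α S he T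
  lt a b := LabelLE α S he T a b ∧ ¬ LabelLE α S he T b a
  lt_iff_le_not_ge _ _ := Iff.rfl
  le_refl a := .single (Or.inl rfl)
  le_trans _ _ _ h h' := h.trans h'
  le_antisymm a b h h' := by
    rcases h.eq_or_lt with h | h
    · exact h
    · rcases h'.eq_or_lt with h' | h'
      · exact h'.symm
      · exact absurd h h'.asymm

end TwistedCategoryAlgebra
end TwistedAlgebra
end

/-! Count the `𝒥`-classes from `0`, so that the layer of the `i`-th class is J_(i+1)/J_i. The
theorem comes from the chain of ideals 0 = J_0 ≤ … ≤ J_n = A, and the heart of the matter is that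
each layer is, as a left module, a direct sum of modules Δ_(i,r).

Two facts about finite split categories give this. First, by stability (`Mor.exists_comp_eq_self`),
a composite t∘s that does not leave the `𝒥`-class of s generates the same left ideal S∘s as s. Hence
the layer, modulo J_i, decomposes along the principal left ideals of morphisms. Since the category
is split, each of these is generated by an idempotent, so every summand is a direct summand of A/J_i
(`isRelativelyProjective_layer`). Secondly, every s in the class factors through e_i, so the layer
is generated by its e_i'-part. For such a module M the natural map Ae ⊗ eM → M is bijective
(`IsInducedLayer.cornerCounit_bijective`). The corner e_i'Ae_i' acts on e_i'M through k_αΓ_(e_i),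
which is semisimple by Maschke (`isSemisimpleRing_of_twistedBasis`), so e_i'M is a sum of inflated
simple modules and M is a sum of Δ's.

Simple modules are classified by the first ideal of the chain that acts on them nontrivially and by
their part under the corresponding idempotent (`IsStratifying.isSimpleRepresentatives`). The
projective cover of D_a can be taken to be a direct summand Q of A contained in Af_a. Intersecting Q
with the J_m gives its filtration: the top quotient is indecomposable and equals Δ_a, and the lower
layers are sums of Δ's with smaller index.

The two halves of the relation ⊏ are what the order has to contain. If D_b is a composition factor
of Rad(Δ_a), then f_b J f_a is not inside the next smaller ideal, where J belongs to the index of a.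
If Δ_b occurs below the top of the cover of D_a, then f_b J f_a is not inside the next smaller
ideal, where J belongs to the index of b. Maximality of Δ_a among the admissible quotients follows
from J² = J for the ideals of the chain. The structures `IsStratifying` and `IsAdaptedOrder` isolate
what is used about A, so that this part is pure ring theory. -/

noncomputable section

/-! ## The functor `A e ⊗_{e A e} -` and its right adjoint `M ↦ e M` -/

namespace CornerInduced

variable {A : Type u} [Ring A] {e : A} (he : IsIdempotentElem e)

/-- The map `t ↦ e ⊗ t`. -/
def unit (N : Type x) [AddCommGroup N] [Module he.Corner N] : N →+ CornerInduced he N :=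
  ((Submodule.mkQ (Submodule.span A (balancedRelations he N))).toAddMonoidHom).comp
    (TensorProduct.mk ℤ (Ideal.span {e} : Ideal A) N
      ⟨e, Ideal.mem_span_singleton_self e⟩).toAddMonoidHom

variable {N : Type x} [AddCommGroup N] [Module he.Corner N]

theorem mk_tmul_smul (p : (Ideal.span {e} : Ideal A)) (b : he.Corner) (t : N)
    (q : (Ideal.span {e} : Ideal A)) (hq : (q : A) = (p : A) * b.1) :
    (Submodule.Quotient.mk (p ⊗ₜ[ℤ] (b • t)) : CornerInduced he N) =
      Submodule.Quotient.mk (q ⊗ₜ[ℤ] t) := by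
  refine ((Submodule.Quotient.eq _).2 (Submodule.subset_span ?_)).symm
  exact ⟨p, q, b, t, hq, rfl⟩

/-- Since p e = p for p in A e, the tensor p ⊗ t is p (e ⊗ t). All later arguments use only the
elements e ⊗ t. -/
theorem mk_tmul (p : (Ideal.span {e} : Ideal A)) (t : N) :
    (Submodule.Quotient.mk (p ⊗ₜ[ℤ] t) : CornerInduced he N) = (p : A) • unit he N t := by
  have hp : (p : A) * e = p := by
    obtain ⟨a, ha⟩ := Ideal.mem_span_singleton'.1 p.2
    rw [← ha, mul_assoc, he.eq]
  change _ = (p : A) • Submodule.Quotient.mk (_ ⊗ₜ[ℤ] t)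
  rw [← Submodule.Quotient.mk_smul, TensorProduct.smul_tmul']
  congr 2
  exact Subtype.ext hp.symm

theorem unit_smul (b : he.Corner) (t : N) : unit he N (b • t) = b.1 • unit he N t := by
  obtain ⟨h₁, h₂⟩ := (Subsemigroup.mem_corner_iff he).1 b.2
  have hb : b.1 ∈ (Ideal.span {e} : Ideal A) := Ideal.mem_span_singleton'.2 ⟨b.1, h₂⟩
  rw [← mk_tmul he ⟨b.1, hb⟩ t]
  exact mk_tmul_smul he _ b t ⟨b.1, hb⟩ h₁.symm

theorem corner_one_val : ((1 : he.Corner) : he.Corner).1 = e := rfl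

theorem idem_smul_unit (t : N) : e • unit he N t = unit he N t := by
  conv_rhs => rw [← one_smul he.Corner t, unit_smul, corner_one_val]

theorem span_range_unit : Submodule.span A (Set.range (unit he N)) = ⊤ := by
  rw [eq_top_iff]
  rintro z -
  obtain ⟨z, rfl⟩ := Submodule.Quotient.mk_surjective _ z
  induction z using TensorProduct.induction_on with
  | zero => exact Submodule.zero_mem _
  | tmul p t =>
    rw [mk_tmul]
    exact Submodule.smul_mem _ _ (Submodule.subset_span ⟨t, rfl⟩)
  | add z z' h h' => exact Submodule.add_mem _ h h'

theorem hom_ext {M : Type y} [AddCommGroup M] [Module A M] {f g : CornerInduced he N →ₗ[A] M}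
    (h : ∀ t, f (unit he N t) = g (unit he N t)) : f = g :=
  LinearMap.ext_on (span_range_unit he) (by rintro _ ⟨t, rfl⟩; exact h t)

/-- The map `a ↦ e a e` onto the corner. -/
def toCorner : A →+ he.Corner where
  toFun a := ⟨e * a * e, a, rfl⟩
  map_zero' := Subtype.ext (by
    change e * 0 * e = 0
    simp)
  map_add' a b := Subtype.ext (by
    change e * (a + b) * e = e * a * e + e * b * e
    rw [mul_add, add_mul])

theorem toCorner_val (a : A) : (toCorner he a).1 = e * a * e := rfl

/-- The additive map `A e ⊗ N → N`, `a ⊗ t ↦ (e a e) t`. -/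
def counitAux (N : Type x) [AddCommGroup N] [Module he.Corner N] :
    ((Ideal.span {e} : Ideal A) ⊗[ℤ] N) →ₗ[ℤ] N :=
  TensorProduct.lift (AddMonoidHom.toIntLinearMap
    { toFun := fun p => AddMonoidHom.toIntLinearMap (smulAddHom he.Corner N (toCorner he p.1))
      map_zero' := by
        ext t
        exact (congrArg (· • t) (map_zero (toCorner he))).trans (zero_smul he.Corner t)
      map_add' := fun p q => by
        ext t
        exact (congrArg (· • t) (map_add (toCorner he) p.1 q.1)).trans (add_smul _ _ t) })

theorem counitAux_tmul (p : (Ideal.span {e} : Ideal A)) (t : N) :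
    counitAux he N (p ⊗ₜ t) = toCorner he p.1 • t := rfl

/-- `counitAux` is not `A`-linear, so the vanishing is proved after multiplication by an arbitrary
`a`; in this form it passes to the `A`-span of the relations. -/
theorem counitAux_smul_eq_zero {z : (Ideal.span {e} : Ideal A) ⊗[ℤ] N}
    (hz : z ∈ Submodule.span A (balancedRelations he N)) (a : A) :
    counitAux he N (a • z) = 0 := by
  induction hz using Submodule.span_induction generalizing a with
  | zero => simp
  | add x y _ _ hx hy => rw [smul_add, map_add, hx, hy, add_zero]
  | smul c x _ hx => rw [← mul_smul, hx]
  | mem x hx =>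
    obtain ⟨p, q, b, t, hq, rfl⟩ := hx
    rw [smul_sub, map_sub, TensorProduct.smul_tmul', TensorProduct.smul_tmul', counitAux_tmul,
      counitAux_tmul, ← mul_smul, sub_eq_zero]
    congr 1
    obtain ⟨h₁, h₂⟩ := (Subsemigroup.mem_corner_iff he).1 b.2
    refine Subtype.ext ?_
    change e * (a * q.1) * e = e * (a * p.1) * e * b.1
    rw [hq, mul_assoc _ e b.1, h₁]
    simp only [mul_assoc, h₂]

/-- The map a ⊗ t ↦ (eae) t respects the balancing relations and is a left inverse of t ↦ e ⊗ t. -/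
theorem unit_injective (N : Type x) [AddCommGroup N] [Module he.Corner N] :
    Function.Injective (unit he N) := by
  rw [injective_iff_map_eq_zero]
  intro t ht
  have h := counitAux_smul_eq_zero he ((Submodule.Quotient.mk_eq_zero _).1 ht) 1
  rw [one_smul] at h
  change counitAux he N (_ ⊗ₜ t) = 0 at h
  rw [counitAux_tmul] at h
  have h1 : toCorner he e = 1 := Subtype.ext (by
    change e * e * e = e
    rw [he.eq, he.eq])
  dsimp only at h
  rwa [h1, one_smul] at h

/-- Because e a (e ⊗ t) = e ⊗ (eae) t. With injectivity of `unit`, the e-part of A e ⊗ N is a copy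
of N. -/
theorem exists_unit_eq (z : CornerInduced he N) : ∃ t : N, e • z = unit he N t := by
  have hz : z ∈ Submodule.span A (Set.range (unit he N)) :=
    (span_range_unit he).ge Submodule.mem_top
  suffices h : ∀ a : A, ∃ t : N, e • a • z = unit he N t by
    simpa using h 1
  induction hz using Submodule.span_induction with
  | zero => exact fun a => ⟨0, by simp⟩
  | add x y _ _ hx hy =>
    intro a
    obtain ⟨t, ht⟩ := hx a
    obtain ⟨t', ht'⟩ := hy a
    exact ⟨t + t', by rw [smul_add, smul_add, ht, ht', map_add]⟩
  | smul c x _ hx => exact fun a => by rw [← mul_smul a]; exact hx _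
  | mem x hx =>
    obtain ⟨t, rfl⟩ := hx
    intro a
    refine ⟨toCorner he a • t, ?_⟩
    rw [unit_smul, toCorner_val]
    conv_lhs => rw [← idem_smul_unit]
    simp only [← mul_smul, mul_assoc]

section Lift

variable {M : Type y} [AddCommGroup M] [Module A M] (φ : N →+ M)
  (hφ : ∀ (b : he.Corner) (t : N), φ (b • t) = b.1 • φ t)

/-- The universal property of `A e ⊗_{e A e} N`. -/
def lift : CornerInduced he N →ₗ[A] M :=
  Submodule.liftQ _
    (TensorProduct.AlgebraTensorModule.lift
      { toFun := fun p => AddMonoidHom.toIntLinearMap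
          (((smulAddHom A M) p.1).comp φ)
        map_add' := fun p q => by
          ext t
          exact add_smul _ _ _
        map_smul' := fun a p => by
          ext t
          exact mul_smul _ _ _ } : ((Ideal.span {e} : Ideal A) ⊗[ℤ] N) →ₗ[A] M)
    (by
      rw [Submodule.span_le]
      rintro _ ⟨p, q, b, t, hq, rfl⟩
      change _ = _
      rw [map_sub, sub_eq_zero]
      change (q : A) • φ t = (p : A) • φ (b • t)
      rw [hφ, hq, mul_smul])

include hφ in
theorem idem_smul_of_equivariant (t : N) : e • φ t = φ t := by
  conv_rhs => rw [← one_smul he.Corner t, hφ, corner_one_val]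

theorem lift_unit (t : N) : lift he φ hφ (unit he N t) = φ t :=
  idem_smul_of_equivariant he φ hφ t

end Lift

/-- The functor `A e ⊗_{e A e} -` on morphisms. -/
def map {N' : Type y} [AddCommGroup N'] [Module he.Corner N'] (g : N →ₗ[he.Corner] N') :
    CornerInduced he N →ₗ[A] CornerInduced he N' :=
  lift he ((unit he N').comp g.toAddMonoidHom) (fun b t => by
    change unit he N' (g (b • t)) = b.1 • unit he N' (g t)
    rw [map_smul, unit_smul])

theorem map_unit {N' : Type y} [AddCommGroup N'] [Module he.Corner N'] (g : N →ₗ[he.Corner] N')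
    (t : N) : map he g (unit he N t) = unit he N' (g t) :=
  lift_unit he _ _ t

theorem map_comp_map {N' : Type y} [AddCommGroup N'] [Module he.Corner N'] (g : N →ₗ[he.Corner] N')
    (g' : N' →ₗ[he.Corner] N) (h : g ∘ₗ g' = LinearMap.id) : map he g ∘ₗ map he g' = LinearMap.id :=
  hom_ext he fun t => by
    rw [LinearMap.comp_apply, map_unit, map_unit, LinearMap.id_apply, ← LinearMap.comp_apply, h,
      LinearMap.id_apply]

/-- For a in J the element a e lies in the left ideal generated by J ∩ eAe, and those generators can
be moved across the tensor sign, where they kill N. Thus annihilation by J is inherited from the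
corner. -/
theorem smul_eq_zero {J : Ideal A} [J.IsTwoSided]
    (hJ : ∀ a ∈ J, a * e ∈ Ideal.span {y | y ∈ J ∧ e * y = y ∧ y * e = y})
    (hN : ∀ b : he.Corner, b.1 ∈ J → ∀ t : N, b • t = 0) {a : A} (ha : a ∈ J)
    (z : CornerInduced he N) : a • z = 0 := by
  have key : ∀ a ∈ J, ∀ t, a • unit he N t = 0 := by
    intro a ha t
    rw [← idem_smul_unit, ← mul_smul]
    have h := hJ a ha
    generalize a * e = a' at h
    induction h using Submodule.span_induction with
    | zero => rw [zero_smul]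
    | add x y _ _ hx hy => rw [add_smul, hx, hy, add_zero]
    | smul c x _ hx => rw [smul_eq_mul, mul_smul, hx, smul_zero]
    | mem x hx =>
      obtain ⟨b, rfl⟩ : ∃ b : he.Corner, b.1 = x :=
        ⟨⟨x, (Subsemigroup.mem_corner_iff he).2 hx.2⟩, rfl⟩
      rw [← unit_smul, hN b hx.1, map_zero]
  have hz : z ∈ Submodule.span A (Set.range (unit he N)) :=
    (span_range_unit he).ge Submodule.mem_top
  induction hz using Submodule.span_induction generalizing a with
  | zero => rw [smul_zero]
  | add x y _ _ hx hy => rw [smul_add, hx ha, hy ha, add_zero]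
  | smul c x _ hx => rw [← mul_smul]; exact hx (J.mul_mem_right c ha)
  | mem x hx =>
    obtain ⟨t, rfl⟩ := hx
    exact key a ha t

end CornerInduced

section CornerPart

variable {A : Type u} [Ring A] {e : A} (he : IsIdempotentElem e)

/-- The `e A e`-module `e M`. -/
def cornerPart (_ : IsIdempotentElem e) (M : Type y) [AddCommGroup M] [Module A M] :
    AddSubgroup M where
  carrier := {m | e • m = m}
  zero_mem' := smul_zero e
  add_mem' {m m'} h h' := by
    change e • (m + m') = m + m'
    rw [smul_add, h, h']
  neg_mem' {m} h := by
    change e • (-m) = -m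
    rw [smul_neg, h]

variable {M : Type y} [AddCommGroup M] [Module A M]

theorem corner_smul_mem_cornerPart (b : he.Corner) (m : M) : b.1 • m ∈ cornerPart he M := by
  change e • b.1 • m = _
  rw [← mul_smul, ((Subsemigroup.mem_corner_iff he).1 b.2).1]

instance cornerPartModule : Module he.Corner (cornerPart he M) where
  smul b m := ⟨b.1 • m.1, corner_smul_mem_cornerPart he b m.1⟩
  one_smul m := Subtype.ext m.2
  mul_smul b c m := Subtype.ext (mul_smul b.1 c.1 m.1)
  smul_zero b := Subtype.ext (smul_zero b.1)
  smul_add b m m' := Subtype.ext (smul_add b.1 m.1 m'.1)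
  add_smul b c m := Subtype.ext (add_smul b.1 c.1 m.1)
  zero_smul m := Subtype.ext (zero_smul A m.1)

theorem cornerPart_smul_val (b : he.Corner) (m : cornerPart he M) : (b • m).1 = b.1 • m.1 := rfl

/-- The natural map `A e ⊗_{e A e} e M → M`. -/
def cornerCounit (M : Type y) [AddCommGroup M] [Module A M] :
    CornerInduced he (cornerPart he M) →ₗ[A] M :=
  CornerInduced.lift he (cornerPart he M).subtype fun _ _ => rfl

theorem cornerCounit_unit (m : cornerPart he M) :
    cornerCounit he M (CornerInduced.unit he _ m) = m.1 :=
  CornerInduced.lift_unit he _ _ m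

theorem cornerCounit_surjective (h : Submodule.span A {m : M | e • m = m} = ⊤) :
    Function.Surjective (cornerCounit he M) := by
  rw [← LinearMap.range_eq_top, eq_top_iff, ← h, Submodule.span_le]
  intro m hm
  exact ⟨CornerInduced.unit he _ ⟨m, hm⟩, cornerCounit_unit he _⟩

end CornerPart
end

noncomputable section

/-! ## Modules over `A` that are projective relative to the quotient by an ideal -/

/-- `M` has the lifting property against epimorphisms of `A`-modules annihilated by `J`. -/
def IsRelativelyProjective {A : Type u} [Ring A] (J : Ideal A) (M : Type u) [AddCommGroup M]
    [Module A M] : Prop :=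
  ∀ (N N' : Type u) [AddCommGroup N] [Module A N] [AddCommGroup N'] [Module A N']
    (g : N →ₗ[A] N') (h : M →ₗ[A] N'), Function.Surjective g →
    (∀ a ∈ J, ∀ z : N, a • z = 0) → ∃ h' : M →ₗ[A] N, g ∘ₗ h' = h

namespace IsRelativelyProjective

variable {A : Type u} [Ring A] {J : Ideal A} {M M' : Type u} [AddCommGroup M] [Module A M]
  [AddCommGroup M'] [Module A M']

theorem of_retract (hM : IsRelativelyProjective J M) (i : M' →ₗ[A] M) (p : M →ₗ[A] M')
    (hpi : p ∘ₗ i = LinearMap.id) : IsRelativelyProjective J M' := by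
  intro N N' _ _ _ _ g h hg hN
  obtain ⟨h', hh⟩ := hM N N' g (h ∘ₗ p) hg hN
  exact ⟨h' ∘ₗ i, by rw [← LinearMap.comp_assoc, hh, LinearMap.comp_assoc, hpi, LinearMap.comp_id]⟩

/-- The dual basis lemma over A/J: the maps φ and r exhibit M as a direct summand of a finite free
A/J-module. -/
theorem of_sum {ι : Type*} [Fintype ι] (φ : ι → M →ₗ[A] A ⧸ J) (r : ι → A ⧸ J →ₗ[A] M)
    (hr : ∀ z, ∑ i, r i (φ i z) = z) : IsRelativelyProjective J M := by
  intro N N' _ _ _ _ g h hg hN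
  -- Lift the image of the class of 1 in each copy of A/J; the resulting map A → N descends to A/J
  -- because J kills N.
  choose m hm using fun i => hg (h (r i (Submodule.Quotient.mk 1)))
  let r' : ι → A ⧸ J →ₗ[A] N := fun i => J.liftQ (LinearMap.toSpanSingleton A N (m i))
    fun a ha => hN a ha _
  have key : ∀ i z, g (r' i z) = h (r i z) := by
    intro i z
    obtain ⟨a, rfl⟩ := Submodule.Quotient.mk_surjective _ z
    have ha : (Submodule.Quotient.mk a : A ⧸ J) = a • Submodule.Quotient.mk 1 := by
      rw [← Submodule.Quotient.mk_smul, smul_eq_mul, mul_one]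
    rw [ha, map_smul, map_smul, map_smul, map_smul, ← hm]
    congr 2
    exact one_smul A (m i)
  refine ⟨∑ i, r' i ∘ₗ φ i, LinearMap.ext fun z => ?_⟩
  rw [LinearMap.comp_apply, LinearMap.sum_apply, map_sum]
  conv_rhs => rw [← hr z, map_sum]
  exact Finset.sum_congr rfl fun i _ => key i _

end IsRelativelyProjective

/-- `M` is annihilated by `J`, generated by `e M`, and projective relative to `J`. -/
structure IsInducedLayer {A : Type u} [Ring A] (J : Ideal A) (e : A) (M : Type u) [AddCommGroup M]
    [Module A M] : Prop where
  smul_eq_zero : ∀ a ∈ J, ∀ z : M, a • z = 0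
  span_eq_top : Submodule.span A {m : M | e • m = m} = ⊤
  proj : IsRelativelyProjective J M

namespace IsInducedLayer

variable {A : Type u} [Ring A] {J : Ideal A} {e : A} {M M' : Type u} [AddCommGroup M] [Module A M]
  [AddCommGroup M'] [Module A M']

theorem of_retract (hM : IsInducedLayer J e M) (i : M' →ₗ[A] M) (p : M →ₗ[A] M')
    (hpi : p ∘ₗ i = LinearMap.id) : IsInducedLayer J e M' where
  smul_eq_zero a ha z := by
    rw [← LinearMap.id_apply (R := A) z, ← hpi, LinearMap.comp_apply, ← map_smul,
      hM.smul_eq_zero a ha, map_zero]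
  span_eq_top := by
    have hp : LinearMap.range p = ⊤ := LinearMap.range_eq_top.2 fun z =>
      ⟨i z, LinearMap.congr_fun hpi z⟩
    rw [eq_top_iff, ← hp, LinearMap.range_eq_map, ← hM.span_eq_top, Submodule.map_span]
    refine Submodule.span_mono ?_
    rintro _ ⟨m, hm, rfl⟩
    change e • p m = p m
    rw [← map_smul, hm]
  proj := hM.proj.of_retract i p hpi

variable [J.IsTwoSided] (he : IsIdempotentElem e)
  (hJ : ∀ a ∈ J, a * e ∈ Ideal.span {y | y ∈ J ∧ e * y = y ∧ y * e = y})

include hJ in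
-- Generation by eM makes the counit surjective, and both sides are killed by J, so relative
-- projectivity gives a section s. The counit is an isomorphism on e-parts, so s is also a left
-- inverse on the generators e ⊗ t.
theorem cornerCounit_bijective (hM : IsInducedLayer J e M) :
    Function.Bijective (cornerCounit he M) := by
  have hsurj := cornerCounit_surjective he hM.span_eq_top
  refine ⟨?_, hsurj⟩
  obtain ⟨s, hs⟩ := hM.proj _ _ (cornerCounit he M) LinearMap.id hsurj fun a ha z =>
    CornerInduced.smul_eq_zero he hJ
      (fun b hb t => Subtype.ext (hM.smul_eq_zero b.1 hb t.1)) ha z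
  suffices h : s ∘ₗ cornerCounit he M = LinearMap.id from
    Function.LeftInverse.injective (LinearMap.congr_fun h)
  refine CornerInduced.hom_ext he fun t => ?_
  set z := s (cornerCounit he M (CornerInduced.unit he _ t)) with hz
  have hez : e • z = z := by
    rw [hz, ← map_smul, ← map_smul, CornerInduced.idem_smul_unit]
  obtain ⟨t', ht'⟩ := CornerInduced.exists_unit_eq he z
  change z = CornerInduced.unit he _ t
  rw [← hez, ht']
  congr 1
  -- Two elements e ⊗ t' and e ⊗ t with the same image under the counit have t' = t.
  refine Subtype.ext ?_
  rw [← cornerCounit_unit he t', ← cornerCounit_unit he t, ← ht', hez, hz]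
  exact LinearMap.congr_fun hs _

variable {κ : Type*} {N : κ → Type x} [∀ r, AddCommGroup (N r)] [∀ r, Module he.Corner (N r)]
  (hss : ∀ (V : Type u) [AddCommGroup V] [Module he.Corner V],
    (∀ b : he.Corner, b.1 ∈ J → ∀ t : V, b • t = 0) → IsSemisimpleModule he.Corner V)
  (hN : ∀ (V : Type u) [AddCommGroup V] [Module he.Corner V], IsSimpleModule he.Corner V →
    (∀ b : he.Corner, b.1 ∈ J → ∀ t : V, b • t = 0) → ∃ r, Nonempty (V ≃ₗ[he.Corner] N r))

include hJ hss hN in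
-- The corner module eM is nonzero and semisimple, so it has a simple direct summand; the functor A
-- e ⊗ - preserves the splitting, and the counit identifies A e ⊗ eM with M.
theorem exists_split_epi [Nontrivial M] (hM : IsInducedLayer J e M) :
    ∃ (r : κ) (g : M →ₗ[A] CornerInduced he (N r)) (s : CornerInduced he (N r) →ₗ[A] M),
      g ∘ₗ s = LinearMap.id ∧ g ≠ 0 := by
  have hkill : ∀ b : he.Corner, b.1 ∈ J → ∀ t : cornerPart he M, b • t = 0 :=
    fun b hb t => Subtype.ext (hM.smul_eq_zero b.1 hb t.1)
  have := hss (cornerPart he M) hkill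
  have hnt : Nontrivial (cornerPart he M) := by
    by_contra h
    rw [not_nontrivial_iff_subsingleton] at h
    have h0 : {m : M | e • m = m} ⊆ {0} := fun m hm =>
      congrArg Subtype.val (Subsingleton.elim (⟨m, hm⟩ : cornerPart he M) 0)
    have h1 := Submodule.span_mono (R := A) h0
    rw [hM.span_eq_top, Submodule.span_zero_singleton] at h1
    exact top_ne_bot (le_bot_iff.1 h1)
  obtain ⟨V, -, hV⟩ := (IsSemisimpleModule.eq_bot_or_exists_simple_le
    (⊤ : Submodule he.Corner (cornerPart he M))).resolve_left top_ne_bot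
  obtain ⟨V', hV'⟩ := exists_isCompl V
  obtain ⟨r, ⟨θ⟩⟩ := hN V hV fun b hb t => Subtype.ext (hkill b hb t.1)
  let p : cornerPart he M →ₗ[he.Corner] N r := θ.toLinearMap ∘ₗ V.projectionOnto V' hV'
  let i : N r →ₗ[he.Corner] cornerPart he M := V.subtype ∘ₗ θ.symm.toLinearMap
  have hpi : p ∘ₗ i = LinearMap.id := by
    ext t
    simp [p, i]
  let E := LinearEquiv.ofBijective (cornerCounit he M) (hM.cornerCounit_bijective he hJ)
  refine ⟨r, CornerInduced.map he p ∘ₗ E.symm.toLinearMap,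
    E.toLinearMap ∘ₗ CornerInduced.map he i, ?_⟩
  have hgs : (CornerInduced.map he p ∘ₗ E.symm.toLinearMap) ∘ₗ
      (E.toLinearMap ∘ₗ CornerInduced.map he i) = LinearMap.id := by
    refine LinearMap.ext fun z => ?_
    have := LinearMap.congr_fun (CornerInduced.map_comp_map he p i hpi) z
    simpa using this
  refine ⟨hgs, fun h0 => ?_⟩
  have := IsSimpleModule.nontrivial he.Corner V
  obtain ⟨t, ht⟩ := exists_ne (0 : V)
  have h1 := LinearMap.congr_fun hgs (CornerInduced.unit he _ (θ t))
  rw [h0, LinearMap.zero_comp, LinearMap.zero_apply, LinearMap.id_apply] at h1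
  exact ht (by simpa using CornerInduced.unit_injective he _ (h1.symm.trans (map_zero _).symm))

/-- `F'` covers `F` with quotient isomorphic to one of the induced modules `A e ⊗ N r`. -/
def _root_.InducedStep {e : A} (he : IsIdempotentElem e) {κ : Type*} (N : κ → Type x)
    [∀ r, AddCommGroup (N r)] [∀ r, Module he.Corner (N r)] {Q : Type u} [AddCommGroup Q]
    [Module A Q] (F F' : Submodule A Q) : Prop :=
  F < F' ∧ ∃ r, Nonempty ((F' ⧸ F.submoduleOf F') ≃ₗ[A] CornerInduced he (N r))

include hJ hss hN in
-- Split off one induced quotient of F/F₀ and continue with its kernel F'/F₀. The kernel is the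
-- complementary summand, so it has the same layer properties, and the descent stops because Q is
-- Artinian.
theorem reflTransGen_inducedStep {Q : Type u} [AddCommGroup Q] [Module A Q] [IsArtinian A Q]
    (F₀ F : Submodule A Q) (hle : F₀ ≤ F) (hF : IsInducedLayer J e (F ⧸ F₀.submoduleOf F)) :
    Relation.ReflTransGen (InducedStep he N) F₀ F := by
  induction F using WellFoundedLT.induction with
  | ind F ih =>
    rcases hle.eq_or_lt with rfl | hlt
    · exact .refl
    have hnt : Nontrivial (F ⧸ F₀.submoduleOf F) := by
      rw [Submodule.Quotient.nontrivial_iff, Ne, Submodule.submoduleOf_eq_top]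
      exact not_le_of_gt hlt
    obtain ⟨r, g, s, hgs, hg0⟩ := hF.exists_split_epi he hJ hss hN
    have hg : Function.Surjective g := fun z => ⟨s z, LinearMap.congr_fun hgs z⟩
    let q := g ∘ₗ (F₀.submoduleOf F).mkQ
    have hq : Function.Surjective q := hg.comp (Submodule.mkQ_surjective _)
    let F' := (LinearMap.ker q).map F.subtype
    have hF'F : F' ≤ F := Submodule.map_subtype_le _ _
    have hker : F'.submoduleOf F = LinearMap.ker q :=
      Submodule.comap_map_eq_of_injective F.injective_subtype _
    have hF₀F' : F₀ ≤ F' := fun x hx => ⟨⟨x, hle hx⟩, by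
      change g (Submodule.Quotient.mk _) = 0
      rw [(Submodule.Quotient.mk_eq_zero _).2 (by exact hx), map_zero], rfl⟩
    have hlt' : F' < F := by
      refine lt_of_le_of_ne hF'F fun h => hg0 ?_
      have : LinearMap.ker q = ⊤ := by rw [← hker, h, Submodule.submoduleOf_self]
      refine LinearMap.ext fun z => ?_
      obtain ⟨z, rfl⟩ := Submodule.mkQ_surjective _ z
      exact (LinearMap.mem_ker.1 (this ▸ Submodule.mem_top : z ∈ LinearMap.ker q))
    let j : (F' ⧸ F₀.submoduleOf F') →ₗ[A] (F ⧸ F₀.submoduleOf F) :=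
      Submodule.mapQ _ _ (Submodule.inclusion hF'F) fun _ hx => hx
    have hj : Function.Injective j := by
      rw [← LinearMap.ker_eq_bot]
      exact Submodule.ker_liftQ_eq_bot _ _ _ fun x hx =>
        (Submodule.Quotient.mk_eq_zero (F₀.submoduleOf F)).1 (LinearMap.mem_ker.1 hx)
    have hgj : g ∘ₗ j = 0 := by
      refine LinearMap.ext fun z => ?_
      obtain ⟨⟨x, y, hy, rfl⟩, rfl⟩ := Submodule.mkQ_surjective _ z
      exact hy
    have hmem : ∀ z, z - s (g z) ∈ LinearMap.range j := by
      intro z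
      have hz : g (z - s (g z)) = 0 := by
        rw [map_sub, sub_eq_zero]
        exact (LinearMap.congr_fun hgs (g z)).symm
      obtain ⟨y, hy⟩ := Submodule.mkQ_surjective _ (z - s (g z))
      rw [← hy] at hz ⊢
      exact ⟨Submodule.Quotient.mk ⟨y, y, hz, rfl⟩, rfl⟩
    -- The endomorphism 1 - s g projects onto ker g, which is the image of F'/F₀; this is the
    -- retraction of j.
    let p : (F ⧸ F₀.submoduleOf F) →ₗ[A] (F' ⧸ F₀.submoduleOf F') :=
      (LinearEquiv.ofInjective j hj).symm.toLinearMap ∘ₗ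
        LinearMap.codRestrict (LinearMap.range j) (LinearMap.id - s ∘ₗ g) hmem
    have hpj : p ∘ₗ j = LinearMap.id := by
      refine LinearMap.ext fun z => ?_
      change (LinearEquiv.ofInjective j hj).symm _ = z
      rw [LinearEquiv.symm_apply_eq]
      refine Subtype.ext ?_
      change j z - s (g (j z)) = j z
      rw [← LinearMap.comp_apply g, hgj, LinearMap.zero_apply, map_zero, sub_zero]
    exact (ih F' hlt' hF₀F' (hF.of_retract j p hpj)).tail
      ⟨hlt', r, ⟨(Submodule.quotEquivOfEq _ _ hker).trans (q.quotKerEquivOfSurjective hq)⟩⟩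

end IsInducedLayer
end

noncomputable section

/-! ## Projective covers over Artinian rings -/

section ProjectiveCover

variable {A : Type u} [Ring A]

/-- Right multiplication by η is a retraction of A onto Q. -/
theorem Ideal.projective_of_rightUnit {Q : Ideal A} {η : A} (hη : η ∈ Q)
    (hQ : ∀ q ∈ Q, q * η = q) : Module.Projective A Q :=
  Module.Projective.of_split Q.subtype (LinearMap.toSpanSingleton A Q ⟨η, hη⟩)
    (LinearMap.ext fun q => Subtype.ext (hQ q.1 q.2))

/-- Among the direct summands of A inside A f that map onto D, take a minimal one, Q. If a proper N
supplemented the kernel, lifting π through N would give an endomorphism ψ of Q with image in N and π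
ψ = π; by Fitting's lemma the image of a high power of ψ is a smaller summand still mapping onto D.
-/
theorem exists_isProjectiveCover_ideal [IsArtinianRing A] {f : A} (hf : IsIdempotentElem f)
    {D : Type y} [AddCommGroup D] [Module A D]
    (π₀ : (Ideal.span {f} : Ideal A) →ₗ[A] D) (hπ₀ : Function.Surjective π₀) :
    ∃ (Q : Ideal A) (η : A) (π : Q →ₗ[A] D), η ∈ Q ∧ (∀ q ∈ Q, q * η = q) ∧
      Q ≤ Ideal.span {f} ∧ IsProjectiveCover π := by
  let s : Set (Ideal A) := {Q | ∃ η ∈ Q, (∀ q ∈ Q, q * η = q) ∧ Q ≤ Ideal.span {f} ∧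
    ∃ π : Q →ₗ[A] D, Function.Surjective π}
  have hs : s.Nonempty := ⟨Ideal.span {f}, f, Ideal.mem_span_singleton_self f, fun q hq => by
    obtain ⟨a, rfl⟩ := Ideal.mem_span_singleton'.1 hq
    rw [mul_assoc, hf.eq], le_rfl, π₀, hπ₀⟩
  obtain ⟨Q, ⟨η, hη, hQ, hQf, π, hπ⟩, hmin⟩ :=
    (IsWellFounded.wf : WellFounded ((· < ·) : Ideal A → Ideal A → Prop)).has_min s hs
  have hproj := Ideal.projective_of_rightUnit hη hQ
  refine ⟨Q, η, π, hη, hQ, hQf, hproj, hπ, fun N hN => ?_⟩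
  by_contra hNtop
  have hπN : Function.Surjective (π ∘ₗ N.subtype) := by
    intro d
    obtain ⟨z, rfl⟩ := hπ d
    obtain ⟨x, hx, y, hy, rfl⟩ := Submodule.mem_sup.1 (hN.ge (Submodule.mem_top (x := z)))
    exact ⟨⟨x, hx⟩, by rw [map_add, LinearMap.mem_ker.1 hy, add_zero]; rfl⟩
  obtain ⟨φ, hφ⟩ := Module.projective_lifting_property (π ∘ₗ N.subtype) π hπN
  let ψ : Module.End A Q := N.subtype ∘ₗ φ
  have hψ : π ∘ₗ ψ = π := hφ
  have hψn : ∀ n, π ∘ₗ (ψ ^ n) = π := by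
    intro n
    induction n with
    | zero => rfl
    | succ n ih => rw [pow_succ, Module.End.mul_eq_comp, ← LinearMap.comp_assoc, ih, hψ]
  obtain ⟨m, hm⟩ := Filter.eventually_atTop.1 ψ.eventually_isCompl_ker_pow_range_pow
  -- The exponent m + 1 is positive, which is needed for the image of the power to lie in N.
  have hc := hm (m + 1) (Nat.le_succ m)
  set R := LinearMap.range (ψ ^ (m + 1)) with hR
  have hRN : R ≤ N := by
    rintro _ ⟨z, rfl⟩
    rw [pow_succ']
    exact (φ ((ψ ^ m) z)).2
  have hπR : ∀ d, ∃ z ∈ R, π z = d := by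
    intro d
    obtain ⟨z, rfl⟩ := hπ d
    exact ⟨_, ⟨z, rfl⟩, LinearMap.congr_fun (hψn (m + 1)) z⟩
  let ρ := R.projectionOnto _ hc.symm
  have hle : R.map Q.subtype ≤ Q := Submodule.map_subtype_le _ _
  -- The projection of η to the summand R is a right unit of R.
  refine hmin (R.map Q.subtype) ⟨(ρ ⟨η, hη⟩).1.1, ⟨_, (ρ ⟨η, hη⟩).2, rfl⟩, ?_, hle.trans hQf,
    π ∘ₗ Submodule.inclusion hle, ?_⟩ (lt_of_le_of_ne hle fun h => hNtop ?_)
  · rintro _ ⟨q, hq, rfl⟩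
    have h1 : q.1 • ρ ⟨η, hη⟩ = ⟨q, hq⟩ := by
      have : (q : A) • (⟨η, hη⟩ : Q) = q := Subtype.ext (hQ q.1 q.2)
      have h2 := Submodule.projectionOnto_apply_left hc.symm ⟨q, hq⟩
      exact (map_smul ρ q.1 ⟨η, hη⟩).symm.trans ((congrArg ρ this).trans h2)
    exact congrArg (fun z : R => z.1.1) h1
  · intro d
    obtain ⟨z, hz, rfl⟩ := hπR d
    exact ⟨⟨z.1, z, hz, rfl⟩, rfl⟩
  · rw [eq_top_iff]
    intro q _
    obtain ⟨q', hq', hqq'⟩ := h.ge q.2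
    exact hRN (Subtype.ext hqq' ▸ hq')

end ProjectiveCover
end

noncomputable section

/-! ## The head of `A e ⊗ N` for a simple `e A e`-module `N` -/

section InducedHead

variable {A : Type u} [Ring A] {e : A} (he : IsIdempotentElem e)

/-- A nonzero w in eM generates M over A; if m = a w with m in eM, then m = (eae) w. -/
theorem isSimpleModule_cornerPart {M : Type y} [AddCommGroup M] [Module A M] [IsSimpleModule A M]
    [Nontrivial (cornerPart he M)] : IsSimpleModule he.Corner (cornerPart he M) := by
  rw [isSimpleModule_iff]
  refine { eq_bot_or_eq_top := fun W => or_iff_not_imp_left.2 fun hW => ?_ }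
  obtain ⟨w, hw, hw0⟩ := (Submodule.ne_bot_iff W).1 hW
  have hw0' : w.1 ≠ 0 := fun h => hw0 (Subtype.ext h)
  rw [eq_top_iff]
  intro m _
  have hm : m.1 ∈ Submodule.span A {w.1} := by
    rw [IsSimpleModule.span_singleton_eq_top A hw0']
    exact Submodule.mem_top
  obtain ⟨a, ha⟩ := Submodule.mem_span_singleton.1 hm
  have : CornerInduced.toCorner he a • w = m := by
    refine Subtype.ext ?_
    rw [cornerPart_smul_val, CornerInduced.toCorner_val, mul_smul, w.2, mul_smul, ha, m.2]
  exact this ▸ W.smul_mem _ hw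

/-- The functor `M ↦ e M` on isomorphisms. -/
def cornerPartCongr {M : Type x} [AddCommGroup M] [Module A M] {M' : Type y} [AddCommGroup M']
    [Module A M'] (θ : M ≃ₗ[A] M') : cornerPart he M ≃ₗ[he.Corner] cornerPart he M' where
  toFun m := ⟨θ m.1, by
    change e • θ m.1 = θ m.1
    rw [← map_smul, m.2]⟩
  invFun m := ⟨θ.symm m.1, by
    change e • θ.symm m.1 = θ.symm m.1
    rw [← map_smul, m.2]⟩
  left_inv m := Subtype.ext (θ.symm_apply_apply m.1)
  right_inv m := Subtype.ext (θ.apply_symm_apply m.1)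
  map_add' m m' := Subtype.ext (map_add θ m.1 m'.1)
  map_smul' b m := Subtype.ext (map_smul θ b.1 m.1)

/-- `M` has a unique maximal submodule. -/
theorem moduleRad_eq_of_unique {M : Type y} [AddCommGroup M] [Module A M] {W : Submodule A M}
    (hW : W ≠ ⊤) (hmax : ∀ W' : Submodule A M, W' ≠ ⊤ → W' ≤ W) :
    IsCoatom W ∧ moduleRad A M = W := by
  have hco : IsCoatom W := ⟨hW, fun W' hlt => by
    by_contra h
    exact (hmax W' h).not_gt hlt⟩
  refine ⟨hco, le_antisymm (sInf_le hco) (le_sInf fun W' hW' => ?_)⟩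
  exact (hW'.le_iff.1 (hmax W' hW'.1)).resolve_left hW |>.le

namespace CornerInduced

variable (N : Type x) [AddCommGroup N] [Module he.Corner N]

/-- The largest submodule of `A e ⊗ N` that is annihilated by `e`. -/
def radical : Submodule A (CornerInduced he N) where
  carrier := {z | ∀ c : A, e • c • z = 0}
  zero_mem' c := by rw [smul_zero, smul_zero]
  add_mem' {z z'} h h' c := by rw [smul_add, smul_add, h, h', add_zero]
  smul_mem' a z h c := by
    rw [← mul_smul c]
    exact h _

variable {N} in
/-- The map `N → e M` induced by a homomorphism `A e ⊗ N → M`. -/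
def toCornerPart {M : Type y} [AddCommGroup M] [Module A M] (g : CornerInduced he N →ₗ[A] M) :
    N →ₗ[he.Corner] cornerPart he M where
  toFun t := ⟨g (unit he N t), by
    change e • g (unit he N t) = g (unit he N t)
    rw [← map_smul, idem_smul_unit]⟩
  map_add' t t' := Subtype.ext (by
    change g (unit he N (t + t')) = g (unit he N t) + g (unit he N t')
    rw [map_add, map_add])
  map_smul' b t := Subtype.ext (by
    change g (unit he N (b • t)) = b.1 • g (unit he N t)
    rw [unit_smul, map_smul])

variable {N} in
theorem toCornerPart_val {M : Type y} [AddCommGroup M] [Module A M]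
    (g : CornerInduced he N →ₗ[A] M) (t : N) : (toCornerPart he g t).1 = g (unit he N t) := rfl

theorem unit_notMem_radical {t : N} (ht : t ≠ 0) : unit he N t ∉ radical he N := fun h => ht <| by
  have := h 1
  rw [one_smul, idem_smul_unit] at this
  exact unit_injective he N (this.trans (map_zero _).symm)

variable [IsSimpleModule he.Corner N]

variable {N} in
-- The elements t with e ⊗ t in W form a submodule of the simple module N. It contains the nonzero
-- element coming from e z, so it is all of N, and e ⊗ N generates. Hence every proper submodule
-- satisfies e W = 0, and A e ⊗ N has a largest proper submodule.
theorem eq_top_of_smul_ne_zero {W : Submodule A (CornerInduced he N)} {z : CornerInduced he N}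
    (hz : z ∈ W) (hez : e • z ≠ 0) : W = ⊤ := by
  let V : Submodule he.Corner N :=
    { carrier := {t | unit he N t ∈ W}
      zero_mem' := by
        change unit he N 0 ∈ W
        rw [map_zero]
        exact W.zero_mem
      add_mem' := fun {t t'} h h' => by
        change unit he N (t + t') ∈ W
        rw [map_add]
        exact W.add_mem h h'
      smul_mem' := fun b t h => by
        change unit he N (b • t) ∈ W
        rw [unit_smul]
        exact W.smul_mem _ h }
  obtain ⟨t, ht⟩ := exists_unit_eq he z
  have htV : t ∈ V := by
    change unit he N t ∈ W
    rw [← ht]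
    exact W.smul_mem _ hz
  have hV : V = ⊤ := (eq_bot_or_eq_top V).resolve_left fun h => hez (by
    rw [ht, (Submodule.mem_bot _).1 (h ▸ htV : t ∈ (⊥ : Submodule he.Corner N)), map_zero])
  rw [eq_top_iff, ← span_range_unit he (N := N), Submodule.span_le]
  rintro _ ⟨t, rfl⟩
  exact (hV.ge Submodule.mem_top : t ∈ V)

theorem le_radical_of_ne_top {W : Submodule A (CornerInduced he N)} (hW : W ≠ ⊤) :
    W ≤ radical he N := fun z hz c => by
  by_contra h
  exact hW (eq_top_of_smul_ne_zero he (W.smul_mem c hz) h)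

theorem radical_ne_top : radical he N ≠ ⊤ := fun h => by
  have := IsSimpleModule.nontrivial he.Corner N
  obtain ⟨t, ht⟩ := exists_ne (0 : N)
  exact unit_notMem_radical he N ht (h ▸ Submodule.mem_top)

theorem isCoatom_radical : IsCoatom (radical he N) :=
  (moduleRad_eq_of_unique (radical_ne_top he N) fun _ => le_radical_of_ne_top he N).1

theorem moduleRad_eq : moduleRad A (CornerInduced he N) = radical he N :=
  (moduleRad_eq_of_unique (radical_ne_top he N) fun _ => le_radical_of_ne_top he N).2

instance isSimpleModule_head : IsSimpleModule A (Head A (CornerInduced he N)) :=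
  isSimpleModule_iff_isCoatom.2 (by rw [moduleRad_eq]; exact isCoatom_radical he N)

/-- The map `N → e (A e ⊗ N / Rad (A e ⊗ N))` is an isomorphism. -/
def equivCornerPartHead : N ≃ₗ[he.Corner] cornerPart he (Head A (CornerInduced he N)) :=
  LinearEquiv.ofBijective (toCornerPart he (moduleRad A (CornerInduced he N)).mkQ) <| by
    constructor
    · rw [injective_iff_map_eq_zero]
      intro t ht
      by_contra h0
      refine unit_notMem_radical he N h0 ?_
      rw [← moduleRad_eq]
      exact (Submodule.Quotient.mk_eq_zero _).1 (congrArg Subtype.val ht)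
    · rintro ⟨z, hz⟩
      obtain ⟨z, rfl⟩ := Submodule.mkQ_surjective _ z
      obtain ⟨t, ht⟩ := exists_unit_eq he z
      refine ⟨t, Subtype.ext ?_⟩
      rw [toCornerPart_val, ← ht, map_smul]
      exact hz

theorem equivCornerPartHead_val (t : N) : (equivCornerPartHead he N t).1 =
    (moduleRad A (CornerInduced he N)).mkQ (unit he N t) := rfl

variable {N} in
/-- A simple module `M` with `e M ≅ N` is the head of `A e ⊗ N`. -/
theorem nonempty_equiv_head {M : Type y} [AddCommGroup M] [Module A M] [IsSimpleModule A M]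
    (θ : cornerPart he M ≃ₗ[he.Corner] N) :
    Nonempty (M ≃ₗ[A] Head A (CornerInduced he N)) := by
  have := IsSimpleModule.nontrivial he.Corner N
  obtain ⟨t, ht⟩ := exists_ne (0 : N)
  let φ : CornerInduced he N →ₗ[A] M := cornerCounit he M ∘ₗ map he θ.symm.toLinearMap
  have hφ : φ ≠ 0 := fun h => ht (by
    have h1 := LinearMap.congr_fun h (unit he N t)
    change cornerCounit he M (map he θ.symm.toLinearMap (unit he N t)) = 0 at h1
    rw [map_unit, cornerCounit_unit] at h1
    exact θ.symm.map_eq_zero_iff.1 (Subtype.ext h1))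
  have hs : Function.Surjective φ := LinearMap.range_eq_top.1
    ((eq_bot_or_eq_top (LinearMap.range φ)).resolve_left fun h => hφ (LinearMap.range_eq_bot.1 h))
  have hk : IsCoatom (LinearMap.ker φ) :=
    isSimpleModule_iff_isCoatom.1 (.congr (φ.quotKerEquivOfSurjective hs))
  have hk' : moduleRad A (CornerInduced he N) = LinearMap.ker φ := by
    rw [moduleRad_eq]
    exact (hk.le_iff.1 (le_radical_of_ne_top he N hk.1)).resolve_left (radical_ne_top he N)
  exact ⟨((Submodule.quotEquivOfEq _ _ hk').trans (φ.quotKerEquivOfSurjective hs)).symm⟩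

end CornerInduced

end InducedHead
end

noncomputable section

/-! ## Chains of idempotent ideals with projective layers -/

/-- `J 0 ≤ ⋯ ≤ J n` is a chain of idempotent ideals from `0` to `A`, the `i`-th layer of which is
generated by the idempotent `e i`, projective modulo `J i`, and controlled by a semisimple quotient
of the corner at `e i` whose simple modules are the `N i r`. -/
structure IsStratifying {A : Type u} [Ring A] {n : ℕ} (J : ℕ → Ideal A) {e : Fin n → A}
    (he : ∀ i, IsIdempotentElem (e i)) {l : Fin n → ℕ} (N : ∀ i, Fin (l i) → Type x)
    [∀ i r, AddCommGroup (N i r)] [∀ i r, Module (he i).Corner (N i r)] : Prop where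
  isTwoSided : ∀ m, (J m).IsTwoSided
  mono : Monotone J
  bot : J 0 = ⊥
  top : J n = ⊤
  idem : ∀ m, ∀ a ∈ J m, a ∈ Ideal.span {z | ∃ b ∈ J m, ∃ c ∈ J m, z = b * c}
  mem : ∀ i : Fin n, e i ∈ J (i + 1)
  generated : ∀ i : Fin n, ∀ a ∈ J (i + 1), ∃ b ∈ Ideal.span {z | z ∈ J (i + 1) ∧ e i * z = z},
    a - b ∈ J i
  corner : ∀ i : Fin n, ∀ a ∈ J i, a * e i ∈ Ideal.span {z | z ∈ J i ∧ e i * z = z ∧ z * e i = z}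
  proj : ∀ i : Fin n,
    IsRelativelyProjective (J i) (J (i + 1) ⧸ (J i).submoduleOf (J (i + 1)))
  semisimple : ∀ i (V : Type u) [AddCommGroup V] [Module (he i).Corner V],
    (∀ b : (he i).Corner, b.1 ∈ J i → ∀ t : V, b • t = 0) → IsSemisimpleModule (he i).Corner V
  simple : ∀ i r, IsSimpleModule (he i).Corner (N i r)
  annihilated : ∀ i r (b : (he i).Corner), b.1 ∈ J i → ∀ t : N i r, b • t = 0
  irredundant : ∀ i r s, Nonempty (N i r ≃ₗ[(he i).Corner] N i s) → r = s
  complete : ∀ i (V : Type u) [AddCommGroup V] [Module (he i).Corner V],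
    IsSimpleModule (he i).Corner V → (∀ b : (he i).Corner, b.1 ∈ J i → ∀ t : V, b • t = 0) →
    ∃ r, Nonempty (V ≃ₗ[(he i).Corner] N i r)

namespace IsStratifying

variable {A : Type u} [Ring A] {n : ℕ} {J : ℕ → Ideal A} {e : Fin n → A}
  {he : ∀ i, IsIdempotentElem (e i)} {l : Fin n → ℕ} {N : ∀ i, Fin (l i) → Type x}
  [∀ i r, AddCommGroup (N i r)] [∀ i r, Module (he i).Corner (N i r)]
  (H : IsStratifying J he N)

include H

theorem smul_induced_eq_zero (i : Fin n) (r : Fin (l i)) {a : A} (ha : a ∈ J i)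
    (z : CornerInduced (he i) (N i r)) : a • z = 0 :=
  have := H.isTwoSided i
  CornerInduced.smul_eq_zero (he i) (H.corner i) (H.annihilated i r) ha z

theorem smul_head_eq_zero (i : Fin n) (r : Fin (l i)) {a : A} (ha : a ∈ J i)
    (z : Head A (CornerInduced (he i) (N i r))) : a • z = 0 := by
  obtain ⟨z, rfl⟩ := Submodule.mkQ_surjective _ z
  rw [← map_smul, H.smul_induced_eq_zero i r ha, map_zero]

theorem isSimpleModule_head (a : Σ i, Fin (l i)) :
    IsSimpleModule A (Head A (CornerInduced (he a.1) (N a.1 a.2))) :=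
  have := H.simple a.1 a.2
  CornerInduced.isSimpleModule_head (he a.1) (N a.1 a.2)

theorem exists_smul_head_ne_zero (a : Σ i, Fin (l i)) :
    ∃ z : Head A (CornerInduced (he a.1) (N a.1 a.2)), e a.1 • z ≠ 0 := by
  have := H.simple a.1 a.2
  have := IsSimpleModule.nontrivial (he a.1).Corner (N a.1 a.2)
  obtain ⟨t, ht⟩ := exists_ne (0 : N a.1 a.2)
  let z := CornerInduced.equivCornerPartHead (he a.1) (N a.1 a.2) t
  refine ⟨z.1, fun h => ht ?_⟩
  refine (CornerInduced.equivCornerPartHead (he a.1) (N a.1 a.2)).map_eq_zero_iff.1 (Subtype.ext ?_)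
  exact z.2.symm.trans h

/-- The index can be read off the module: e_a lies in J_(a+1) and does not kill the head for a,
whereas J_b kills the head for b. -/
theorem le_of_head_equiv {a b : Σ i, Fin (l i)}
    (θ : Head A (CornerInduced (he a.1) (N a.1 a.2)) ≃ₗ[A]
      Head A (CornerInduced (he b.1) (N b.1 b.2))) : b.1 ≤ a.1 := by
  by_contra! h
  obtain ⟨z, hz⟩ := H.exists_smul_head_ne_zero a
  refine hz (θ.map_eq_zero_iff.1 ?_)
  rw [map_smul]
  exact H.smul_head_eq_zero b.1 b.2 (H.mono h (H.mem a.1)) _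

theorem head_irredundant (a b : Σ i, Fin (l i))
    (h : Nonempty (Head A (CornerInduced (he a.1) (N a.1 a.2)) ≃ₗ[A]
      Head A (CornerInduced (he b.1) (N b.1 b.2)))) : a = b := by
  obtain ⟨θ⟩ := h
  have hab : a.1 = b.1 := le_antisymm (H.le_of_head_equiv θ.symm) (H.le_of_head_equiv θ)
  obtain ⟨i, r⟩ := a
  obtain ⟨j, s⟩ := b
  obtain rfl : i = j := hab
  have := H.simple i r
  have := H.simple i s
  congr 1
  exact H.irredundant i r s ⟨(CornerInduced.equivCornerPartHead (he i) (N i r)).trans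
    ((cornerPartCongr (he i) θ).trans (CornerInduced.equivCornerPartHead (he i) (N i s)).symm)⟩

/-- The label is found from the least m for which J_m does not annihilate M. With m = i + 1, the
corner part e_i M is then a simple module killed by J_i, which determines r. -/
theorem head_complete (M : Type u) [AddCommGroup M] [Module A M] (hM : IsSimpleModule A M) :
    ∃ a : Σ i, Fin (l i), Nonempty (M ≃ₗ[A] Head A (CornerInduced (he a.1) (N a.1 a.2))) := by
  classical
  have := IsSimpleModule.nontrivial A M
  obtain ⟨z₀, hz₀⟩ := exists_ne (0 : M)
  have hex : ∃ m, ∃ a ∈ J m, ∃ z : M, a • z ≠ 0 :=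
    ⟨n, 1, H.top ▸ Submodule.mem_top, z₀, by rwa [one_smul]⟩
  obtain ⟨a, ha, z, haz⟩ := Nat.find_spec hex
  have hle : Nat.find hex ≤ n :=
    Nat.find_min' hex ⟨1, H.top ▸ Submodule.mem_top, z₀, by rwa [one_smul]⟩
  have hmin : ∀ m < Nat.find hex, ∀ a ∈ J m, ∀ z : M, a • z = 0 := fun m hm a ha z => by
    by_contra h
    exact Nat.find_min hex hm ⟨a, ha, z, h⟩
  rcases hm : Nat.find hex with _ | m
  · rw [hm, H.bot, Submodule.mem_bot] at ha
    exact absurd (by rw [ha, zero_smul]) haz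
  · rw [hm] at ha hle hmin
    let i : Fin n := ⟨m, hle⟩
    have hkill : ∀ a ∈ J i, ∀ z : M, a • z = 0 := hmin m (Nat.lt_succ_self m)
    -- If e_i M were zero, the generators z = e_i z of J_(i+1) modulo J_i would kill M, hence so
    -- would J_(i+1).
    have hnt : Nontrivial (cornerPart (he i) M) := by
      by_contra hs
      rw [not_nontrivial_iff_subsingleton] at hs
      refine haz ?_
      obtain ⟨b, hb, hab⟩ := H.generated i a ha
      have hspan : ∀ b ∈ Ideal.span {z | z ∈ J (i + 1) ∧ e i * z = z}, b • z = 0 := by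
        intro b hb
        induction hb using Submodule.span_induction with
        | zero => rw [zero_smul]
        | add x y _ _ hx hy => rw [add_smul, hx, hy, add_zero]
        | smul c x _ hx => rw [smul_eq_mul, mul_smul, hx, smul_zero]
        | mem x hx =>
          have hxz : e i • x • z = x • z := by rw [← mul_smul, hx.2]
          exact congrArg Subtype.val (Subsingleton.elim (⟨x • z, hxz⟩ : cornerPart (he i) M) 0)
      rw [← sub_add_cancel a b, add_smul, hkill _ hab, hspan b hb, zero_add]
    have := isSimpleModule_cornerPart (he i) (M := M)
    obtain ⟨r, ⟨θ⟩⟩ := H.complete i (cornerPart (he i) M) this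
      fun b hb t => Subtype.ext (hkill b.1 hb t.1)
    have := H.simple i r
    exact ⟨⟨i, r⟩, CornerInduced.nonempty_equiv_head (he i) θ⟩

theorem isSimpleRepresentatives : IsSimpleRepresentatives A
    (fun a : Σ i, Fin (l i) => Head A (CornerInduced (he a.1) (N a.1 a.2))) where
  simple := H.isSimpleModule_head
  irredundant := H.head_irredundant
  complete M _ _ hM := H.head_complete M hM

end IsStratifying
end

/-! ### Orders adapted to the chain, and composition factors of the induced modules -/

noncomputable section

/-- The kernel is a maximal submodule and superfluous; a submodule not contained in it would
supplement it. -/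
theorem IsProjectiveCover.le_ker {A : Type u} [Ring A] {P : Type x} [AddCommGroup P] [Module A P]
    {D : Type y} [AddCommGroup D] [Module A D] [IsSimpleModule A D] {π : P →ₗ[A] D}
    (hπ : IsProjectiveCover π) {W : Submodule A P} (hW : W ≠ ⊤) : W ≤ LinearMap.ker π := by
  have hk : IsCoatom (LinearMap.ker π) :=
    isSimpleModule_iff_isCoatom.1 (.congr (π.quotKerEquivOfSurjective hπ.surjective))
  by_contra h
  exact hW (hπ.superfluous W (hk.2 _ (right_lt_sup.2 h)))

theorem Relation.ReflTransGen.exists_seq {α : Type*} {r : α → α → Prop} {a b : α}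
    (h : Relation.ReflTransGen r a b) :
    ∃ (m : ℕ) (F : ℕ → α), F 0 = a ∧ F m = b ∧ ∀ q < m, r (F q) (F (q + 1)) := by
  induction h with
  | refl => exact ⟨0, fun _ => a, rfl, rfl, fun q hq => absurd hq (Nat.not_lt_zero q)⟩
  | @tail b c _ hbc ih =>
    obtain ⟨m, F, h0, hm, hF⟩ := ih
    refine ⟨m + 1, fun q => if q ≤ m then F q else c, by simpa using h0, by simp, fun q hq => ?_⟩
    rcases (Nat.lt_succ_iff.1 hq).lt_or_eq with h | rfl
    · have h1 : q ≤ m := h.le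
      have h2 : q + 1 ≤ m := h
      simpa only [h1, h2, if_true] using hF q h
    · simpa [hm] using hbc

/-- Idempotents `f a` in the corners that act as the identity on the modules `N a`, and a partial
order on the labels that contains the relations `f b J f a ≠ 0` and `f a J f b ≠ 0` modulo the next
smaller ideal. -/
structure IsAdaptedOrder {A : Type u} [Ring A] {n : ℕ} (J : ℕ → Ideal A) {e : Fin n → A}
    (he : ∀ i, IsIdempotentElem (e i)) {l : Fin n → ℕ} (N : ∀ i, Fin (l i) → Type x)
    [∀ i r, AddCommGroup (N i r)] [∀ i r, Module (he i).Corner (N i r)]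
    (f : (Σ i, Fin (l i)) → A) (ord : PartialOrder (Σ i, Fin (l i))) : Prop where
  idem : ∀ a, IsIdempotentElem (f a)
  acts : ∀ a, ∃ b : (he a.1).Corner, b.1 = f a ∧ ∀ t : N a.1 a.2, b • t = t
  index_lt : ∀ a b, ord.lt b a → a.1 < b.1
  lt_of_left : ∀ a b, a.1 ≠ b.1 → ∀ z ∈ J (a.1 + 1), f b * z * f a ∉ J a.1 → ord.lt b a
  lt_of_right : ∀ a b, a.1 ≠ b.1 → ∀ z ∈ J (a.1 + 1), f a * z * f b ∉ J a.1 → ord.lt b a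

namespace IsAdaptedOrder

variable {A : Type u} [Ring A] {n : ℕ} {J : ℕ → Ideal A} {e : Fin n → A}
  {he : ∀ i, IsIdempotentElem (e i)} {l : Fin n → ℕ} {N : ∀ i, Fin (l i) → Type x}
  [∀ i r, AddCommGroup (N i r)] [∀ i r, Module (he i).Corner (N i r)]
  {f : (Σ i, Fin (l i)) → A} {ord : PartialOrder (Σ i, Fin (l i))}
  (O : IsAdaptedOrder J he N f ord)

include O

theorem mul_idem (a : Σ i, Fin (l i)) : f a * e a.1 = f a := by
  obtain ⟨b, hb, -⟩ := O.acts a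
  rw [← hb]
  exact ((Subsemigroup.mem_corner_iff (he a.1)).1 b.2).2

theorem smul_unit (a : Σ i, Fin (l i)) (t : N a.1 a.2) :
    f a • CornerInduced.unit (he a.1) (N a.1 a.2) t = CornerInduced.unit (he a.1) (N a.1 a.2) t := by
  obtain ⟨b, hb, ht⟩ := O.acts a
  rw [← hb, ← CornerInduced.unit_smul, ht]

variable (H : IsStratifying J he N)

include H

theorem mem (a : Σ i, Fin (l i)) : f a ∈ J (a.1 + 1) := by
  rw [← O.mul_idem a]
  exact (J _).mul_mem_left _ (H.mem a.1)

theorem le_ideal (a : Σ i, Fin (l i)) {Q : Ideal A} (hQ : Q ≤ Ideal.span {f a}) :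
    Q ≤ J (a.1 + 1) :=
  hQ.trans ((Ideal.span_singleton_le_iff_mem _).2 (O.mem H a))

theorem exists_smul_induced_ne_zero (a : Σ i, Fin (l i)) :
    ∃ z : CornerInduced (he a.1) (N a.1 a.2), f a • z ≠ 0 := by
  have := H.simple a.1 a.2
  have := IsSimpleModule.nontrivial (he a.1).Corner (N a.1 a.2)
  obtain ⟨t, ht⟩ := exists_ne (0 : N a.1 a.2)
  refine ⟨CornerInduced.unit _ _ t, fun h => ht ?_⟩
  rw [O.smul_unit] at h
  exact CornerInduced.unit_injective _ _ (h.trans (map_zero _).symm)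

theorem exists_head_smul_eq (a : Σ i, Fin (l i)) :
    ∃ z : Head A (CornerInduced (he a.1) (N a.1 a.2)), z ≠ 0 ∧ f a • z = z := by
  have := H.simple a.1 a.2
  have := IsSimpleModule.nontrivial (he a.1).Corner (N a.1 a.2)
  obtain ⟨t, ht⟩ := exists_ne (0 : N a.1 a.2)
  let E := CornerInduced.equivCornerPartHead (he a.1) (N a.1 a.2)
  refine ⟨(E t).1, fun h => ht (E.map_eq_zero_iff.1 (Subtype.ext h)), ?_⟩
  rw [CornerInduced.equivCornerPartHead_val, ← map_smul, O.smul_unit]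

/-- All composition factors of the radical of `A e ⊗ N a` have labels smaller than `a`. -/
theorem compositionFactorsIn_moduleRad (a : Σ i, Fin (l i)) {M : Type u} [AddCommGroup M]
    [Module A M] (θ : CornerInduced (he a.1) (N a.1 a.2) ≃ₗ[A] M) :
    CompositionFactorsIn A (moduleRad A M)
      (fun b : Σ i, Fin (l i) => Head A (CornerInduced (he b.1) (N b.1 b.2)))
      (fun b => ord.lt b a) := by
  intro N₁ N₂ hN₁ hN₂
  have hsimple : IsSimpleModule A (N₁ ⧸ N₂.submoduleOf N₁) :=
    (covBy_iff_quot_is_simple hN₂.le).1 hN₂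
  obtain ⟨b, ⟨ψ⟩⟩ := H.head_complete _ hsimple
  refine ⟨b, ?_, ⟨ψ⟩⟩
  obtain ⟨d, hd0, hd⟩ := O.exists_head_smul_eq H b
  obtain ⟨⟨x, hx⟩, hxd⟩ := Submodule.mkQ_surjective _ (ψ.symm d)
  -- f_b fixes a nonzero vector of the head with label b, so the subquotient has a representative x
  -- that f_b does not kill.
  have hfx : f b • x ≠ 0 := by
    intro h
    have h1 : f b • (⟨x, hx⟩ : N₁) = 0 := Subtype.ext h
    have h2 : f b • ψ.symm d = 0 := by rw [← hxd, ← map_smul, h1, map_zero]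
    rw [← map_smul, hd] at h2
    exact hd0 (ψ.symm.map_eq_zero_iff.1 h2)
  have := H.simple a.1 a.2
  have hrad : ∀ c : A, e a.1 • c • θ.symm x = 0 := by
    have h1 : x ∈ moduleRad A M := hN₁ hx
    have h2 : θ.symm x ∈ moduleRad A (CornerInduced (he a.1) (N a.1 a.2)) :=
      Module.map_jacobson_le θ.symm.toLinearMap ⟨x, h1, rfl⟩
    rw [CornerInduced.moduleRad_eq] at h2
    exact h2
  have hfz : f b • θ.symm x ≠ 0 := fun h => hfx (θ.symm.map_eq_zero_iff.1 (by rwa [map_smul]))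
  generalize θ.symm x = z at hrad hfz
  -- The radical is killed by e_a, while f_b = f_b e_b does not kill z; so the indices differ.
  have hne : a.1 ≠ b.1 := fun h => hfz (by
    have h1 := hrad 1
    rw [one_smul] at h1
    rw [← (congrArg (fun i => f b * e i) h).trans (O.mul_idem b), mul_smul, h1, smul_zero])
  have hz : z ∈ Submodule.span A (Set.range (CornerInduced.unit (he a.1) (N a.1 a.2))) :=
    (CornerInduced.span_range_unit (he a.1)).ge Submodule.mem_top
  obtain ⟨c, t, hct⟩ : ∃ (c : A) (t : N a.1 a.2), f b • c • CornerInduced.unit (he a.1) _ t ≠ 0 := by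
    by_contra! hall
    refine hfz ?_
    clear hrad hfz
    suffices h : ∀ c : A, f b • c • z = 0 by simpa using h 1
    induction hz using Submodule.span_induction with
    | zero => exact fun c => by rw [smul_zero, smul_zero]
    | add x y _ _ hx hy => exact fun c => by rw [smul_add, smul_add, hx, hy, add_zero]
    | smul c' x _ hx => exact fun c => by rw [← mul_smul c]; exact hx _
    | mem x hx =>
      obtain ⟨t, rfl⟩ := hx
      exact fun c => hall c t
  -- The witness is c f_a: since f_a fixes e ⊗ t and J_a kills the induced module, f_b c f_a in J_a
  -- would force f_b c (e ⊗ t) = 0.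
  refine O.lt_of_left a b hne (c * f a) ((J _).mul_mem_left _ (O.mem H a)) fun hmem => hct ?_
  have heq : f b * (c * f a) * f a = f b * c * f a := by
    rw [mul_assoc, mul_assoc, (O.idem a).eq, mul_assoc]
  rw [← O.smul_unit, ← mul_smul, ← mul_smul, ← heq]
  exact H.smul_induced_eq_zero a.1 a.2 hmem _

end IsAdaptedOrder

namespace IsStratifying

variable {A : Type u} [Ring A] {n : ℕ} {J : ℕ → Ideal A} {e : Fin n → A}
  {he : ∀ i, IsIdempotentElem (e i)} {l : Fin n → ℕ} {N : ∀ i, Fin (l i) → Type x}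
  [∀ i r, AddCommGroup (N i r)] [∀ i r, Module (he i).Corner (N i r)]
  (H : IsStratifying J he N)

include H

theorem smul_smul_top (m : ℕ) {M : Type u} [AddCommGroup M] [Module A M] :
    J m • (⊤ : Submodule A M) ≤ J m • J m • (⊤ : Submodule A M) := by
  rw [Submodule.smul_le]
  intro c hc z _
  have := H.idem m c hc
  clear hc
  induction this using Submodule.span_induction with
  | zero => rw [zero_smul]; exact Submodule.zero_mem _
  | add x y _ _ hx hy => rw [add_smul]; exact Submodule.add_mem _ hx hy
  | smul c x _ hx => rw [smul_eq_mul, mul_smul]; exact Submodule.smul_mem _ c hx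
  | mem x hx =>
    obtain ⟨b, hb, c, hc, rfl⟩ := hx
    rw [mul_smul]
    exact Submodule.smul_mem_smul hb (Submodule.smul_mem_smul hc Submodule.mem_top)

theorem isInducedLayer_ideal (i : Fin n) :
    IsInducedLayer (J i) (e i) (J (i + 1) ⧸ (J i).submoduleOf (J (i + 1))) where
  smul_eq_zero a ha z := by
    have := H.isTwoSided i
    obtain ⟨z, rfl⟩ := Submodule.mkQ_surjective _ z
    rw [← map_smul]
    exact (Submodule.Quotient.mk_eq_zero _).2 ((J i).mul_mem_right z.1 ha)
  span_eq_top := by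
    rw [eq_top_iff]
    rintro z -
    obtain ⟨⟨z, hz⟩, rfl⟩ := Submodule.mkQ_surjective _ z
    obtain ⟨b, hb, hzb⟩ := H.generated i z hz
    have hle : ∀ b ∈ Ideal.span {z | z ∈ J (i + 1) ∧ e i * z = z}, b ∈ J (i + 1) :=
      fun b hb => Ideal.span_le.2 (fun z hz => hz.1) hb
    have hzb' : ((J i).submoduleOf (J (i + 1))).mkQ ⟨z, hz⟩ =
        ((J i).submoduleOf (J (i + 1))).mkQ ⟨b, hle b hb⟩ :=
      (Submodule.Quotient.eq _).2 hzb
    rw [hzb']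
    have key : ∀ b ∈ Ideal.span {z | z ∈ J (i + 1) ∧ e i * z = z}, ∀ h : b ∈ J (i + 1),
        ((J i).submoduleOf (J (i + 1))).mkQ ⟨b, h⟩ ∈
          Submodule.span A {m : J (i + 1) ⧸ (J i).submoduleOf (J (i + 1)) | e i • m = m} := by
      intro b hb
      induction hb using Submodule.span_induction with
      | zero => exact fun h => Submodule.zero_mem _
      | add x y hx' hy' hx hy =>
        exact fun h => Submodule.add_mem _ (hx (hle x hx')) (hy (hle y hy'))
      | smul c x hx' hx => exact fun h => Submodule.smul_mem _ c (hx (hle x hx'))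
      | mem x hx =>
        refine fun h => Submodule.subset_span ?_
        change e i • Submodule.mkQ _ _ = _
        rw [← map_smul]
        exact congrArg _ (Subtype.ext hx.2)
    exact key b hb _
  proj := H.proj i

/-- Passing to direct summands: if V is a retract of J_(i+1) compatibly with V₀ and J_i, then V/V₀
is a retract of the layer. -/
theorem isInducedLayer_quotient (i : Fin n) {V : Type u} [AddCommGroup V] [Module A V]
    (V₀ : Submodule A V) (ι : V →ₗ[A] J (i + 1)) (ρ : J (i + 1) →ₗ[A] V)
    (hρι : ρ ∘ₗ ι = LinearMap.id) (hι : ∀ v ∈ V₀, (ι v).1 ∈ J i)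
    (hρ : ∀ z : J (i + 1), z.1 ∈ J i → ρ z ∈ V₀) : IsInducedLayer (J i) (e i) (V ⧸ V₀) :=
  (H.isInducedLayer_ideal i).of_retract (Submodule.mapQ _ _ ι hι) (Submodule.mapQ _ _ ρ hρ)
    (LinearMap.ext fun v => by
      obtain ⟨v, rfl⟩ := Submodule.mkQ_surjective _ v
      exact congrArg V₀.mkQ (LinearMap.congr_fun hρι v))

end IsStratifying
end

/-! ### Standard modules and the filtration of projective covers -/

noncomputable section

namespace IsAdaptedOrder

variable {A : Type u} [Ring A] [IsArtinianRing A] {n : ℕ} {J : ℕ → Ideal A} {e : Fin n → A}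
  {he : ∀ i, IsIdempotentElem (e i)} {l : Fin n → ℕ} {N : ∀ i, Fin (l i) → Type x}
  [∀ i r, AddCommGroup (N i r)] [∀ i r, Module (he i).Corner (N i r)]
  {f : (Σ i, Fin (l i)) → A} {ord : PartialOrder (Σ i, Fin (l i))}
  (O : IsAdaptedOrder J he N f ord) (H : IsStratifying J he N)

include O H

/-- Since f_a fixes a nonzero vector d of the simple head, c f_a ↦ c d maps A f_a onto it, and the
cover can be cut out of A f_a. -/
theorem exists_projectiveCover (a : Σ i, Fin (l i)) :
    ∃ (Q : Ideal A) (η : A) (π : Q →ₗ[A] Head A (CornerInduced (he a.1) (N a.1 a.2))),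
      η ∈ Q ∧ (∀ q ∈ Q, q * η = q) ∧ Q ≤ Ideal.span {f a} ∧ IsProjectiveCover π := by
  have := H.isSimpleModule_head a
  obtain ⟨d, hd0, hd⟩ := O.exists_head_smul_eq H a
  refine exists_isProjectiveCover_ideal (O.idem a)
    (LinearMap.toSpanSingleton A _ d ∘ₗ Submodule.subtype _) fun z => ?_
  obtain ⟨c, rfl⟩ := IsSimpleModule.toSpanSingleton_surjective A hd0 z
  refine ⟨⟨c * f a, Ideal.mem_span_singleton'.2 ⟨c, rfl⟩⟩, ?_⟩
  change (c * f a) • d = c • d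
  rw [mul_smul, hd]

omit [IsArtinianRing A] in
/-- The quotient of the projective cover of the head of `A e ⊗ N a` by the part that lies in the
next smaller ideal is `A e ⊗ N a`. -/
theorem nonempty_equiv_quotient (a : Σ i, Fin (l i)) {Q : Ideal A} {η : A}
    {π : Q →ₗ[A] Head A (CornerInduced (he a.1) (N a.1 a.2))} (hη : η ∈ Q)
    (hQη : ∀ q ∈ Q, q * η = q) (hQ : Q ≤ Ideal.span {f a}) (hπ : IsProjectiveCover π) :
    Nonempty (CornerInduced (he a.1) (N a.1 a.2) ≃ₗ[A] Q ⧸ (J a.1).submoduleOf Q) := by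
  have hsimple := H.isSimpleModule_head a
  have := H.isTwoSided a.1
  set F := (J a.1).submoduleOf Q with hF
  have hFπ : F ≤ LinearMap.ker π := by
    intro q hq
    have : q = q.1 • (⟨η, hη⟩ : Q) := Subtype.ext (hQη q.1 q.2).symm
    rw [LinearMap.mem_ker, this, map_smul]
    exact H.smul_head_eq_zero a.1 a.2 hq _
  have hkπ : LinearMap.ker π ≠ ⊤ := fun h => by
    have := IsSimpleModule.nontrivial A (Head A (CornerInduced (he a.1) (N a.1 a.2)))
    obtain ⟨d, hd⟩ := exists_ne (0 : Head A (CornerInduced (he a.1) (N a.1 a.2)))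
    obtain ⟨q, rfl⟩ := hπ.surjective d
    exact hd (LinearMap.mem_ker.1 (h.ge Submodule.mem_top))
  have hnt : Nontrivial (Q ⧸ F) := by
    rw [Submodule.Quotient.nontrivial_iff]
    exact fun h => hkπ (top_le_iff.1 (h ▸ hFπ))
  -- Right multiplication by η retracts J_(a+1) onto Q and sends J_a into J_a because that ideal is
  -- two-sided.
  have hlayer : IsInducedLayer (J a.1) (e a.1) (Q ⧸ F) :=
    H.isInducedLayer_quotient a.1 F (Submodule.inclusion (O.le_ideal H a hQ))
      (LinearMap.toSpanSingleton A Q ⟨η, hη⟩ ∘ₗ Submodule.subtype _)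
      (LinearMap.ext fun q => Subtype.ext (hQη q.1 q.2)) (fun q hq => hq)
      (fun z hz => (J a.1).mul_mem_right η hz)
  obtain ⟨s, g, σ, hgσ, hg0⟩ := hlayer.exists_split_epi (he a.1) (H.corner a.1)
    (H.semisimple a.1) (H.complete a.1)
  have hgs : Function.Surjective g := fun z => ⟨σ z, LinearMap.congr_fun hgσ z⟩
  have hproper : ∀ W : Submodule A (Q ⧸ F), W ≠ ⊤ → W ≤ (LinearMap.ker π).map F.mkQ := by
    intro W hW z hz
    have hW' : W.comap F.mkQ ≠ ⊤ := fun h => hW (by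
      rw [← Submodule.map_comap_eq_of_surjective F.mkQ_surjective W, h, Submodule.map_top,
        Submodule.range_mkQ])
    obtain ⟨q, rfl⟩ := F.mkQ_surjective z
    exact ⟨q, hπ.le_ker hW' hz, rfl⟩
  have hM : (LinearMap.ker π).map F.mkQ ≠ ⊤ := fun h => hkπ (by
    rw [← sup_eq_left.2 hFπ, sup_comm, ← Submodule.comap_map_mkQ, h, Submodule.comap_top])
  -- The image of σ and the kernel of g span the quotient. If the image were proper, both would lie
  -- in the unique maximal submodule, which is impossible.
  have hσ : LinearMap.range σ = ⊤ := by
    by_contra h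
    refine hM (eq_top_iff.2 fun z _ => ?_)
    have h1 : z - σ (g z) ∈ LinearMap.ker g := by
      rw [LinearMap.mem_ker, map_sub, sub_eq_zero]
      exact (LinearMap.congr_fun hgσ (g z)).symm
    have h2 := hproper _ (fun h => hg0 (LinearMap.ker_eq_top.1 h)) h1
    have h3 := hproper _ h ⟨g z, rfl⟩
    simpa using Submodule.add_mem _ h2 h3
  let θ : CornerInduced (he a.1) (N a.1 s) ≃ₗ[A] Q ⧸ F :=
    LinearEquiv.ofBijective σ ⟨Function.LeftInverse.injective (LinearMap.congr_fun hgσ),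
      LinearMap.range_eq_top.1 hσ⟩
  have := H.simple a.1 s
  let ψ : CornerInduced (he a.1) (N a.1 s) →ₗ[A] Head A (CornerInduced (he a.1) (N a.1 a.2)) :=
    F.liftQ π hFπ ∘ₗ θ.toLinearMap
  have hψ : Function.Surjective ψ := by
    intro d
    obtain ⟨q, rfl⟩ := hπ.surjective d
    exact ⟨θ.symm (F.mkQ q), by simp [ψ]⟩
  have hk : IsCoatom (LinearMap.ker ψ) :=
    isSimpleModule_iff_isCoatom.1 (.congr (ψ.quotKerEquivOfSurjective hψ))
  have hk' : moduleRad A (CornerInduced (he a.1) (N a.1 s)) = LinearMap.ker ψ := by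
    rw [CornerInduced.moduleRad_eq]
    exact (hk.le_iff.1 (CornerInduced.le_radical_of_ne_top _ _ hk.1)).resolve_left
      (CornerInduced.radical_ne_top _ _)
  -- The induced module found so far maps onto the head labelled a, and its own head is simple;
  -- irredundancy identifies its label.
  have hlabel := H.head_irredundant ⟨a.1, s⟩ a
    ⟨(Submodule.quotEquivOfEq _ _ hk').trans (ψ.quotKerEquivOfSurjective hψ)⟩
  have hs : s = a.2 := eq_of_heq (Sigma.mk.inj (hlabel.trans (Sigma.eta a).symm)).2
  subst hs
  exact ⟨θ⟩

/-- The modules `A e ⊗ N a` are the standard modules. -/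
theorem isStandardModule (a : Σ i, Fin (l i)) {M : Type y} [AddCommGroup M] [Module A M]
    (θ : M ≃ₗ[A] CornerInduced (he a.1) (N a.1 a.2)) :
    IsStandardModule A
      (fun b : Σ i, Fin (l i) => Head A (CornerInduced (he b.1) (N b.1 b.2))) ord a M := by
  obtain ⟨Q, η, π, hη, hQη, hQ, hπ⟩ := O.exists_projectiveCover H a
  obtain ⟨ψ⟩ := O.nonempty_equiv_quotient H a hη hQη hQ hπ
  have hsimple := H.isSimpleModule_head a
  refine ⟨Q, inferInstance, inferInstance, π, (J a.1).submoduleOf Q, hπ,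
    ⟨O.compositionFactorsIn_moduleRad H a ψ, fun K' hK' => ?_⟩, ⟨θ.trans ψ⟩⟩
  -- Minimality of the kernel amounts to J_a acting as zero on every admissible quotient Q/K',
  -- because q = q η for q in Q.
  let Y : Submodule A (Q ⧸ K') := J a.1 • (⊤ : Submodule A (Q ⧸ K'))
  have hYrad : Y ≤ moduleRad A (Q ⧸ K') := by
    refine le_sInf fun W hW => Submodule.smul_le.2 fun c hc z _ => ?_
    have hW' : IsCoatom (W.comap K'.mkQ) :=
      (Submodule.isCoatom_comap_iff K'.mkQ_surjective).2 hW
    obtain ⟨q, rfl⟩ := K'.mkQ_surjective z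
    have hker : W.comap K'.mkQ = LinearMap.ker π := by
      refine ((hW'.le_iff.1 (hπ.le_ker hW'.1)).resolve_left fun h => ?_).symm
      have := IsSimpleModule.nontrivial A (Head A (CornerInduced (he a.1) (N a.1 a.2)))
      obtain ⟨d, hd⟩ := exists_ne (0 : Head A (CornerInduced (he a.1) (N a.1 a.2)))
      obtain ⟨q, rfl⟩ := hπ.surjective d
      exact hd (LinearMap.mem_ker.1 (h.ge Submodule.mem_top))
    have : c • q ∈ W.comap K'.mkQ := by
      rw [hker, LinearMap.mem_ker, map_smul]
      exact H.smul_head_eq_zero a.1 a.2 hc _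
    exact this
  have hY : Y = ⊥ := by
    by_contra hne
    -- A simple quotient Y/N₂ lies inside the radical, so its label is below a and its index exceeds
    -- that of a. Thus J_a kills it, and Y = J_a Y ≤ N₂.
    obtain ⟨N₂, -, hN₂⟩ := exists_le_covBy_of_lt (bot_lt_iff_ne_bot.2 hne)
    obtain ⟨μ, hμ, ⟨χ⟩⟩ := hK' Y N₂ hYrad hN₂
    refine hN₂.lt.not_ge ((H.smul_smul_top a.1).trans (Submodule.smul_le.2 fun c hc z hz => ?_))
    have h1 : χ (c • (N₂.submoduleOf Y).mkQ ⟨z, hz⟩) = 0 := by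
      rw [map_smul]
      exact H.smul_head_eq_zero μ.1 μ.2 (H.mono (O.index_lt a μ hμ).le hc) _
    exact (Submodule.Quotient.mk_eq_zero (N₂.submoduleOf Y)).1 (χ.map_eq_zero_iff.1 h1)
  intro q hq
  have hqη : q = q.1 • (⟨η, hη⟩ : Q) := Subtype.ext (hQη q.1 q.2).symm
  have : q.1 • K'.mkQ ⟨η, hη⟩ ∈ Y := Submodule.smul_mem_smul hq Submodule.mem_top
  rw [hY, Submodule.mem_bot, ← map_smul, ← hqη] at this
  exact (Submodule.Quotient.mk_eq_zero _).1 this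

/-- As Q is a direct summand of A, this layer of Q is a direct summand of J_(i+1)/J_i, so it can be
peeled into induced modules. The containment Q ≤ A f_a then forces their labels to be larger than a.
-/
theorem reflTransGen_layer (a : Σ i, Fin (l i)) {Q : Ideal A} {η : A} (hη : η ∈ Q)
    (hQη : ∀ q ∈ Q, q * η = q) (hQ : Q ≤ Ideal.span {f a}) (i : Fin n) (hi : i < a.1) :
    Relation.ReflTransGen (fun F F' : Submodule A Q => F < F' ∧ ∃ b, ord.lt a b ∧
      Nonempty ((F' ⧸ F.submoduleOf F') ≃ₗ[A] CornerInduced (he b.1) (N b.1 b.2)))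
      ((J i).submoduleOf Q) ((J (i + 1)).submoduleOf Q) := by
  have := H.isTwoSided i
  have := H.isTwoSided (i + 1)
  have hle : (J i).submoduleOf Q ≤ (J (i + 1)).submoduleOf Q := fun q hq =>
    H.mono (Nat.le_succ i) hq
  have hlayer : IsInducedLayer (J i) (e i) ((J (i + 1)).submoduleOf Q ⧸
      ((J i).submoduleOf Q).submoduleOf ((J (i + 1)).submoduleOf Q)) :=
    H.isInducedLayer_quotient i _
      (LinearMap.codRestrict (J (i + 1)) (Q.subtype ∘ₗ Submodule.subtype _) fun q => q.2)
      (LinearMap.codRestrict ((J (i + 1)).submoduleOf Q)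
        (LinearMap.toSpanSingleton A Q ⟨η, hη⟩ ∘ₗ Submodule.subtype _)
        fun z => (J (i + 1)).mul_mem_right η z.2)
      (LinearMap.ext fun q => Subtype.ext (Subtype.ext (hQη q.1.1 q.1.2))) (fun q hq => hq)
      (fun z hz => (J i).mul_mem_right η hz)
  have hchain := hlayer.reflTransGen_inducedStep (he i) (H.corner i) (H.semisimple i)
    (H.complete i) _ _ hle
  -- The lower bound J_i ∩ Q ≤ X is carried along, since the label comparison at each step tests
  -- membership in J_i.
  suffices h : ∀ X, Relation.ReflTransGen (InducedStep (he i) (N i)) ((J i).submoduleOf Q) X →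
      X ≤ (J (i + 1)).submoduleOf Q → (J i).submoduleOf Q ≤ X ∧
      Relation.ReflTransGen (fun F F' : Submodule A Q => F < F' ∧ ∃ b, ord.lt a b ∧
        Nonempty ((F' ⧸ F.submoduleOf F') ≃ₗ[A] CornerInduced (he b.1) (N b.1 b.2)))
        ((J i).submoduleOf Q) X from (h _ hchain le_rfl).2
  intro X hX
  induction hX with
  | refl => exact fun _ => ⟨le_rfl, .refl⟩
  | @tail X Y _ hXY ih =>
    intro hY
    obtain ⟨hlt, r, ⟨θ⟩⟩ := hXY
    obtain ⟨hJX, hchainX⟩ := ih (hlt.le.trans hY)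
    refine ⟨hJX.trans hlt.le, hchainX.tail ⟨hlt, ⟨i, r⟩, ?_, ⟨θ⟩⟩⟩
    -- Lift a vector of the factor not killed by its own f to y in Q. From y = y f_a it follows that
    -- f y f_a is not in J_i, which is the second half of the relation.
    obtain ⟨z, hz⟩ := O.exists_smul_induced_ne_zero H ⟨i, r⟩
    obtain ⟨⟨y, hyY⟩, hy⟩ := Submodule.mkQ_surjective _ (θ.symm z)
    refine O.lt_of_right ⟨i, r⟩ a hi.ne y.1 (hY hyY) fun hmem => hz ?_
    have hyf : y.1 * f a = y.1 := by
      obtain ⟨c, hc⟩ := Ideal.mem_span_singleton'.1 (hQ y.2)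
      rw [← hc, mul_assoc, (O.idem a).eq]
    rw [mul_assoc, hyf] at hmem
    have h1 : f ⟨i, r⟩ • (X.submoduleOf Y).mkQ ⟨y, hyY⟩ = 0 := by
      rw [← map_smul]
      exact (Submodule.Quotient.mk_eq_zero (X.submoduleOf Y)).2 (hJX hmem)
    rw [hy, ← map_smul] at h1
    exact θ.symm.map_eq_zero_iff.1 h1

theorem isQuasiHereditary : IsQuasiHereditary A
    (fun b : Σ i, Fin (l i) => Head A (CornerInduced (he b.1) (N b.1 b.2))) ord where
  finite := inferInstance
  simples := H.isSimpleRepresentatives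
  filtration a := by
    obtain ⟨Q, η, π, hη, hQη, hQ, hπ⟩ := O.exists_projectiveCover H a
    refine ⟨Q, inferInstance, inferInstance, π, hπ, ?_⟩
    obtain ⟨ψ⟩ := O.nonempty_equiv_quotient H a hη hQη hQ hπ
    have hchain : ∀ m ≤ a.1.1, Relation.ReflTransGen (fun F F' : Submodule A Q => F < F' ∧
        ∃ b, ord.lt a b ∧
          Nonempty ((F' ⧸ F.submoduleOf F') ≃ₗ[A] CornerInduced (he b.1) (N b.1 b.2)))
        ⊥ ((J m).submoduleOf Q) := by
      intro m
      induction m with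
      | zero =>
        intro _
        have h0 : (J 0).submoduleOf Q = ⊥ := by
          rw [H.bot, Submodule.submoduleOf, Submodule.comap_bot, Submodule.ker_subtype]
        rw [h0]
      | succ m ih =>
        intro hm
        exact (ih (Nat.le_of_succ_le hm)).trans
          (O.reflTransGen_layer H a hη hQη hQ ⟨m, hm.trans_lt' (Nat.lt_succ_self m) |>.trans a.1.2⟩
            hm)
    obtain ⟨m, F, h0, hm, hF⟩ := (hchain a.1 le_rfl).exists_seq
    have htop : F m < ⊤ := by
      rw [hm, lt_top_iff_ne_top]
      intro h
      obtain ⟨z, hz⟩ := O.exists_smul_induced_ne_zero H a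
      have : Subsingleton (Q ⧸ (J a.1).submoduleOf Q) := by
        rw [h]
        infer_instance
      exact hz (ψ.injective (Subsingleton.elim _ _))
    -- The chain F ends at J_a ∩ Q; one more step to all of Q supplies the top quotient.
    let G : ℕ → Submodule A Q := fun q => if q ≤ m then F q else ⊤
    have hG : ∀ q ≤ m, G q = F q := fun q hq => if_pos hq
    have hGtop : G (m + 1) = ⊤ := if_neg (Nat.not_succ_le_self m)
    refine ⟨m, G, (hG 0 (Nat.zero_le m)).trans h0, hGtop, fun q hq => ?_, ?_, fun q hq => ?_⟩
    · rcases hq.lt_or_eq with h | rfl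
      · rw [hG q hq, hG (q + 1) h]
        exact (hF q h).1
      · rw [hG q le_rfl, hGtop]
        exact htop
    · rw [hG m le_rfl, hGtop, hm]
      have E : ((⊤ : Submodule A Q) ⧸ ((J a.1).submoduleOf Q).submoduleOf ⊤) ≃ₗ[A]
          Q ⧸ (J a.1).submoduleOf Q :=
        Submodule.Quotient.equiv _ _ Submodule.topEquiv (by
          ext q
          constructor
          · rintro ⟨q, hq, rfl⟩
            exact hq
          · exact fun hq => ⟨⟨q, Submodule.mem_top⟩, hq, rfl⟩)
      exact O.isStandardModule H a (E.trans ψ.symm)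
    · rw [hG q hq.le, hG (q + 1) hq]
      obtain ⟨-, b, hb, ⟨θ⟩⟩ := hF q hq
      exact ⟨b, hb, O.isStandardModule H b θ⟩

end IsAdaptedOrder
end

noncomputable section

/-! ## Twisted group algebras -/

/-- By the pigeonhole principle the powers of a are eventually periodic, and a power whose exponent
is a multiple of the period beyond the preperiod is idempotent. The exponent is kept positive
because zero would be useless for stability. -/
theorem exists_isIdempotentElem_pow_succ {M : Type*} [Monoid M] [Finite M] (a : M) :
    ∃ m : ℕ, IsIdempotentElem (a ^ (m + 1)) := by
  obtain ⟨i, j, hij, h⟩ := Finite.exists_ne_map_eq_of_infinite fun m : ℕ => a ^ m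
  wlog hlt : i < j generalizing i j
  · exact this j i hij.symm h.symm (lt_of_le_of_ne (not_lt.1 hlt) hij.symm)
  obtain ⟨d, rfl⟩ := Nat.exists_eq_add_of_lt hlt
  have h1 : ∀ c q, a ^ (i + c + q * (d + 1)) = a ^ (i + c) := by
    intro c q
    induction q with
    | zero => simp
    | succ q ih =>
      calc a ^ (i + c + (q + 1) * (d + 1)) = a ^ (i + d + 1) * a ^ (c + q * (d + 1)) := by
            rw [← pow_add]; congr 1; ring
        _ = a ^ (i + c + q * (d + 1)) := by
            rw [show a ^ (i + d + 1) = a ^ i from h.symm, ← pow_add]; congr 1; ring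
        _ = _ := ih
  -- The exponent is (i + 1)(d + 1): a multiple of the period d + 1 that is at least i.
  refine ⟨(i + 1) * (d + 1) - 1, ?_⟩
  have hpos : (i + 1) * (d + 1) - 1 + 1 = i + (d + i * d + 1) := by
    have : (i + 1) * (d + 1) = i + (d + i * d) + 1 := by ring
    omega
  have := h1 (d + i * d + 1) (i + 1)
  rw [hpos, IsIdempotentElem, ← pow_add]
  rw [← this]
  congr 1
  ring

/-- Maschke's argument: a k-linear projection onto a left ideal is averaged over its conjugates by
the units b g. No cocycle identity for c has to be assumed, since associativity of R does the work.
-/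
theorem isSemisimpleRing_of_twistedBasis {k : Type w} [Field k] {R : Type u} [Ring R] [Algebra k R]
    {G : Type v} [Group G] [Finite G] (hG : (Nat.card G : k) ≠ 0) (b : G → R) (c : G → G → kˣ)
    (c₀ : kˣ) (hmul : ∀ g h, b g * b h = (c g h : k) • b (g * h)) (hone : b 1 = (c₀ : k) • 1)
    (hspan : Submodule.span k (Set.range b) = ⊤) : IsSemisimpleRing R := by
  have := Fintype.ofFinite G
  have hunit : ∀ g, ∃ b' : R, b g * b' = 1 ∧ b' * b g = 1 := by
    intro g
    have hr : ∀ g h, g * h = 1 → b g * (((c g h : k)⁻¹ * (c₀ : k)⁻¹) • b h) = 1 := fun g h hgh => by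
      rw [mul_smul_comm, hmul, hgh, hone, smul_smul, smul_smul]
      rw [show (c g h : k)⁻¹ * (c₀ : k)⁻¹ * (c g h : k) * c₀ = 1 by field_simp, one_smul]
    have h1 := hr g g⁻¹ (mul_inv_cancel g)
    have h2 : (((c g⁻¹ g : k)⁻¹ * (c₀ : k)⁻¹) • b g⁻¹) * b g = 1 := by
      rw [smul_mul_assoc, ← mul_smul_comm]
      exact hr g⁻¹ g (inv_mul_cancel g)
    exact ⟨_, h1, (left_inv_eq_right_inv h2 h1) ▸ h2⟩
  choose b' hb hb' using hunit
  refine (isSemisimpleModule_iff R R).2 ⟨fun W => ?_⟩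
  obtain ⟨V, hV⟩ := exists_isCompl (W.restrictScalars k)
  let p : R →ₗ[k] R := (W.restrictScalars k).projection V hV
  have hpW : ∀ z, p z ∈ W := fun z => ((W.restrictScalars k).projectionOnto V hV z).2
  have hpid : ∀ z ∈ W, p z = z := fun z hz => by
    exact congrArg Subtype.val
      (Submodule.projectionOnto_apply_left hV (⟨z, hz⟩ : W.restrictScalars k))
  let P : R →ₗ[k] R := (Nat.card G : k)⁻¹ •
    ∑ g, (LinearMap.mulLeft k (b' g) ∘ₗ p ∘ₗ LinearMap.mulLeft k (b g))
  have hP : ∀ z, P z = (Nat.card G : k)⁻¹ • ∑ g, b' g * p (b g * z) := fun z => by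
    simp [P]
  have hPb : ∀ h z, P (b h * z) = b h * P z := by
    intro h z
    rw [hP, hP, mul_smul_comm, Finset.mul_sum]
    congr 1
    -- Substituting g h for g matches the two sums term by term; the scalar c g h is absorbed by
    -- c(g,h) b(g)⁻¹ = b(h) b(gh)⁻¹.
    rw [← Equiv.sum_comp (Equiv.mulRight h) fun g => b h * (b' g * p (b g * z))]
    refine Finset.sum_congr rfl fun g _ => ?_
    change _ = b h * (b' (g * h) * p (b (g * h) * z))
    rw [← mul_assoc (b g), hmul, smul_mul_assoc, map_smul, mul_smul_comm, ← smul_mul_assoc,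
      ← mul_assoc]
    congr 1
    calc (c g h : k) • b' g = (c g h : k) • (b' g * (b (g * h) * b' (g * h))) := by
          rw [hb, mul_one]
      _ = b' g * (b g * b h) * b' (g * h) := by
          rw [hmul, mul_smul_comm, smul_mul_assoc, mul_assoc]
      _ = b h * b' (g * h) := by rw [← mul_assoc, hb', one_mul]
  have hPW : ∀ z, P z ∈ W := fun z => by
    rw [hP]
    exact W.smul_of_tower_mem _ (Submodule.sum_mem _ fun g _ => W.smul_mem _ (hpW _))
  have hPid : ∀ z ∈ W, P z = z := fun z hz => by
    have hterm : ∀ g, b' g * p (b g * z) = z := fun g => by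
      rw [hpid (b g * z) (W.smul_mem (b g) hz), ← mul_assoc, hb', one_mul]
    rw [hP, Finset.sum_congr rfl fun g _ => hterm g, Finset.sum_const, Finset.card_univ, ← Nat.card_eq_fintype_card, ← Nat.cast_smul_eq_nsmul k,
      smul_smul, inv_mul_cancel₀ hG, one_smul]
  let P' : R →ₗ[R] W :=
    { toFun := fun z => ⟨P z, hPW z⟩
      map_add' := fun z z' => Subtype.ext (map_add P z z')
      map_smul' := fun a z => Subtype.ext (by
        change P (a * z) = a * P z
        have ha : a ∈ Submodule.span k (Set.range b) := hspan.ge Submodule.mem_top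
        induction ha using Submodule.span_induction with
        | zero => simp
        | add x y _ _ hx hy => rw [add_mul, map_add, hx, hy, add_mul]
        | smul d x _ hx => rw [smul_mul_assoc, map_smul, hx, smul_mul_assoc]
        | mem x hx =>
          obtain ⟨g, rfl⟩ := hx
          exact hPb g z) }
  exact ⟨LinearMap.ker P', LinearMap.isCompl_of_proj fun z => Subtype.ext (hPid z.1 z.2)⟩

/-! ## Green's relations in a finite category -/

section Green

variable {C : Type u} [Category.{v} C]

theorem mem_twoSidedMor_self (s : Mor C) : s ∈ twoSidedMor s := ⟨𝟙 _, 𝟙 _, by simp⟩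

theorem Mor.le_iff {s t : Mor C} :
    s ≤ t ↔ ∃ (p : s.dom ⟶ t.dom) (q : t.cod ⟶ s.cod), s.hom = p ≫ t.hom ≫ q := by
  refine ⟨fun h => h (mem_twoSidedMor_self s), ?_⟩
  rintro ⟨p, q, h⟩ a ⟨p', q', h'⟩
  exact ⟨p' ≫ p, q ≫ q', by rw [h', h]; simp⟩

theorem Mor.comp_le_left {X Y Z : C} (s : X ⟶ Y) (t : Y ⟶ Z) :
    (⟨X, Z, s ≫ t⟩ : Mor C) ≤ ⟨X, Y, s⟩ := Mor.le_iff.2 ⟨𝟙 X, t, by simp⟩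

theorem Mor.comp_le_right {X Y Z : C} (s : X ⟶ Y) (t : Y ⟶ Z) :
    (⟨X, Z, s ≫ t⟩ : Mor C) ≤ ⟨Y, Z, t⟩ := Mor.le_iff.2 ⟨s, 𝟙 Z, by simp⟩

theorem jClass_le_iff {s t : Mor C} : jClass s ≤ jClass t ↔ s ≤ t :=
  toAntisymmetrization_le_toAntisymmetrization_iff

theorem finite_end [Finite (Mor C)] (X : C) : Finite (End X) :=
  Finite.of_injective (fun s : End X => (⟨X, X, s⟩ : Mor C)) fun a b h => by
    simpa using h

/-- Stability: if `s` lies in the two-sided ideal generated by `a ∘ s`, then it lies in the left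
ideal generated by `a ∘ s`. -/
theorem Mor.exists_comp_eq_self [Finite (Mor C)] {X Y Z : C} (s : X ⟶ Y) (a : Y ⟶ Z)
    (h : (⟨X, Y, s⟩ : Mor C) ≤ ⟨X, Z, s ≫ a⟩) : ∃ b : Z ⟶ Y, s ≫ a ≫ b = s := by
  obtain ⟨p, q, hpq⟩ := Mor.le_iff.1 h
  dsimp only at p q hpq
  let y : End Y := a ≫ q
  let r : End X := p
  -- Iterating s = p ≫ s ≫ (a ≫ q) puts powers on both sides. At an exponent where the right-hand
  -- power is idempotent, that power fixes s, and it starts with a.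
  have hpow : ∀ m : ℕ, s = (show X ⟶ X from r ^ m) ≫ s ≫ (show Y ⟶ Y from y ^ m) := by
    intro m
    induction m with
    | zero =>
      rw [pow_zero, pow_zero]
      change s = 𝟙 X ≫ s ≫ 𝟙 Y
      simp
    | succ m ih =>
      rw [pow_succ, pow_succ']
      change s = (p ≫ (show X ⟶ X from r ^ m)) ≫ s ≫ ((show Y ⟶ Y from y ^ m) ≫ (a ≫ q))
      have : (p ≫ (show X ⟶ X from r ^ m)) ≫ s ≫ ((show Y ⟶ Y from y ^ m) ≫ (a ≫ q)) =
          p ≫ ((show X ⟶ X from r ^ m) ≫ s ≫ (show Y ⟶ Y from y ^ m)) ≫ a ≫ q := by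
        simp only [Category.assoc]
      rw [this, ← ih]
      simpa only [Category.assoc] using hpq
  have := finite_end Y
  obtain ⟨m, hm⟩ := exists_isIdempotentElem_pow_succ y
  have hm' : (show Y ⟶ Y from y ^ (m + 1)) ≫ (show Y ⟶ Y from y ^ (m + 1)) =
      (show Y ⟶ Y from y ^ (m + 1)) := hm.eq
  refine ⟨q ≫ (show Y ⟶ Y from y ^ m), ?_⟩
  have h1 : a ≫ q ≫ (show Y ⟶ Y from y ^ m) = (show Y ⟶ Y from y ^ (m + 1)) := by
    rw [pow_succ]
    change _ = (a ≫ q) ≫ (show Y ⟶ Y from y ^ m)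
    rw [Category.assoc]
  rw [h1]
  conv_lhs => rw [hpow (m + 1)]
  rw [Category.assoc, Category.assoc, hm', ← hpow (m + 1)]

/-- The left ideal `S ∘ s`. -/
def leftIdealMor (s : Mor C) : Set (Mor C) :=
  {a | ∃ (h : a.dom = s.dom) (q : s.cod ⟶ a.cod), a.hom = eqToHom h ≫ s.hom ≫ q}

theorem mem_leftIdealMor_self (s : Mor C) : s ∈ leftIdealMor s := ⟨rfl, 𝟙 _, by simp⟩

theorem leftIdealMor_comp_subset {X Y Z : C} (s : X ⟶ Y) (t : Y ⟶ Z) :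
    leftIdealMor (⟨X, Z, s ≫ t⟩ : Mor C) ⊆ leftIdealMor ⟨X, Y, s⟩ := by
  rintro ⟨X', W, a⟩ ⟨h, q, hq⟩
  obtain rfl : X' = X := h
  exact ⟨rfl, t ≫ q, by simpa using hq⟩

theorem le_of_mem_leftIdealMor {s t : Mor C} (h : s ∈ leftIdealMor t) : s ≤ t := by
  obtain ⟨h, q, hq⟩ := h
  exact Mor.le_iff.2 ⟨eqToHom h, q, hq⟩

/-- Stability recovers s from s ≫ a by a further composition, so neither left ideal is smaller. -/
theorem leftIdealMor_comp [Finite (Mor C)] {X Y Z : C} (s : X ⟶ Y) (a : Y ⟶ Z)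
    (h : (⟨X, Y, s⟩ : Mor C) ≤ ⟨X, Z, s ≫ a⟩) :
    leftIdealMor (⟨X, Z, s ≫ a⟩ : Mor C) = leftIdealMor ⟨X, Y, s⟩ := by
  refine (leftIdealMor_comp_subset s a).antisymm ?_
  obtain ⟨b, hb⟩ := Mor.exists_comp_eq_self s a h
  have := leftIdealMor_comp_subset (s ≫ a) b
  rwa [Category.assoc, hb] at this

/-- If s t s = s, then t s is idempotent and generates the same left ideal as s. -/
theorem IsSplitCategory.exists_leftIdealMor_eq (hsplit : IsSplitCategory C) (s : Mor C) :
    ∃ (X : C) (g : End X), IsIdempotentElem g ∧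
      leftIdealMor (⟨X, X, g⟩ : Mor C) = leftIdealMor s := by
  obtain ⟨X, Y, s⟩ := s
  obtain ⟨t, ht⟩ := hsplit s
  refine ⟨X, s ≫ t, ?_, (leftIdealMor_comp_subset s t).antisymm ?_⟩
  · change (s ≫ t) ≫ s ≫ t = s ≫ t
    rw [← Category.assoc, Category.assoc s t s, ht]
  · have := leftIdealMor_comp_subset (s ≫ t) s
    rwa [Category.assoc, ht] at this

theorem exists_eq_of_leftIdealMor_eq {s : Mor C} {X : C} {g : End X} (hg : IsIdempotentElem g)
    (h : leftIdealMor (⟨X, X, g⟩ : Mor C) = leftIdealMor s) :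
    ∃ (Y : C) (t : X ⟶ Y), s = ⟨X, Y, t⟩ ∧ g ≫ t = t := by
  have hs : s ∈ leftIdealMor (⟨X, X, g⟩ : Mor C) := h ▸ mem_leftIdealMor_self s
  obtain ⟨X', Y, s⟩ := s
  obtain ⟨h', q, hq⟩ := hs
  obtain rfl : X' = X := h'
  have hgg : g ≫ g = g := hg.eq
  refine ⟨Y, s, rfl, ?_⟩
  simp only [eqToHom_refl, Category.id_comp] at hq
  rw [hq, ← Category.assoc, hgg]

/-- Stability applied to e and e ≫ m gives a one-sided inverse of m, which is two-sided in a finite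
monoid. Consequently the non-units are the elements strictly below e. -/
theorem LocalMonoid.isUnit_iff [Finite (Mor C)] {X : C} {e : End X} {he : IsIdempotentElem e}
    (m : LocalMonoid he) : IsUnit m ↔ (⟨X, X, e⟩ : Mor C) ≤ m.mor := by
  obtain ⟨h₁, h₂⟩ := (Subsemigroup.mem_corner_iff he).1 m.2
  have hem : e ≫ (show X ⟶ X from m.1) = m.1 := h₂
  have hme : (show X ⟶ X from m.1) ≫ e = m.1 := h₁
  have hee : e ≫ e = e := he.eq
  constructor
  · rintro ⟨g, rfl⟩
    have hg : ((g : LocalMonoid he).1 : X ⟶ X) ≫ ((g⁻¹ : (LocalMonoid he)ˣ) : LocalMonoid he).1 = e :=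
      congrArg Subtype.val g.inv_mul
    refine Mor.le_iff.2 ⟨𝟙 X, ((g⁻¹ : (LocalMonoid he)ˣ) : LocalMonoid he).1, ?_⟩
    exact hg.symm.trans (Category.id_comp _).symm
  · intro h
    obtain ⟨b, hb⟩ := Mor.exists_comp_eq_self e (show X ⟶ X from m.1) (by rw [hem]; exact h)
    rw [← Category.assoc, hem] at hb
    let b' : LocalMonoid he := ⟨e * (show End X from b) * e, show End X from b, rfl⟩
    have hb' : b' * m = 1 := Subtype.ext (by
      change (show X ⟶ X from m.1) ≫ (e ≫ b ≫ e) = e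
      rw [← Category.assoc, hme, ← Category.assoc, hb, hee])
    exact IsUnit.of_mul_eq_one_right _ hb'

end Green
end

/-! ### Idempotents of the category and the span ideals in the twisted algebra -/

noncomputable section

namespace TwistedCategoryAlgebra

variable {C : Type u} [Category.{v} C] {k : Type w} [Field k] (α : TwoCocycle C k)

/-- The cocycle identity for e, e, s after cancellation. Because the value does not depend on s, the
normalised idempotent e' acts as an exact identity on morphisms fixed by e. -/
theorem _root_.TwoCocycle.toFun_idem_right {X Y : C} {e : End X} (he : IsIdempotentElem e)
    {s : X ⟶ Y} (hs : e ≫ s = s) : α.toFun s e = α.toFun e e := by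
  have h := α.cocycle e e s
  rw [hs, show e ≫ e = e from he.eq] at h
  exact mul_left_cancel h

theorem _root_.TwoCocycle.toFun_idem_left {X Y : C} {e : End Y} (he : IsIdempotentElem e)
    {s : X ⟶ Y} (hs : s ≫ e = s) : α.toFun e s = α.toFun e e := by
  have h := α.cocycle s e e
  rw [hs, show e ≫ e = e from he.eq] at h
  rw [mul_comm] at h
  exact (mul_right_cancel h).symm

section Index

variable {n : ℕ} {S : Fin n → JClass C} (hSbij : Function.Bijective S)
  (hSord : ∀ i j, S i < S j → i < j)

/-- The index of the `𝒥`-class of `s` in the enumeration `S`. -/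
def classIndex (s : Mor C) : Fin n := (Equiv.ofBijective S hSbij).symm (jClass s)

theorem apply_classIndex (s : Mor C) : S (classIndex hSbij s) = jClass s :=
  (Equiv.ofBijective S hSbij).apply_symm_apply (jClass s)

theorem classIndex_eq {s : Mor C} {i : Fin n} (h : jClass s = S i) : classIndex hSbij s = i :=
  hSbij.1 ((apply_classIndex hSbij s).trans h)

theorem le_of_classIndex_eq {s t : Mor C} (h : classIndex hSbij s = classIndex hSbij t) : s ≤ t :=
  jClass_le_iff.1 (by rw [← apply_classIndex hSbij s, h, apply_classIndex hSbij t])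

include hSord in
theorem classIndex_mono {s t : Mor C} (h : s ≤ t) : (classIndex hSbij s).1 ≤ (classIndex hSbij t).1 := by
  have h' := jClass_le_iff.2 h
  rw [← apply_classIndex hSbij s, ← apply_classIndex hSbij t] at h'
  rcases h'.lt_or_eq with h' | h'
  · exact Fin.le_def.1 (hSord _ _ h').le
  · exact Fin.le_def.1 (hSbij.1 h').le

end Index

variable [Finite (Mor C)]

section Local

variable {X : C} {e : End X} (he : IsIdempotentElem e)

theorem of_mul_idem {Y : C} {s : X ⟶ Y} (hs : e ≫ s = s) :
    of α ⟨X, Y, s⟩ * idem α he = of α ⟨X, Y, s⟩ := by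
  unfold idem
  rw [mul_smul_comm, of_comp, hs, smul_smul, α.toFun_idem_right he hs, Units.inv_mul, one_smul]

theorem idem_mul_of {Y : C} {s : Y ⟶ X} (hs : s ≫ e = s) :
    idem α he * of α ⟨Y, X, s⟩ = of α ⟨Y, X, s⟩ := by
  unfold idem
  rw [smul_mul_assoc, of_comp, hs, smul_smul, α.toFun_idem_left he hs, Units.inv_mul, one_smul]

theorem of_eq_smul_of_mul_of {X Y Z : C} (t : Y ⟶ Z) (s : X ⟶ Y) :
    of α ⟨X, Z, s ≫ t⟩ = (((α.toFun t s)⁻¹ : kˣ) : k) • (of α ⟨Y, Z, t⟩ * of α ⟨X, Y, s⟩) := by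
  rw [of_comp, smul_smul, Units.inv_mul, one_smul]

theorem induction_of {p : TwistedCategoryAlgebra α → Prop} (h0 : p 0)
    (hadd : ∀ a b, p a → p b → p (a + b)) (hsmul : ∀ (c : k) a, p a → p (c • a))
    (hof : ∀ s, p (of α s)) (a : TwistedCategoryAlgebra α) : p a := by
  have ha : a ∈ Submodule.span k (Set.range (of α)) := (span_of α).ge Submodule.mem_top
  induction ha using Submodule.span_induction with
  | zero => exact h0
  | add x y _ _ hx hy => exact hadd x y hx hy
  | smul c x _ hx => exact hsmul c x hx
  | mem x hx =>
    obtain ⟨s, rfl⟩ := hx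
    exact hof s

/-- Maschke's theorem for the twisted group algebra `k_α Γ_e`. -/
theorem isSemisimpleRing_groupAlgebra (hΓ : (Nat.card (MaximalSubgroup he) : k) ≠ 0) :
    IsSemisimpleRing (groupAlgebra α he) := by
  have hcorner : ∀ g : MaximalSubgroup he, of α (g : LocalMonoid he).mor ∈ groupSpan α he :=
    fun g => Submodule.subset_span ⟨g, rfl⟩
  let b : MaximalSubgroup he → groupAlgebra α he := fun g =>
    ⟨⟨of α (g : LocalMonoid he).mor, groupSpan_corner α he (hcorner g)⟩, hcorner g⟩
  have hval : ∀ (c : k) (z : groupAlgebra α he), (c • z).1.1 = c • z.1.1 := fun _ _ => rfl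
  -- The constant for the unit is α(e,e), since the identity of the corner is e' = α(e,e)⁻¹ e.
  refine isSemisimpleRing_of_twistedBasis hΓ b
    (fun g h => α.toFun (g : LocalMonoid he).1 (h : LocalMonoid he).1) (α.toFun e e) ?_ ?_ ?_
  · intro g h
    refine Subtype.ext (Subtype.ext ?_)
    exact of_mor_mul α he g h
  · refine Subtype.ext (Subtype.ext ?_)
    change of α _ = ((α.toFun e e : kˣ) : k) • idem α he
    unfold idem
    rw [smul_smul, Units.mul_inv, one_smul]
    rfl
  · rw [eq_top_iff]
    rintro ⟨⟨z, hz'⟩, hz⟩ -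
    have hz0 : z ∈ groupSpan α he := hz
    let ι : groupAlgebra α he →ₗ[k] TwistedCategoryAlgebra α :=
      (cornerInclusion k (idem_isIdempotentElem α he)) ∘ₗ (groupAlgebra α he).val.toLinearMap
    have hι : Function.Injective ι := fun z z' h => Subtype.ext (Subtype.ext h)
    have h1 : (Submodule.span k (Set.range b)).map ι = groupSpan α he := by
      rw [Submodule.map_span, ← Set.range_comp]
      rfl
    rw [← h1] at hz0
    obtain ⟨z', hz', h2⟩ := hz0
    have : z' = ⟨⟨z, _⟩, hz⟩ := hι h2
    exact this ▸ hz'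

end Local

section Chain

variable {n : ℕ} {S : Fin n → JClass C} (hSbij : Function.Bijective S)
  (hSord : ∀ i j, S i < S j → i < j)

theorem chainIdeal_eq (m : ℕ) : chainIdeal α S m =
    Submodule.span k (of α '' {s | (classIndex hSbij s).1 < m}) := by
  unfold chainIdeal
  congr 1
  ext a
  constructor
  · rintro ⟨s, i, hi, hs, rfl⟩
    exact ⟨s, (congrArg Fin.val (classIndex_eq hSbij hs)).trans_lt hi, rfl⟩
  · rintro ⟨s, hs, rfl⟩
    exact ⟨s, _, hs, (apply_classIndex hSbij s).symm, rfl⟩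

theorem of_mem_chainIdeal {s : Mor C} {m : ℕ} (h : (classIndex hSbij s).1 < m) :
    of α s ∈ chainIdeal α S m := by
  rw [chainIdeal_eq α hSbij]
  exact Submodule.subset_span ⟨s, h, rfl⟩

theorem chainIdeal_induction {m : ℕ} {p : TwistedCategoryAlgebra α → Prop} (h0 : p 0)
    (hadd : ∀ a b, p a → p b → p (a + b)) (hsmul : ∀ (c : k) a, p a → p (c • a))
    (hof : ∀ s, (classIndex hSbij s).1 < m → p (of α s)) {a : TwistedCategoryAlgebra α}
    (ha : a ∈ chainIdeal α S m) : p a := by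
  rw [chainIdeal_eq α hSbij] at ha
  induction ha using Submodule.span_induction with
  | zero => exact h0
  | add x y _ _ hx hy => exact hadd x y hx hy
  | smul c x _ hx => exact hsmul c x hx
  | mem x hx =>
    obtain ⟨s, hs, rfl⟩ := hx
    exact hof s hs

include hSbij hSord

/-- Composition can only descend in the `𝒥`-order, and the numbering refines that order. -/
theorem of_mul_of_mem_chainIdeal (t s : Mor C) {m : ℕ}
    (h : (classIndex hSbij s).1 < m ∨ (classIndex hSbij t).1 < m) :
    of α t * of α s ∈ chainIdeal α S m := by
  by_cases hts : s.cod = t.dom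
  · obtain ⟨Y, Z, t⟩ := t
    obtain ⟨X, Y', s⟩ := s
    obtain rfl : Y' = Y := hts
    rw [of_comp]
    refine Submodule.smul_mem _ _ (of_mem_chainIdeal α hSbij ?_)
    rcases h with h | h
    · exact (classIndex_mono hSbij hSord (Mor.comp_le_left s t)).trans_lt h
    · exact (classIndex_mono hSbij hSord (Mor.comp_le_right s t)).trans_lt h
  · rw [of_not_comp α t s hts]
    exact Submodule.zero_mem _

theorem mul_mem_chainIdeal_left {m : ℕ} (a : TwistedCategoryAlgebra α)
    {b : TwistedCategoryAlgebra α} (hb : b ∈ chainIdeal α S m) : a * b ∈ chainIdeal α S m := by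
  refine chainIdeal_induction α hSbij (p := fun b => a * b ∈ chainIdeal α S m) ?_ ?_ ?_ ?_ hb
  · rw [mul_zero]; exact Submodule.zero_mem _
  · intro x y hx hy
    rw [mul_add]; exact Submodule.add_mem _ hx hy
  · intro c x hx
    rw [mul_smul_comm]; exact Submodule.smul_mem _ c hx
  · intro s hs
    refine induction_of α (p := fun a => a * of α s ∈ chainIdeal α S m) ?_ ?_ ?_ ?_ a
    · rw [zero_mul]; exact Submodule.zero_mem _
    · intro x y hx hy
      rw [add_mul]; exact Submodule.add_mem _ hx hy
    · intro c x hx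
      rw [smul_mul_assoc]; exact Submodule.smul_mem _ c hx
    · exact fun t => of_mul_of_mem_chainIdeal α hSbij hSord t s (.inl hs)

theorem mul_mem_chainIdeal_right {m : ℕ} {a : TwistedCategoryAlgebra α}
    (ha : a ∈ chainIdeal α S m) (b : TwistedCategoryAlgebra α) : a * b ∈ chainIdeal α S m := by
  refine chainIdeal_induction α hSbij (p := fun a => a * b ∈ chainIdeal α S m) ?_ ?_ ?_ ?_ ha
  · rw [zero_mul]; exact Submodule.zero_mem _
  · intro x y hx hy
    rw [add_mul]; exact Submodule.add_mem _ hx hy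
  · intro c x hx
    rw [smul_mul_assoc]; exact Submodule.smul_mem _ c hx
  · intro s hs
    refine induction_of α (p := fun b => of α s * b ∈ chainIdeal α S m) ?_ ?_ ?_ ?_ b
    · rw [mul_zero]; exact Submodule.zero_mem _
    · intro x y hx hy
      rw [mul_add]; exact Submodule.add_mem _ hx hy
    · intro c x hx
      rw [mul_smul_comm]; exact Submodule.smul_mem _ c hx
    · exact fun t => of_mul_of_mem_chainIdeal α hSbij hSord s t (.inr hs)

omit hSbij hSord in
variable (S) in
theorem idem_mem_chainIdeal (hSbij : Function.Bijective S) {X : C} {e : End X}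
    (he : IsIdempotentElem e) {m : ℕ} (h : (classIndex hSbij ⟨X, X, e⟩).1 < m) :
    idem α he ∈ chainIdeal α S m :=
  Submodule.smul_mem _ _ (of_mem_chainIdeal α hSbij h)

/-- The span `J_m` as a left ideal. -/
def chainLeftIdeal (m : ℕ) : Ideal (TwistedCategoryAlgebra α) where
  carrier := chainIdeal α S m
  zero_mem' := Submodule.zero_mem _
  add_mem' := Submodule.add_mem _
  smul_mem' a _ hb := mul_mem_chainIdeal_left α hSbij hSord a hb

theorem chainLeftIdeal_isTwoSided (m : ℕ) : (chainLeftIdeal α hSbij hSord m).IsTwoSided :=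
  ⟨fun b ha => mul_mem_chainIdeal_right α hSbij hSord ha b⟩

theorem chainLeftIdeal_mono : Monotone (chainLeftIdeal α hSbij hSord) := fun _ m' h _ ha =>
  chainIdeal_induction α hSbij (p := fun a => a ∈ chainIdeal α S m') (Submodule.zero_mem _)
    (fun _ _ => Submodule.add_mem _) (fun c _ => Submodule.smul_mem _ c)
    (fun _ hs => of_mem_chainIdeal α hSbij (hs.trans_le h)) ha

theorem chainLeftIdeal_zero : chainLeftIdeal α hSbij hSord 0 = ⊥ :=
  eq_bot_iff.2 fun _ ha =>
    chainIdeal_induction α hSbij (m := 0) (p := fun a => a ∈ (⊥ : Ideal (TwistedCategoryAlgebra α)))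
      (Submodule.zero_mem _) (fun _ _ => Submodule.add_mem _)
      (fun c _ => Submodule.smul_of_tower_mem _ c) (fun _ hs => absurd hs (Nat.not_lt_zero _)) ha

theorem chainLeftIdeal_top : chainLeftIdeal α hSbij hSord n = ⊤ :=
  eq_top_iff.2 fun a _ => induction_of α (p := fun a => a ∈ chainIdeal α S n)
    (Submodule.zero_mem _) (fun _ _ => Submodule.add_mem _) (fun c _ => Submodule.smul_mem _ c)
    (fun s => of_mem_chainIdeal α hSbij (classIndex hSbij s).2) a

/-- Every morphism is fixed by right multiplication by an idempotent that generates the same left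
ideal. -/
theorem exists_of_mul_idem (hsplit : IsSplitCategory C) (U : Set (Mor C)) :
    ∃ z : TwistedCategoryAlgebra α, ∀ s, leftIdealMor s = U → of α s * z = of α s ∧
      ∀ m, (classIndex hSbij s).1 < m → z ∈ chainIdeal α S m := by
  by_cases h : ∃ s : Mor C, leftIdealMor s = U
  · obtain ⟨s₀, rfl⟩ := h
    obtain ⟨X, g, hg, hgs₀⟩ := hsplit.exists_leftIdealMor_eq s₀
    refine ⟨idem α hg, fun s hs => ⟨?_, fun m hm => ?_⟩⟩
    · obtain ⟨Y, t, rfl, ht⟩ := exists_eq_of_leftIdealMor_eq hg (hgs₀.trans hs.symm)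
      exact of_mul_idem α hg ht
    · have hle : (⟨X, X, g⟩ : Mor C) ≤ s := le_of_mem_leftIdealMor
        ((hgs₀.trans hs.symm) ▸ mem_leftIdealMor_self (⟨X, X, g⟩ : Mor C))
      exact idem_mem_chainIdeal α S hSbij hg ((classIndex_mono hSbij hSord hle).trans_lt hm)
  · exact ⟨0, fun s hs => absurd ⟨s, hs⟩ h⟩

end Chain

end TwistedCategoryAlgebra
end

noncomputable section

namespace TwistedCategoryAlgebra

variable {C : Type u} [Category.{v} C] {k : Type w} [Field k] (α : TwoCocycle C k)
  [Finite (Mor C)]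

/-! ### Modules over the local algebras `e' A e'` -/

section LocalModules

variable {X : C} {e : End X} (he : IsIdempotentElem e)

theorem groupProj_of_mem_groupSpan {a : TwistedCategoryAlgebra α} (ha : a ∈ groupSpan α he) :
    groupProj α he a = a := by
  induction ha using Submodule.span_induction with
  | zero => rw [map_zero]
  | add x y _ _ hx hy => rw [map_add, hx, hy]
  | smul c x _ hx => rw [map_smul, hx]
  | mem x hx =>
    obtain ⟨g, rfl⟩ := hx
    rw [groupProj_of_mor, if_pos g.isUnit]

theorem localProj_coe (g : groupAlgebra α he) : localProj α he g.1 = g :=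
  Subtype.ext (Subtype.ext (groupProj_of_mem_groupSpan α he g.2))

theorem localProj_surjective : Function.Surjective (localProj α he) :=
  fun g => ⟨g.1, localProj_coe α he g⟩

instance : RingHomSurjective (localProj α he) := ⟨localProj_surjective α he⟩

theorem inflation_smul {T : Type x} [AddCommGroup T] [Module (groupAlgebra α he) T]
    (b : Local α he) (t : T) :
    b • (show Inflation α he T from t) = (localProj α he b • t : T) := rfl

theorem isSimpleModule_inflation (T : Type x) [AddCommGroup T] [Module (groupAlgebra α he) T]
    [IsSimpleModule (groupAlgebra α he) T] : IsSimpleModule (Local α he) (Inflation α he T) := by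
  let id' : Inflation α he T →ₛₗ[localProj α he] T :=
    { toFun := fun t => t
      map_add' := fun _ _ => rfl
      map_smul' := fun _ _ => rfl }
  have hid : Function.Bijective id' := Function.bijective_id
  exact (LinearMap.isSimpleModule_iff_of_bijective (R := Local α he) (S := groupAlgebra α he)
    (σ := localProj α he) id' hid).2 inferInstance

theorem nonempty_equiv_of_inflation {T T' : Type x} [AddCommGroup T]
    [Module (groupAlgebra α he) T] [AddCommGroup T'] [Module (groupAlgebra α he) T']
    (θ : Inflation α he T ≃ₗ[Local α he] Inflation α he T') :
    Nonempty (T ≃ₗ[groupAlgebra α he] T') :=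
  ⟨{ toFun := fun t => θ t
     invFun := fun t => θ.symm t
     left_inv := θ.left_inv
     right_inv := θ.right_inv
     map_add' := θ.map_add
     map_smul' := fun g t => by
       have h := θ.map_smul g.1 t
       have h1 : ∀ t : T, g.1 • (show Inflation α he T from t) = (g • t : T) := fun t => by
         rw [inflation_smul, localProj_coe]
       have h2 : ∀ t : T', g.1 • (show Inflation α he T' from t) = (g • t : T') := fun t => by
         rw [inflation_smul, localProj_coe]
       exact (congrArg θ (h1 t).symm).trans (h.trans (h2 _)) }⟩

variable {n : ℕ} {S : Fin n → JClass C} (hSbij : Function.Bijective S)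
  (hSord : ∀ i j, S i < S j → i < j) {i : Fin n} (hi : jClass (⟨X, X, e⟩ : Mor C) = S i)

include hSbij hSord hi

theorem of_mor_mem_chainIdeal {m : LocalMonoid he} (hm : ¬ IsUnit m) :
    of α m.mor ∈ chainIdeal α S i := by
  obtain ⟨h₁, h₂⟩ := (Subsemigroup.mem_corner_iff he).1 m.2
  have hem : e ≫ (show X ⟶ X from m.1) = m.1 := h₂
  have hle : m.mor ≤ ⟨X, X, e⟩ := by
    have := Mor.comp_le_left e (show X ⟶ X from m.1)
    rwa [hem] at this
  have hie := classIndex_eq hSbij hi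
  refine of_mem_chainIdeal α hSbij (lt_of_le_of_ne ?_ fun h => hm ?_)
  · exact (classIndex_mono hSbij hSord hle).trans_eq (congrArg Fin.val hie)
  · exact m.isUnit_iff.2 (le_of_classIndex_eq hSbij (hie.trans (Fin.ext h).symm))

/-- The decomposition e'Ae' = k_αΓ ⊕ kJ_e, together with the fact that non-units lie strictly below
e. With `groupProj_eq_zero` it identifies kJ_e as the part of the corner in J_i. -/
theorem sub_groupProj_mem_chainIdeal (a : Local α he) :
    a.1 - groupProj α he a.1 ∈ chainIdeal α S i := by
  have ha := local_mem_span α he a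
  generalize a.1 = a' at ha ⊢
  induction ha using Submodule.span_induction with
  | zero => simp
  | add x y _ _ hx hy => rw [map_add, add_sub_add_comm]; exact Submodule.add_mem _ hx hy
  | smul c x _ hx => rw [map_smul, ← smul_sub]; exact Submodule.smul_mem _ c hx
  | mem x hx =>
    obtain ⟨m, rfl⟩ := hx
    rw [groupProj_of_mor]
    split_ifs with h
    · rw [sub_self]; exact Submodule.zero_mem _
    · rw [sub_zero]; exact of_mor_mem_chainIdeal α he hSbij hSord hi h

/-- A unit of the local monoid is `𝒥`-equivalent to e, so no element of Γ_e occurs among the classes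
before the i-th. -/
theorem groupProj_eq_zero {a : TwistedCategoryAlgebra α} (ha : a ∈ chainIdeal α S i) :
    groupProj α he a = 0 := by
  refine chainIdeal_induction α hSbij (p := fun a => groupProj α he a = 0) (map_zero _)
    (fun a b ha hb => by rw [map_add, ha, hb, add_zero])
    (fun c a ha => by rw [map_smul, ha, smul_zero]) (fun s hs => ?_) ha
  rw [groupProj_of, if_neg]
  rintro ⟨g, rfl⟩
  have h1 := classIndex_mono hSbij hSord ((g : LocalMonoid he).isUnit_iff.1 g.isUnit)
  rw [classIndex_eq hSbij hi] at h1
  exact absurd hs h1.not_gt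

theorem localProj_eq_zero {b : Local α he} (hb : b.1 ∈ chainIdeal α S i) :
    localProj α he b = 0 :=
  Subtype.ext (Subtype.ext (groupProj_eq_zero α he hSbij hSord hi hb))

/-- A corner module killed by J_i is an inflation: the identity map is semilinear along the
projection to k_αΓ. Semisimplicity and the list of simple modules are transported through this. -/
theorem smul_eq_localProj_smul {V : Type y} [AddCommGroup V] [Module (Local α he) V]
    (hV : ∀ b : Local α he, b.1 ∈ chainIdeal α S i → ∀ t : V, b • t = 0) (b : Local α he) (t : V) :
    b • t = localProj α he b • t := by
  have h := hV (b - (localProj α he b).1) (sub_groupProj_mem_chainIdeal α he hSbij hSord hi b) t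
  rw [sub_smul, sub_eq_zero] at h
  exact h

theorem isSemisimpleModule_of_annihilated (hΓ : (Nat.card (MaximalSubgroup he) : k) ≠ 0)
    {V : Type y} [AddCommGroup V] [Module (Local α he) V]
    (hV : ∀ b : Local α he, b.1 ∈ chainIdeal α S i → ∀ t : V, b • t = 0) :
    IsSemisimpleModule (Local α he) V := by
  have := isSemisimpleRing_groupAlgebra α he hΓ
  let id' : V →ₛₗ[localProj α he] V :=
    { toFun := fun t => t
      map_add' := fun _ _ => rfl
      map_smul' := smul_eq_localProj_smul α he hSbij hSord hi hV }
  have hid : Function.Bijective id' := Function.bijective_id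
  exact (LinearMap.isSemisimpleModule_iff_of_bijective (R := Local α he) (S := groupAlgebra α he)
    (σ := localProj α he) id' hid).2 inferInstance

theorem exists_equiv_inflation {ι : Type*} {T : ι → Type x} [∀ r, AddCommGroup (T r)]
    [∀ r, Module (groupAlgebra α he) (T r)]
    (hT : IsSimpleRepresentatives (groupAlgebra α he) T)
    (V : Type (max u v w)) [AddCommGroup V] [Module (Local α he) V]
    (hsimple : IsSimpleModule (Local α he) V)
    (hV : ∀ b : Local α he, b.1 ∈ chainIdeal α S i → ∀ t : V, b • t = 0) :
    ∃ r, Nonempty (V ≃ₗ[Local α he] Inflation α he (T r)) := by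
  let id' : V →ₛₗ[localProj α he] V :=
    { toFun := fun t => t
      map_add' := fun _ _ => rfl
      map_smul' := smul_eq_localProj_smul α he hSbij hSord hi hV }
  have hid : Function.Bijective id' := Function.bijective_id
  have := (LinearMap.isSimpleModule_iff_of_bijective (R := Local α he) (S := groupAlgebra α he)
    (σ := localProj α he) id' hid).1 hsimple
  obtain ⟨r, ⟨θ⟩⟩ := hT.complete V this
  exact ⟨r, ⟨{ toFun := fun t => θ t
               invFun := fun t => θ.symm t
               left_inv := θ.left_inv
               right_inv := θ.right_inv
               map_add' := θ.map_add
               map_smul' := fun b t => by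
                 rw [smul_eq_localProj_smul α he hSbij hSord hi hV]
                 exact θ.map_smul _ _ }⟩⟩

end LocalModules

/-! ### The layers of the chain of ideals -/

section Layers

variable {n : ℕ} {S : Fin n → JClass C} (hSbij : Function.Bijective S)
  (hSord : ∀ i j, S i < S j → i < j)

/-- Each basis morphism s equals s z with z a normalised idempotent of the same left ideal, so s is
already a product of two elements of J_m. -/
theorem chainLeftIdeal_idem (hsplit : IsSplitCategory C) (m : ℕ) {a : TwistedCategoryAlgebra α}
    (ha : a ∈ chainLeftIdeal α hSbij hSord m) :
    a ∈ Ideal.span {z | ∃ b ∈ chainLeftIdeal α hSbij hSord m,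
      ∃ c ∈ chainLeftIdeal α hSbij hSord m, z = b * c} := by
  refine chainIdeal_induction α hSbij (p := fun a => a ∈ Ideal.span
    {z | ∃ b ∈ chainLeftIdeal α hSbij hSord m, ∃ c ∈ chainLeftIdeal α hSbij hSord m, z = b * c})
    (Submodule.zero_mem _) (fun _ _ => Submodule.add_mem _)
    (fun c _ => Submodule.smul_of_tower_mem _ c) (fun s hs => Submodule.subset_span ?_) ha
  obtain ⟨z, hz⟩ := exists_of_mul_idem α hSbij hSord hsplit (leftIdealMor s)
  obtain ⟨hsz, hzm⟩ := hz s rfl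
  exact ⟨_, of_mem_chainIdeal α hSbij hs, z, hzm m hs, hsz.symm⟩

variable {X : C} {e : End X} (he : IsIdempotentElem e) {i : Fin n}
  (hi : jClass (⟨X, X, e⟩ : Mor C) = S i)

include hi in
-- A morphism in the class of e factors as q ∘ e ∘ p, hence lies in the left ideal generated by e ∘
-- p, which e' fixes. Morphisms of earlier classes are already in J_i.
theorem chainLeftIdeal_generated {a : TwistedCategoryAlgebra α}
    (ha : a ∈ chainLeftIdeal α hSbij hSord (i + 1)) :
    ∃ b ∈ Ideal.span {z | z ∈ chainLeftIdeal α hSbij hSord (i + 1) ∧ idem α he * z = z},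
      a - b ∈ chainLeftIdeal α hSbij hSord i := by
  have hie := classIndex_eq hSbij hi
  refine chainIdeal_induction α hSbij (p := fun a => ∃ b ∈ Ideal.span
    {z | z ∈ chainLeftIdeal α hSbij hSord (i + 1) ∧ idem α he * z = z},
      a - b ∈ chainIdeal α S i) ?_ ?_ ?_ ?_ ha
  · exact ⟨0, Submodule.zero_mem _, by rw [sub_zero]; exact Submodule.zero_mem _⟩
  · rintro a a' ⟨b, hb, hab⟩ ⟨b', hb', hab'⟩
    exact ⟨b + b', Submodule.add_mem _ hb hb', by
      rw [add_sub_add_comm]; exact Submodule.add_mem _ hab hab'⟩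
  · rintro c a ⟨b, hb, hab⟩
    exact ⟨c • b, Submodule.smul_of_tower_mem _ c hb, by
      rw [← smul_sub]; exact Submodule.smul_mem _ c hab⟩
  · intro s hs
    rcases (Nat.lt_succ_iff.1 hs).lt_or_eq with h | h
    · exact ⟨0, Submodule.zero_mem _, by rw [sub_zero]; exact of_mem_chainIdeal α hSbij h⟩
    · obtain ⟨p, q, hpq⟩ := Mor.le_iff.1
        (le_of_classIndex_eq hSbij ((Fin.ext h).trans hie.symm))
      obtain ⟨Y, Z, s⟩ := s
      dsimp only at p q hpq
      refine ⟨of α ⟨Y, Z, s⟩, ?_, by rw [sub_self]; exact Submodule.zero_mem _⟩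
      rw [hpq, ← Category.assoc, of_eq_smul_of_mul_of]
      refine Submodule.smul_of_tower_mem _ _ (Ideal.mul_mem_left _ _ (Submodule.subset_span ⟨?_, ?_⟩))
      · refine of_mem_chainIdeal α hSbij (Nat.lt_succ_iff.2 ?_)
        exact (classIndex_mono hSbij hSord (Mor.comp_le_right p e)).trans_eq (congrArg Fin.val hie)
      · exact idem_mul_of α he (by rw [Category.assoc, show e ≫ e = e from he.eq])

/-- Splitness gives t with (se)t(se) = se, so se is a left multiple of e(tse), an element of the
corner that lies below s. -/
theorem chainLeftIdeal_corner (hsplit : IsSplitCategory C) {m : ℕ} {a : TwistedCategoryAlgebra α}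
    (ha : a ∈ chainLeftIdeal α hSbij hSord m) :
    a * idem α he ∈ Ideal.span {z | z ∈ chainLeftIdeal α hSbij hSord m ∧
      idem α he * z = z ∧ z * idem α he = z} := by
  have hee : e ≫ e = e := he.eq
  refine chainIdeal_induction α hSbij (p := fun a => a * idem α he ∈ Ideal.span
    {z | z ∈ chainLeftIdeal α hSbij hSord m ∧ idem α he * z = z ∧ z * idem α he = z}) ?_ ?_ ?_ ?_ ha
  · rw [zero_mul]; exact Submodule.zero_mem _
  · intro x y hx hy
    rw [add_mul]; exact Submodule.add_mem _ hx hy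
  · intro c x hx
    rw [smul_mul_assoc]; exact Submodule.smul_of_tower_mem _ c hx
  · intro s hs
    have h0 : of α s * idem α he =
        ((α.toFun e e)⁻¹ : kˣ).val • (of α s * of α ⟨X, X, e⟩) := mul_smul_comm _ _ _
    rw [h0]
    refine Submodule.smul_of_tower_mem _ _ ?_
    by_cases hX : X = s.dom
    · obtain ⟨X', Y, s⟩ := s
      obtain rfl : X = X' := hX
      rw [of_comp]
      refine Submodule.smul_of_tower_mem _ _ ?_
      obtain ⟨t, ht⟩ := hsplit (e ≫ s)
      have h1 : ((e ≫ s) ≫ t ≫ e) ≫ e ≫ s = e ≫ s := by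
        calc ((e ≫ s) ≫ t ≫ e) ≫ e ≫ s = (e ≫ s) ≫ t ≫ (e ≫ e) ≫ s := by
              simp only [Category.assoc]
          _ = e ≫ s := by rw [hee, ht]
      rw [show (⟨X, Y, e ≫ s⟩ : Mor C) = ⟨X, Y, ((e ≫ s) ≫ t ≫ e) ≫ e ≫ s⟩ by rw [h1],
        of_eq_smul_of_mul_of]
      refine Submodule.smul_of_tower_mem _ _ (Ideal.mul_mem_left _ _
        (Submodule.subset_span ⟨?_, ?_, ?_⟩))
      · exact of_mem_chainIdeal α hSbij (((classIndex_mono hSbij hSord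
          (Mor.comp_le_left (e ≫ s) (t ≫ e))).trans
            (classIndex_mono hSbij hSord (Mor.comp_le_right e s))).trans_lt hs)
      · exact idem_mul_of α he (by simp only [Category.assoc, hee])
      · exact of_mul_idem α he (by rw [← Category.assoc, ← Category.assoc e, hee])
    · rw [of_not_comp α s _ hX]
      exact Submodule.zero_mem _

/-- The `k`-linear projection of `A` onto the span of the morphisms that generate the left ideal
`U`. -/
def leftClassProj (U : Set (Mor C)) : TwistedCategoryAlgebra α →ₗ[k] TwistedCategoryAlgebra α :=
  open Classical in
  Finsupp.linearCombination k fun s : Mor C => if leftIdealMor s = U then of α s else 0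

open Classical in
theorem leftClassProj_of (U : Set (Mor C)) (s : Mor C) :
    leftClassProj α U (of α s) = if leftIdealMor s = U then of α s else 0 := by
  change Finsupp.linearCombination k (fun s : Mor C => if leftIdealMor s = U then of α s else 0)
    (Finsupp.single s (1 : k)) = _
  rw [Finsupp.linearCombination_single, one_smul]

theorem leftClassProj_of_mem (U : Set (Mor C)) {m : ℕ} {s : Mor C}
    (hs : (classIndex hSbij s).1 < m) : leftClassProj α U (of α s) ∈ chainIdeal α S m := by
  rw [leftClassProj_of]
  split_ifs
  · exact of_mem_chainIdeal α hSbij hs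
  · exact Submodule.zero_mem _

theorem leftClassProj_mem (U : Set (Mor C)) {m : ℕ} {z : TwistedCategoryAlgebra α}
    (hz : z ∈ chainLeftIdeal α hSbij hSord m) :
    leftClassProj α U z ∈ chainLeftIdeal α hSbij hSord m :=
  chainIdeal_induction α hSbij (p := fun z => leftClassProj α U z ∈ chainIdeal α S m)
    (by rw [map_zero]; exact Submodule.zero_mem _)
    (fun x y hx hy => by rw [map_add]; exact Submodule.add_mem _ hx hy)
    (fun c x hx => by rw [map_smul]; exact Submodule.smul_mem _ c hx)
    (fun s hs => leftClassProj_of_mem α hSbij U hs) hz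

include hSbij hSord in
-- Left multiplication by t either drops t ∘ s into J_i, where nothing has to be checked, or keeps
-- the `𝒥`-class of s and then, by stability, the left ideal as well. So the projection is left
-- linear modulo J_i.
theorem leftClassProj_of_mul_of (U : Set (Mor C)) (i : Fin n) (t s : Mor C)
    (hs : (classIndex hSbij s).1 < i.1 + 1) :
    leftClassProj α U (of α t * of α s) - of α t * leftClassProj α U (of α s) ∈
      chainIdeal α S i := by
  classical
  by_cases hts : s.cod = t.dom
  · obtain ⟨Y, Z, t⟩ := t
    obtain ⟨X, Y', s⟩ := s
    obtain rfl : Y' = Y := hts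
    have hle := classIndex_mono hSbij hSord (Mor.comp_le_left s t)
    by_cases hlt : (classIndex hSbij ⟨X, Z, s ≫ t⟩).1 < i
    · have h1 : of α ⟨Y', Z, t⟩ * of α ⟨X, Y', s⟩ ∈ chainIdeal α S i := by
        rw [of_comp]
        exact Submodule.smul_mem _ _ (of_mem_chainIdeal α hSbij hlt)
      refine Submodule.sub_mem _ (leftClassProj_mem α hSbij hSord U h1) ?_
      rw [leftClassProj_of]
      split_ifs
      · exact h1
      · rw [mul_zero]; exact Submodule.zero_mem _
    · have heq : classIndex hSbij ⟨X, Y', s⟩ = classIndex hSbij ⟨X, Z, s ≫ t⟩ := Fin.ext (by omega)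
      have hL := leftIdealMor_comp s t (le_of_classIndex_eq hSbij heq)
      rw [of_comp, map_smul, leftClassProj_of, leftClassProj_of, hL]
      split_ifs
      · rw [of_comp, sub_self]; exact Submodule.zero_mem _
      · rw [smul_zero, mul_zero, sub_self]; exact Submodule.zero_mem _
  · rw [of_not_comp α t s hts, map_zero, leftClassProj_of]
    split_ifs
    · rw [of_not_comp α t s hts, sub_self]; exact Submodule.zero_mem _
    · rw [mul_zero, sub_self]; exact Submodule.zero_mem _

include hSbij hSord in
theorem leftClassProj_mul (U : Set (Mor C)) (i : Fin n) (a : TwistedCategoryAlgebra α)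
    {z : TwistedCategoryAlgebra α} (hz : z ∈ chainIdeal α S (i + 1)) :
    leftClassProj α U (a * z) - a * leftClassProj α U z ∈ chainIdeal α S i := by
  refine chainIdeal_induction α hSbij (p := fun z =>
    leftClassProj α U (a * z) - a * leftClassProj α U z ∈ chainIdeal α S i) ?_ ?_ ?_ ?_ hz
  · simp
  · intro x y hx hy
    rw [mul_add, map_add, map_add, mul_add, add_sub_add_comm]; exact Submodule.add_mem _ hx hy
  · intro c x hx
    rw [mul_smul_comm, map_smul, map_smul, mul_smul_comm, ← smul_sub]
    exact Submodule.smul_mem _ c hx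
  · intro s hs
    refine induction_of α (p := fun a => leftClassProj α U (a * of α s) -
      a * leftClassProj α U (of α s) ∈ chainIdeal α S i) ?_ ?_ ?_ ?_ a
    · simp
    · intro x y hx hy
      rw [add_mul, map_add, add_mul, add_sub_add_comm]; exact Submodule.add_mem _ hx hy
    · intro c x hx
      rw [smul_mul_assoc, map_smul, smul_mul_assoc, ← smul_sub]; exact Submodule.smul_mem _ c hx
    · exact fun t => leftClassProj_of_mul_of α hSbij hSord U i t s hs

/-- The layers `J_(i+1) / J_i` are projective relative to `J_i`. -/
theorem isRelativelyProjective_layer (hsplit : IsSplitCategory C) (i : Fin n) :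
    IsRelativelyProjective (chainLeftIdeal α hSbij hSord i)
      (chainLeftIdeal α hSbij hSord (i + 1) ⧸ (chainLeftIdeal α hSbij hSord i).submoduleOf
        (chainLeftIdeal α hSbij hSord (i + 1))) := by
  classical
  have := Fintype.ofFinite (Set (Mor C))
  choose z hz using exists_of_mul_idem α hSbij hSord hsplit
  set I := chainLeftIdeal α hSbij hSord i with hI
  set I' := chainLeftIdeal α hSbij hSord (i + 1) with hI'
  have hI2 : I.IsTwoSided := chainLeftIdeal_isTwoSided α hSbij hSord i
  have hI'2 : I'.IsTwoSided := chainLeftIdeal_isTwoSided α hSbij hSord (i + 1)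
  -- The coordinates: φ U extracts the part of an element supported on generators of the left ideal
  -- U, and r U multiplies on the right by the idempotent attached to U.
  let φ : Set (Mor C) → (I' ⧸ I.submoduleOf I') →ₗ[TwistedCategoryAlgebra α]
      (TwistedCategoryAlgebra α ⧸ I) := fun U =>
    Submodule.liftQ _
      { toFun := fun a => I.mkQ (leftClassProj α U a.1)
        map_add' := fun a b => by
          change I.mkQ (leftClassProj α U (a.1 + b.1)) = _
          rw [map_add, map_add]
        map_smul' := fun c a =>
          (Submodule.Quotient.eq I).2 (leftClassProj_mul α hSbij hSord U i c a.2) }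
      fun a ha => (Submodule.Quotient.mk_eq_zero I).2 (leftClassProj_mem α hSbij hSord U ha)
  -- The value 0 is used only where z U lies outside J_(i+1); no morphism of J_(i+1) generates such
  -- a U.
  let y : Set (Mor C) → I' := fun U => if h : z U ∈ I' then ⟨z U, h⟩ else 0
  let r : Set (Mor C) → (TwistedCategoryAlgebra α ⧸ I) →ₗ[TwistedCategoryAlgebra α]
      (I' ⧸ I.submoduleOf I') := fun U =>
    Submodule.liftQ _ ((I.submoduleOf I').mkQ ∘ₗ
      LinearMap.toSpanSingleton (TwistedCategoryAlgebra α) I' (y U)) fun a ha =>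
        (Submodule.Quotient.mk_eq_zero (I.submoduleOf I')).2 (I.mul_mem_right (y U).1 ha)
  refine IsRelativelyProjective.of_sum φ r fun a => ?_
  obtain ⟨⟨a, ha⟩, rfl⟩ := Submodule.mkQ_surjective _ a
  suffices h : a - ∑ U, leftClassProj α U a * (y U).1 ∈ I by
    have h1 : ∀ U, r U (φ U ((I.submoduleOf I').mkQ ⟨a, ha⟩)) =
        (I.submoduleOf I').mkQ (leftClassProj α U a • y U) := fun U => rfl
    rw [Finset.sum_congr rfl fun U _ => h1 U, ← map_sum]
    refine ((Submodule.Quotient.eq (I.submoduleOf I')).2 ?_).symm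
    change (I'.subtype (_ - _)) ∈ I
    rw [map_sub, map_sum]
    exact h
  refine chainIdeal_induction α hSbij
    (p := fun a => a - ∑ U, leftClassProj α U a * (y U).1 ∈ chainIdeal α S i) ?_ ?_ ?_ ?_ ha
  · simp
  · intro a b ha hb
    rw [show (∑ U, leftClassProj α U (a + b) * (y U).1) =
      (∑ U, leftClassProj α U a * (y U).1) + ∑ U, leftClassProj α U b * (y U).1 by
        rw [← Finset.sum_add_distrib]
        exact Finset.sum_congr rfl fun U _ => by rw [map_add, add_mul], add_sub_add_comm]
    exact Submodule.add_mem _ ha hb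
  · intro c a ha
    rw [show (∑ U, leftClassProj α U (c • a) * (y U).1) =
      c • ∑ U, leftClassProj α U a * (y U).1 by
        rw [Finset.smul_sum]
        exact Finset.sum_congr rfl fun U _ => by rw [map_smul, smul_mul_assoc], ← smul_sub]
    exact Submodule.smul_mem _ c ha
  · intro s hs
    obtain ⟨h1, h2⟩ := hz (leftIdealMor s) s rfl
    have hy : (y (leftIdealMor s)).1 = z (leftIdealMor s) := by
      have h3 : z (leftIdealMor s) ∈ I' := h2 _ hs
      simp only [y, dif_pos h3]
    rw [Finset.sum_eq_single (leftIdealMor s)]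
    · rw [leftClassProj_of, if_pos rfl, hy, h1, sub_self]
      exact Submodule.zero_mem _
    · intro U _ hU
      rw [leftClassProj_of, if_neg (Ne.symm hU), zero_mul]
    · exact fun h => absurd (Finset.mem_univ _) h

end Layers

end TwistedCategoryAlgebra
end

/-! ### Verification of the axioms for twisted category algebras, and the main theorem -/

noncomputable section

namespace TwistedCategoryAlgebra

variable {C : Type u} [Category.{v} C] {k : Type w} [Field k] (α : TwoCocycle C k)
  [Finite (Mor C)] {n : ℕ} {S : Fin n → JClass C} (hSbij : Function.Bijective S)
  (hSord : ∀ i j, S i < S j → i < j) {X : Fin n → C} {e : ∀ i, End (X i)}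
  (he : ∀ i, IsIdempotentElem (e i)) (heS : ∀ i, jClass (⟨X i, X i, e i⟩ : Mor C) = S i)
  {l : Fin n → ℕ} (T : ∀ i, Fin (l i) → Type x) [∀ i r, AddCommGroup (T i r)]
  [∀ i r, Module (groupAlgebra α (he i)) (T i r)]
  (hT : ∀ i, IsSimpleRepresentatives (groupAlgebra α (he i)) (T i))

include heS hT

/-- The ideals `J_m` of the twisted category algebra of a split category are stratifying. -/
theorem isStratifying (hsplit : IsSplitCategory C)
    (hΓ : ∀ i, (Nat.card (MaximalSubgroup (he i)) : k) ≠ 0) :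
    IsStratifying (chainLeftIdeal α hSbij hSord) (fun i => idem_isIdempotentElem α (he i))
      (fun i r => Inflation α (he i) (T i r)) where
  isTwoSided := chainLeftIdeal_isTwoSided α hSbij hSord
  mono := chainLeftIdeal_mono α hSbij hSord
  bot := chainLeftIdeal_zero α hSbij hSord
  top := chainLeftIdeal_top α hSbij hSord
  idem m _ ha := chainLeftIdeal_idem α hSbij hSord hsplit m ha
  mem i := idem_mem_chainIdeal α S hSbij (he i)
    (by rw [classIndex_eq hSbij (heS i)]; exact Nat.lt_succ_self _)
  generated i _ ha := chainLeftIdeal_generated α hSbij hSord (he i) (heS i) ha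
  corner i _ ha := chainLeftIdeal_corner α hSbij hSord (he i) hsplit ha
  proj := isRelativelyProjective_layer α hSbij hSord hsplit
  semisimple i _ _ _ hV :=
    isSemisimpleModule_of_annihilated α (he i) hSbij hSord (heS i) (hΓ i) hV
  simple i r :=
    have := (hT i).simple r
    isSimpleModule_inflation α (he i) (T i r)
  annihilated i r b hb t := by
    have h : localProj α (he i) b = 0 := localProj_eq_zero α (he i) hSbij hSord (heS i) hb
    have h1 : (localProj α (he i) b • (show T i r from t) : T i r) = 0 := by rw [h, zero_smul]
    exact h1
  irredundant i r s h := by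
    obtain ⟨θ⟩ := h
    exact (hT i).irredundant r s (nonempty_equiv_of_inflation α (he i) θ)
  complete i V _ _ hV hV' :=
    exists_equiv_inflation α (he i) hSbij hSord (heS i) (hT i) V hV hV'

omit heS in
theorem labelIdempotent_spec (a : Σ i, Fin (l i)) :
    IsIdempotentElem (labelIdempotent α he T a) ∧ ∃ b : Local α (he a.1),
      b.1 = labelIdempotent α he T a ∧ ∀ t : Inflation α (he a.1) (T a.1 a.2), b • t = t := by
  have := (hT a.1).simple a.2
  have hb := blockIdempotent_spec (R := groupAlgebra α (he a.1)) (T a.1 a.2)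
  refine ⟨congrArg (fun z : groupAlgebra α (he a.1) => z.1.1) hb.idem.eq,
    (blockIdempotent (groupAlgebra α (he a.1)) (T a.1 a.2)).1, rfl, fun t => ?_⟩
  have h1 : ∀ t : T a.1 a.2,
      blockIdempotent (groupAlgebra α (he a.1)) (T a.1 a.2) • t = t :=
    (centralIdempotent_smul_simple hb.idem hb.central).resolve_left fun h => by
      obtain ⟨t, ht⟩ := hb.acts
      exact ht (h t)
  have h2 := inflation_smul α (he a.1)
    (blockIdempotent (groupAlgebra α (he a.1)) (T a.1 a.2)).1 (show T a.1 a.2 from t)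
  rw [localProj_coe] at h2
  exact h2.trans (h1 t)

omit hT in
include hSbij hSord in
-- If e_p ∘ s ∘ e_q does not drop into J_i, it belongs to the i-th class, and as a composite it lies
-- below both e_p and e_q. This supplies the comparison of classes demanded in the definition of ⊏.
theorem le_of_idem_mul_mul_notMem {i p q : Fin n} {z : TwistedCategoryAlgebra α}
    (hz : z ∈ chainIdeal α S (i + 1))
    (h : idem α (he p) * z * idem α (he q) ∉ chainIdeal α S i) : S i ≤ S p ∧ S i ≤ S q := by
  by_contra hcon
  refine h (chainIdeal_induction α hSbij
    (p := fun z => idem α (he p) * z * idem α (he q) ∈ chainIdeal α S i) ?_ ?_ ?_ ?_ hz)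
  · rw [mul_zero, zero_mul]; exact Submodule.zero_mem _
  · intro x y hx hy
    rw [mul_add, add_mul]; exact Submodule.add_mem _ hx hy
  · intro c x hx
    rw [mul_smul_comm, smul_mul_assoc]; exact Submodule.smul_mem _ c hx
  · intro s hs
    unfold idem
    rw [smul_mul_assoc, smul_mul_assoc, mul_smul_comm]
    refine Submodule.smul_mem _ _ (Submodule.smul_mem _ _ ?_)
    by_cases h₁ : s.cod = X p
    · by_cases h₂ : X q = s.dom
      · obtain ⟨Y, Z, s⟩ := s
        obtain rfl : Z = X p := h₁
        obtain rfl : X q = Y := h₂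
        rw [of_comp, smul_mul_assoc, of_comp]
        refine Submodule.smul_mem _ _ (Submodule.smul_mem _ _ (of_mem_chainIdeal α hSbij ?_))
        have hw := (classIndex_mono hSbij hSord (Mor.comp_le_right (e q) (s ≫ e p))).trans
          (classIndex_mono hSbij hSord (Mor.comp_le_left s (e p)))
        refine lt_of_le_of_ne (hw.trans (Nat.lt_succ_iff.1 hs)) fun heq => hcon ?_
        have hSi := apply_classIndex hSbij ⟨X q, X p, e q ≫ s ≫ e p⟩
        rw [Fin.ext heq] at hSi
        rw [hSi, ← heS p, ← heS q, jClass_le_iff, jClass_le_iff]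
        refine ⟨?_, Mor.comp_le_left _ _⟩
        rw [← Category.assoc]
        exact Mor.comp_le_right _ _
      · rw [mul_assoc, of_not_comp α s _ h₂, mul_zero]
        exact Submodule.zero_mem _
    · rw [of_not_comp α _ s h₁, zero_mul]
      exact Submodule.zero_mem _

include hSbij hSord in
theorem le_of_labelIdempotent_mul_mul_notMem {i : Fin n} {a b : Σ i, Fin (l i)}
    {z : TwistedCategoryAlgebra α} (hz : z ∈ chainIdeal α S (i + 1))
    (h : labelIdempotent α he T a * z * labelIdempotent α he T b ∉ chainIdeal α S i) :
    S i ≤ S a.1 ∧ S i ≤ S b.1 := by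
  obtain ⟨-, b₁, hb₁, -⟩ := labelIdempotent_spec α he T hT a
  obtain ⟨-, b₂, hb₂, -⟩ := labelIdempotent_spec α he T hT b
  have h₁ : labelIdempotent α he T a * idem α (he a.1) = labelIdempotent α he T a :=
    hb₁ ▸ ((Subsemigroup.mem_corner_iff (idem_isIdempotentElem α (he a.1))).1 b₁.2).2
  have h₂ : idem α (he b.1) * labelIdempotent α he T b = labelIdempotent α he T b :=
    hb₂ ▸ ((Subsemigroup.mem_corner_iff (idem_isIdempotentElem α (he b.1))).1 b₂.2).1
  refine le_of_idem_mul_mul_notMem α hSbij hSord he heS hz fun hmem => h ?_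
  rw [← h₁, ← h₂, show labelIdempotent α he T a * idem α (he a.1) * z *
    (idem α (he b.1) * labelIdempotent α he T b) = labelIdempotent α he T a *
      (idem α (he a.1) * z * idem α (he b.1)) * labelIdempotent α he T b by
        simp only [mul_assoc]]
  exact mul_mem_chainIdeal_right α hSbij hSord
    (mul_mem_chainIdeal_left α hSbij hSord _ hmem) _

omit heS hT in
theorem labelOrder_lt_of_labelRel {a b : Σ i, Fin (l i)} (h : LabelRel α S he T b a) :
    (labelOrder α S he T).lt b a := by
  refine ⟨.single (.inr h), fun h' => ?_⟩
  rcases LabelLE.eq_or_lt α S he T h' with rfl | h'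
  · exact lt_irrefl _ h.1
  · exact h'.not_gt h.1

/-- A nonzero product modulo the smaller ideal gives S_i ≤ S_j for the two classes; distinct indices
make it strict, so the two halves of ⊏ supply the two comparison axioms. -/
theorem isAdaptedOrder : IsAdaptedOrder (chainLeftIdeal α hSbij hSord)
    (fun i => idem_isIdempotentElem α (he i)) (fun i r => Inflation α (he i) (T i r))
    (labelIdempotent α he T) (labelOrder α S he T) where
  idem a := (labelIdempotent_spec α he T hT a).1
  acts a := (labelIdempotent_spec α he T hT a).2
  index_lt a b h := by
    rcases LabelLE.eq_or_lt α S he T h.1 with rfl | h'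
    · exact absurd h.1 h.2
    · exact hSord _ _ h'
  lt_of_left a b hab z hz h :=
    labelOrder_lt_of_labelRel α he T ⟨lt_of_le_of_ne
      (le_of_labelIdempotent_mul_mul_notMem α hSbij hSord he heS T hT hz h).1
      fun h => hab (hSbij.1 h), .inl ⟨z, hz, h⟩⟩
  lt_of_right a b hab z hz h :=
    labelOrder_lt_of_labelRel α he T ⟨lt_of_le_of_ne
      (le_of_labelIdempotent_mul_mul_notMem α hSbij hSord he heS T hT hz h).2
      fun h => hab (hSbij.1 h), .inr ⟨z, hz, h⟩⟩

end TwistedCategoryAlgebra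

end
-- The classification of the simple modules is part of the first conjunct, as the field `simples` of
-- `IsQuasiHereditary`.
theorem mainTheorem1 {C : Type u} [Category.{v} C] [Finite (Mor C)] (hsplit : IsSplitCategory C)
    {k : Type w} [Field k] (α : TwoCocycle C k)
    {n : ℕ} (S : Fin n → JClass C) (hSbij : Function.Bijective S)
    (hSord : ∀ i j, S i < S j → i < j)
    {X : Fin n → C} {e : ∀ i, End (X i)} (he : ∀ i, IsIdempotentElem (e i))
    (heS : ∀ i, jClass (⟨X i, X i, e i⟩ : Mor C) = S i)
    (hΓ : ∀ i, (Nat.card (MaximalSubgroup (he i)) : k) ≠ 0)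
    {l : Fin n → ℕ} (T : ∀ i, Fin (l i) → Type x)
    [∀ i r, AddCommGroup (T i r)]
    [∀ i r, Module (TwistedCategoryAlgebra.groupAlgebra α (he i)) (T i r)]
    (hT : ∀ i, IsSimpleRepresentatives (TwistedCategoryAlgebra.groupAlgebra α (he i)) (T i)) :
    IsQuasiHereditary (TwistedCategoryAlgebra α)
      (fun a : Σ i, Fin (l i) =>
        Head (TwistedCategoryAlgebra α) (TwistedCategoryAlgebra.Delta α (he a.1) (T a.1 a.2)))
      (TwistedCategoryAlgebra.labelOrder α S he T) ∧
    ∀ a : Σ i, Fin (l i),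
      IsStandardModule (TwistedCategoryAlgebra α)
        (fun b : Σ i, Fin (l i) =>
          Head (TwistedCategoryAlgebra α) (TwistedCategoryAlgebra.Delta α (he b.1) (T b.1 b.2)))
        (TwistedCategoryAlgebra.labelOrder α S he T) a
        (TwistedCategoryAlgebra.Delta α (he a.1) (T a.1 a.2)) := by
  have : IsArtinianRing (TwistedCategoryAlgebra α) :=
    IsArtinianRing.of_finite k (TwistedCategoryAlgebra α)
  have H := TwistedCategoryAlgebra.isStratifying α hSbij hSord he heS T hT hsplit hΓ
  have O := TwistedCategoryAlgebra.isAdaptedOrder α hSbij hSord he heS T hT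
  exact ⟨O.isQuasiHereditary H, fun a => O.isStandardModule H a (LinearEquiv.refl _ _)⟩
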